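/- Let $d\ge 1$, $\alpha\in(0,1)$, $\mu\in\mathbb R^d$ and $\Sigma\in\mathbb R^{d\times d}$ symmetric positive definite; let $\gamma=\mathcal N(\mu,\Sigma)$, let $f$ be its density and $\lambda$ the Lebesgue measure. Let the data points $(X_i,Y_i,(\hat Y_i^m)_{m\ge 1})$, $i\ge 1$, be i.i.d.; conditionally on the covariate $X_i$ (with values in any measurable space), the response $Y_i$ and the generated draws $\hat Y_i^1,\hat Y_i^2,\dots$ are i.i.d. with law $\gamma$, which does not depend on $X_i$. For a score $s(y\mid \hat y^1,\dots,\hat y^M)$, the conformal set with ensemble size $M$ and $N$ calibration points is $$\hat C=\{y: s(y\mid \hat Y_{N+1}^{1:M})\le Q_{1-\alpha}(\{s(Y_i\mid \hat Y_i^{1:M})\}_{i=1}^N\cup\{\infty\})\},$$ where $Q_{b}(z_1,\dots,z_n)=\inf\{x:\frac1n\#\{i:z_i\le x\}\ge b\}$. Let $\hat C^{\mathrm{CP4Gen}}_{M,N}$ be this set for the CP4Gen score with one cluster, $-\log \mathcal N(y;\hat\mu,\hat\Sigma+\beta_M^2 I)$, where $\hat\mu,\hat\Sigma$ are the mean and covariance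 (normalized by $1/M$) of the ensemble, and $\beta_M\to0$ is any sequence of nuggets (for instance $\beta_M=0$). Let $\hat C^{\mathrm{PCP}}_{M,N}$ be this set for the PCP score $\min_{m\le M}\|y-\hat y^m\|$. Then there is $\tau>0$ such that $C=\{f\ge\tau\}$ satisfies $\gamma(C)=1-\alpha$, and the following hold. 1. $C$ is volume-optimal: every jointly measurable random set $A$ (on the given probability space) with $\mathbb E\,\gamma(A)\ge 1-\alpha$ satisfies $\mathbb E\,\lambda(A)\ge\lambda(C)$. 2. CP4Gen is asymptotically volume-optimal: $\mathbb E\,\lambda(\hat C^{\mathrm{CP4Gen}}_{M,N}\,\triangle\, C)\to0$ and $\mathbb E\,\lambda(\hat C^{\mathrm{CP4Gen}}_{M,N})\to\lambda(C)$ as $M,N\to\infty$ (jointly, in any manner). 3. For all $M\ge1$ and $N\ge 0$, $\hat C^{\mathrm{PCP}}_{M,N}$ is either $\mathbb R^d$ or the union of the $M$ closed balls of one common radius around $\hat Y_{N+1}^1,\dots,\hat Y_{N+1}^M$; and for every $\sigma>0$ it equals the conformal set of the score $-\log\max_{m\le M}\frac1M\mathcal N(y;\hat y^m,\sigma^2I)$,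 i.e. of the negative logarithm of the largest term of the kernel density estimate $\hat f_{M,\sigma}(y)=\frac1M\sum_{m\le M}\mathcal N(y;\hat y^m,\sigma^2I)$. 4. If $\sigma_M>0$ and $\sigma_M=o(M^{-1/d})$, then for every $i$ and every $y\in\mathbb R^d$, with the ensemble at data point $i$, the difference between that largest-term score and $-\log\hat f_{M,\sigma_M}(y)$ tends to $0$ in probability as $M\to\infty$, and the estimate is inconsistent: $\hat f_{M,\sigma_M}(y)$ does not converge to $f(y)$ in probability. 5. PCP is not asymptotically volume-optimal: there is $\delta>0$ such that $\mathbb E\,\lambda(\hat C^{\mathrm{PCP}}_{M,N})\ge\lambda(C)+\delta$ for all $M\ge1$ and $N\ge0$. -/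

import Mathlib

open MeasureTheory ProbabilityTheory Filter Topology
open scoped ENNReal

namespace ConformalGen

/-- The response space `ℝᵈ` with its Euclidean norm and Lebesgue measure. -/
abbrev Resp (d : ℕ) : Type := EuclideanSpace ℝ (Fin d)

/-- The Gaussian density `𝒩(y; m, S)` on `ℝᵈ`. -/
noncomputable def gaussianDensity {d : ℕ} (m : Resp d) (S : Matrix (Fin d) (Fin d) ℝ)
    (y : Resp d) : ℝ :=
  (Real.sqrt ((2 * Real.pi) ^ d * S.det))⁻¹ *
    Real.exp (-(1 / 2) * ((y - m).ofLp ⬝ᵥ S⁻¹.mulVec (y - m).ofLp))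

/-- The superlevel set `{y : τ ≤ f y}` of a density `f`. -/
def superlevelSet {d : ℕ} (f : Resp d → ℝ) (τ : ℝ) : Set (Resp d) := {y | τ ≤ f y}

/-! ### Split conformal prediction with an ensemble score -/

/-- The empirical quantile `inf {x : (1/n) #{i : z i ≤ x} ≥ b}` of finitely many extended reals. -/
noncomputable def empiricalQuantile {ι : Type} [Fintype ι] (b : ℝ) (z : ι → EReal) : EReal :=
  sInf {x : EReal | b ≤ (Nat.card {i // z i ≤ x} : ℝ) / (Fintype.card ι : ℝ)}

/-- `Q_b({z 0, …, z (N-1)} ∪ {∞})`. -/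
noncomputable def conformalThreshold (b : ℝ) (N : ℕ) (z : ℕ → ℝ) : EReal :=
  empiricalQuantile b (fun o : Option (Fin N) => o.elim (⊤ : EReal) (fun i => (z i : EReal)))

/-- The conformal set at nominal level `1 - α` for a score `s` that depends on the ensemble at the
data point. The calibration data are the points `0, …, N-1`, with responses `Y i` and ensembles
`ens i`; the test point has index `N`, and only its ensemble `ens N` is used. -/
def conformalSet {d M : ℕ} (s : (Fin M → Resp d) → Resp d → ℝ) (α : ℝ) (N : ℕ)
    (Y : ℕ → Resp d) (ens : ℕ → Fin M → Resp d) : Set (Resp d) :=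
  {y | (s (ens N) y : EReal) ≤ conformalThreshold (1 - α) N (fun i => s (ens i) (Y i))}

/-! ### The CP4Gen score -/

/-- The number of ensemble members that the clustering `c` puts into cluster `k`. -/
def clusterSize {M K : ℕ} (c : Fin M → Fin K) (k : Fin K) : ℕ :=
  (Finset.univ.filter (fun m => c m = k)).card

/-- The sample mean of cluster `k`. -/
noncomputable def clusterMean {d M K : ℕ} (c : Fin M → Fin K) (e : Fin M → Resp d) (k : Fin K) :
    Resp d :=
  (clusterSize c k : ℝ)⁻¹ • ∑ m ∈ Finset.univ.filter (fun m => c m = k), e m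

/-- The sample covariance of cluster `k`. -/
noncomputable def clusterCov {d M K : ℕ} (c : Fin M → Fin K) (e : Fin M → Resp d) (k : Fin K) :
    Matrix (Fin d) (Fin d) ℝ :=
  Matrix.of fun a b => (clusterSize c k : ℝ)⁻¹ *
    ∑ m ∈ Finset.univ.filter (fun m => c m = k),
      (e m a - clusterMean c e k a) * (e m b - clusterMean c e k b)

/-- The CP4Gen score of a clustering `c` of the ensemble `e` into `K` clusters, with nugget `β²`:
`-log max_k w_k 𝒩(y; μ_k, Σ_k + β² I)`. -/
noncomputable def cp4genScore {d M K : ℕ} (c : Fin M → Fin K) (β : ℝ) (e : Fin M → Resp d)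
    (y : Resp d) : ℝ :=
  -Real.log (⨆ k : Fin K, ((clusterSize c k : ℝ) / (M : ℝ)) *
    gaussianDensity (clusterMean c e k) (clusterCov c e k + β ^ 2 • (1 : Matrix _ _ ℝ)) y)

/-! ### The PCP score and the kernel density estimator behind it -/

/-- The PCP score: the distance from `y` to the nearest ensemble member. -/
noncomputable def pcpScore {d M : ℕ} (e : Fin M → Resp d) (y : Resp d) : ℝ :=
  ⨅ m : Fin M, ‖y - e m‖

/-- The Gaussian kernel density estimate with bandwidth `σ`. -/
noncomputable def kde {d M : ℕ} (σ : ℝ) (e : Fin M → Resp d) (y : Resp d) : ℝ :=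
  ∑ m : Fin M, (1 / (M : ℝ)) * gaussianDensity (e m) (σ ^ 2 • (1 : Matrix _ _ ℝ)) y

/-- The negative log-density score of the kernel density estimate. -/
noncomputable def kdeScore {d M : ℕ} (σ : ℝ) (e : Fin M → Resp d) (y : Resp d) : ℝ :=
  -Real.log (kde σ e y)

/-- The same score with the sum replaced by its largest term. -/
noncomputable def kdeMaxScore {d M : ℕ} (σ : ℝ) (e : Fin M → Resp d) (y : Resp d) : ℝ :=
  -Real.log (⨆ m : Fin M, (1 / (M : ℝ)) * gaussianDensity (e m) (σ ^ 2 • (1 : Matrix _ _ ℝ)) y)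

/-! ### The data -/

/-- The data points `(X i, Y i, (Yhat i m)_m)` are i.i.d.; `X i` has law `PX`, and conditionally on
`X i` the response `Y i` and the generated `Yhat i 0, Yhat i 1, …` are i.i.d. with law `γ`, which
does not depend on `X i`. The ensemble of size `M` consists of the first `M` generated draws. -/
structure IsSample {Ω 𝒳 : Type*} [MeasurableSpace Ω] [MeasurableSpace 𝒳] {d : ℕ}
    (P : Measure Ω) (PX : Measure 𝒳) (γ : Measure (Resp d))
    (X : ℕ → Ω → 𝒳) (Y : ℕ → Ω → Resp d) (Yhat : ℕ → ℕ → Ω → Resp d) : Prop where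
  measurable_X : ∀ i, Measurable (X i)
  measurable_Y : ∀ i, Measurable (Y i)
  measurable_Yhat : ∀ i m, Measurable (Yhat i m)
  indep : iIndepFun (fun i ω => (X i ω, Y i ω, fun m => Yhat i m ω)) P
  law : ∀ i, P.map (fun ω => (X i ω, Y i ω, fun m => Yhat i m ω)) =
    PX.prod (γ.prod (Measure.infinitePi fun _ : ℕ => γ))

/-- The first `M` draws at every data point. -/
def ensemble {Ω : Type*} {d : ℕ} (Yhat : ℕ → ℕ → Ω → Resp d) (M : ℕ) (ω : Ω) :
    ℕ → Fin M → Resp d :=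
  fun i m => Yhat i m ω

/-- The random CP4Gen set with one cluster (a plug-in Gaussian fit), nugget `β²`, ensemble size `M`
and `N` calibration points. -/
noncomputable def cp4genSet {Ω : Type*} {d : ℕ} (Y : ℕ → Ω → Resp d) (Yhat : ℕ → ℕ → Ω → Resp d)
    (α β : ℝ) (M N : ℕ) (ω : Ω) : Set (Resp d) :=
  conformalSet (cp4genScore (fun _ : Fin M => (0 : Fin 1)) β) α N (fun i => Y i ω)
    (ensemble Yhat M ω)

/-- The random PCP set with ensemble size `M` and `N` calibration points. -/
noncomputable def pcpSet {Ω : Type*} {d : ℕ} (Y : ℕ → Ω → Resp d) (Yhat : ℕ → ℕ → Ω → Resp d)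
    (α : ℝ) (M N : ℕ) (ω : Ω) : Set (Resp d) :=
  conformalSet (pcpScore (M := M)) α N (fun i => Y i ω) (ensemble Yhat M ω)

end ConformalGen

/-!
# Volume-optimal conformal sets from generated ensembles

The set `C` is a superlevel set of the Gaussian density `f`. Level sets of `f` are Lebesgue null, so
every mass is attained by some level `τ` (`exists_superlevelSet_mass`), and optimality is the
Neyman–Pearson lemma: `C` minimizes `τ λ(A) - γ(A)` over all sets `A`, and this inequality is
integrated over the random set (`volume_superlevelSet_le_lintegral`).

A point belongs to a conformal set iff fewer than `(1 - α) (N + 1)` calibration scores lie strictly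
below its score (`mem_conformalSet_iff`). Hence the set depends only on the order of the scores, and
since the largest term of the kernel density estimate is a decreasing function of the distance to the
nearest draw, it gives the same set as PCP. When the bandwidth is `o(M ^ (-1 / d))`, the nearest draw
is many bandwidths away from `y`, and the gaps between squared distances are large compared with the
squared bandwidth: the largest term dominates the sum, while the estimate itself tends to `0`
in probability (`IsSample.tendstoInMeasure_kdeMaxScore_sub`, `IsSample.tendsto_measure_le_kde`).

PCP is not volume-optimal because of a dichotomy (`exists_miss_add_hit_volume`). Fix a region `U₁`
of high density inside `C` and a region `U₂` of lower density outside `C`. Balls of one common radius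
around the draws cover points of `U₂` with a probability that is comparable to the one for `U₁`,
whatever `M` and the radius are, so the PCP set misses a fixed share of `U₁` or contains a fixed
share of `U₂`. As it has mean mass at least `1 - α` by exchangeability
(`IsSample.le_lintegral_pcpSet_mass`), the Neyman–Pearson inequality with its slack term
(`neymanPearson_slack`) turns this share into excess volume.

For CP4Gen with one cluster the score is the negative log-density of the plug-in Gaussian fit, which
is strongly consistent (`IsSample.ae_tendsto_fit`). Together with the law of large numbers for the
calibration responses this squeezes the CP4Gen set between two level sets of `f` close to `C`, with
probability tending to one (`IsSample.tendsto_measure_not_sandwich`). To pass from probability to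
expected volume, the second moment of the volume has to be bounded uniformly
(`IsSample.exists_volume_sq_bound`). The volume is controlled by powers of the trace and of the
inverse determinant of the fitted covariances, at the test point and averaged over the calibration
points. Negative moments of the determinant come from the identity that `∫ exp (- vᵀ A v / 2) dv` is
proportional to `(det A) ^ (-1 / 2)`, together with a bound on the Laplace transform of the empirical
quadratic form, for which disjoint pairs of draws supply independent summands
(`IsSample.exists_lintegral_quadIntegral_le`).
-/

namespace ConformalGen

/-! ### The Gaussian density -/

open scoped RealInnerProductSpace MatrixOrder

/-- The standard Gaussian measure has density `(2π)^(-d/2) exp (-‖x‖² / 2)`. -/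
lemma stdGaussian_eq_withDensity (d : ℕ) :
    stdGaussian (Resp d) = volume.withDensity fun x : Resp d =>
      ENNReal.ofReal ((Real.sqrt ((2 * Real.pi) ^ d))⁻¹ * Real.exp (-(1 / 2) * ‖x‖ ^ 2)) := by
  have hπ : (0 : ℝ) < 2 * Real.pi := by positivity
  have hint : Integrable (fun x : Resp d => Real.exp (-(1 / 2) * ‖x‖ ^ 2)) := by
    have h := GaussianFourier.integrable_cexp_neg_mul_sq_norm_add (V := Resp d)
      (b := (1 / 2 : ℂ)) (by norm_num) 0 0
    have h2 := h.re
    refine h2.congr (Eventually.of_forall fun x => ?_)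
    simp only [zero_mul, add_zero]
    have : (-(1 / 2 : ℂ) * (‖x‖ : ℂ) ^ 2) = ((-(1 / 2) * ‖x‖ ^ 2 : ℝ) : ℂ) := by push_cast; ring
    rw [this]
    exact Complex.exp_ofReal_re _
  have hfin : IsFiniteMeasure (volume.withDensity fun x : Resp d =>
      ENNReal.ofReal ((Real.sqrt ((2 * Real.pi) ^ d))⁻¹ * Real.exp (-(1 / 2) * ‖x‖ ^ 2))) :=
    isFiniteMeasure_withDensity_ofReal (hint.const_mul _).2
  apply Measure.ext_of_charFun
  ext t
  rw [charFun_stdGaussian, charFun_apply, integral_withDensity_eq_integral_toReal_smul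
    (by fun_prop) (Eventually.of_forall fun _ => ENNReal.ofReal_lt_top)]
  have hsq : ((Real.sqrt ((2 * Real.pi) ^ d) : ℝ) : ℂ) = (2 * Real.pi : ℂ) ^ (d / 2 : ℂ) := by
    rw [Real.sqrt_eq_rpow, ← Real.rpow_natCast, ← Real.rpow_mul hπ.le,
      Complex.ofReal_cpow hπ.le]
    push_cast
    congr 1
    ring
  have h1 := GaussianFourier.integral_cexp_neg_mul_sq_norm_add (V := Resp d)
      (b := (1 / 2 : ℂ)) (by norm_num) Complex.I t
  have h2 : (Real.pi / (1 / 2) : ℂ) = 2 * Real.pi := by ring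
  rw [h2] at h1
  have hne : (2 * Real.pi : ℂ) ^ (d / 2 : ℂ) ≠ 0 := by
    rw [← hsq]
    exact_mod_cast (Real.sqrt_pos.2 (by positivity)).ne'
  have h3 : ∀ x : Resp d, (ENNReal.ofReal ((Real.sqrt ((2 * Real.pi) ^ d))⁻¹ *
      Real.exp (-(1 / 2) * ‖x‖ ^ 2))).toReal • Complex.exp (⟪x, t⟫ * Complex.I) =
      ((2 * Real.pi : ℂ) ^ (d / 2 : ℂ))⁻¹ *
        Complex.exp (-(1 / 2) * ‖x‖ ^ 2 + Complex.I * ⟪t, x⟫) := by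
    intro x
    rw [ENNReal.toReal_ofReal (by positivity), Complex.exp_add, ← hsq, real_inner_comm,
      Complex.real_smul, mul_comm Complex.I]
    push_cast
    ring
  simp_rw [h3]
  rw [integral_const_mul, h1]
  simp only [finrank_euclideanSpace, Fintype.card_fin]
  rw [inv_mul_cancel_left₀ hne]
  congr 1
  simp
  ring

variable {d : ℕ} {S : Matrix (Fin d) (Fin d) ℝ}

lemma sqrt_mul_sqrt (hS : S.PosDef) : CFC.sqrt S * CFC.sqrt S = S :=
  CFC.sqrt_mul_sqrt_self S hS.posSemidef.nonneg

lemma sqrt_transpose : (CFC.sqrt S).transpose = CFC.sqrt S := by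
  have h := (CFC.sqrt_nonneg S).isSelfAdjoint
  rwa [isSelfAdjoint_iff, Matrix.star_eq_conjTranspose, Matrix.conjTranspose_eq_transpose_of_trivial]
    at h

lemma det_sqrt_sq (hS : S.PosDef) : (CFC.sqrt S).det * (CFC.sqrt S).det = S.det := by
  rw [← Matrix.det_mul, sqrt_mul_sqrt hS]

lemma det_sqrt_ne_zero (hS : S.PosDef) : (CFC.sqrt S).det ≠ 0 := by
  intro h
  have := det_sqrt_sq hS
  rw [h] at this
  exact hS.det_pos.ne (by simpa using this)

/-- The affine map that takes the standard Gaussian to the one with mean `μ` and covariance `S`. -/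
noncomputable def whitenInv (μ : Resp d) (S : Matrix (Fin d) (Fin d) ℝ) (x : Resp d) : Resp d :=
  μ + Matrix.toEuclideanCLM (𝕜 := ℝ) (CFC.sqrt S) x

lemma measurable_whitenInv (μ : Resp d) : Measurable (whitenInv μ S) := by
  unfold whitenInv; fun_prop

lemma volume_map_whitenInv (hS : S.PosDef) (μ : Resp d) :
    (volume : Measure (Resp d)).map (whitenInv μ S) =
      ENNReal.ofReal |((CFC.sqrt S).det)⁻¹| • volume := by
  have h1 : (whitenInv μ S) = (fun x => μ + x) ∘ (Matrix.toEuclideanCLM (𝕜 := ℝ) (CFC.sqrt S)) := rfl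
  have hdet : LinearMap.det ((Matrix.toEuclideanCLM (𝕜 := ℝ) (CFC.sqrt S)) :
      Resp d →ₗ[ℝ] Resp d) = (CFC.sqrt S).det := by
    rw [Matrix.coe_toEuclideanCLM_eq_toEuclideanLin]
    change LinearMap.det (Matrix.toLpLin 2 2 (CFC.sqrt S)) = _
    rw [Matrix.toLpLin_eq_toLin, LinearMap.det_toLin]
  have h2 := Measure.map_linearMap_addHaar_eq_smul_addHaar (volume : Measure (Resp d))
    (f := ((Matrix.toEuclideanCLM (𝕜 := ℝ) (CFC.sqrt S)) : Resp d →ₗ[ℝ] Resp d))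
    (by rw [hdet]; exact det_sqrt_ne_zero hS)
  rw [hdet] at h2
  rw [h1, ← Measure.map_map (measurable_const_add μ) (by fun_prop)]
  erw [h2]
  rw [Measure.map_smul, map_add_left_eq_self]

lemma quadForm_whitenInv (hS : S.PosDef) (μ x : Resp d) :
    (whitenInv μ S x - μ).ofLp ⬝ᵥ S⁻¹.mulVec (whitenInv μ S x - μ).ofLp = ‖x‖ ^ 2 := by
  have h1 : (whitenInv μ S x - μ).ofLp = (CFC.sqrt S).mulVec x.ofLp := by
    simp [whitenInv]
  have hu : IsUnit (CFC.sqrt S).det := isUnit_iff_ne_zero.2 (det_sqrt_ne_zero hS)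
  have h2 : S⁻¹ * CFC.sqrt S = (CFC.sqrt S)⁻¹ := by
    conv_lhs => rw [← sqrt_mul_sqrt hS]
    rw [CFC.sqrt_mul_sqrt_self S hS.posSemidef.nonneg]
    nth_rewrite 1 [← sqrt_mul_sqrt hS]
    rw [Matrix.mul_inv_rev, Matrix.mul_assoc, Matrix.nonsing_inv_mul _ hu, Matrix.mul_one]
  rw [h1, Matrix.mulVec_mulVec, h2]
  nth_rewrite 1 [← sqrt_transpose (S := S)]
  rw [Matrix.mulVec_transpose, ← Matrix.dotProduct_mulVec, Matrix.mulVec_mulVec,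
    Matrix.mul_nonsing_inv _ hu, Matrix.one_mulVec, EuclideanSpace.real_norm_sq_eq]
  simp [dotProduct, sq]

lemma continuous_gaussianDensity (μ : Resp d) : Continuous (gaussianDensity μ S) := by
  unfold gaussianDensity
  simp only [dotProduct, Matrix.mulVec]
  fun_prop

lemma gaussianDensity_pos (hS : S.PosDef) (μ y : Resp d) : 0 < gaussianDensity μ S y := by
  have := hS.det_pos
  unfold gaussianDensity
  positivity

lemma gaussianDensity_whitenInv (hS : S.PosDef) (μ x : Resp d) :
    gaussianDensity μ S (whitenInv μ S x) =
      |((CFC.sqrt S).det)⁻¹| * ((Real.sqrt ((2 * Real.pi) ^ d))⁻¹ *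
        Real.exp (-(1 / 2) * ‖x‖ ^ 2)) := by
  unfold gaussianDensity
  rw [quadForm_whitenInv hS, Real.sqrt_mul (by positivity), ← det_sqrt_sq hS,
    Real.sqrt_mul_self_eq_abs, mul_inv, abs_inv]
  ring

/-- The multivariate Gaussian with positive definite covariance has the usual Lebesgue density. -/
theorem multivariateGaussian_eq_withDensity (hS : S.PosDef) (μ : Resp d) :
    multivariateGaussian μ S =
      volume.withDensity fun y => ENNReal.ofReal (gaussianDensity μ S y) := by
  have hm : Measurable fun y => ENNReal.ofReal (gaussianDensity μ S y) :=
    (continuous_gaussianDensity μ).measurable.ennreal_ofReal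
  have hvol := volume_map_whitenInv hS μ
  have hc : (0 : ℝ) < |((CFC.sqrt S).det)⁻¹| := abs_pos.2 (inv_ne_zero (det_sqrt_ne_zero hS))
  change (stdGaussian (Resp d)).map (whitenInv μ S) = _
  ext s hs
  rw [Measure.map_apply (measurable_whitenInv μ) hs, stdGaussian_eq_withDensity,
    withDensity_apply _ (measurable_whitenInv μ hs), withDensity_apply _ hs]
  have h1 : ∫⁻ y in s, ENNReal.ofReal (gaussianDensity μ S y)
      ∂((volume : Measure (Resp d)).map (whitenInv μ S)) =
      ENNReal.ofReal |((CFC.sqrt S).det)⁻¹| * ∫⁻ y in s, ENNReal.ofReal (gaussianDensity μ S y) := by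
    rw [hvol, Measure.restrict_smul, lintegral_smul_measure, smul_eq_mul]
  rw [setLIntegral_map hs hm (measurable_whitenInv μ)] at h1
  simp_rw [gaussianDensity_whitenInv hS, ENNReal.ofReal_mul hc.le] at h1
  rw [lintegral_const_mul _ (by fun_prop)] at h1
  have h2 := (ENNReal.mul_right_inj (ENNReal.ofReal_pos.2 hc).ne' ENNReal.ofReal_ne_top).1 h1
  rw [← h2]

/-- Level sets of a Gaussian density are images of spheres, hence Lebesgue null. -/
lemma volume_gaussianDensity_eq (hd : 0 < d) (hS : S.PosDef) (μ : Resp d) (c : ℝ) :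
    volume {y | gaussianDensity μ S y = c} = 0 := by
  have : Nonempty (Fin d) := ⟨⟨0, hd⟩⟩
  have hms : MeasurableSet {y | gaussianDensity μ S y = c} :=
    (isClosed_eq (continuous_gaussianDensity μ) continuous_const).measurableSet
  have hc : (0 : ℝ) < |((CFC.sqrt S).det)⁻¹| := abs_pos.2 (inv_ne_zero (det_sqrt_ne_zero hS))
  have h := congrArg (fun m => m {y | gaussianDensity μ S y = c}) (volume_map_whitenInv hS μ)
  simp only [Measure.smul_apply, smul_eq_mul] at h
  rw [Measure.map_apply (measurable_whitenInv μ) hms] at h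
  have h0 : volume (whitenInv μ S ⁻¹' {y | gaussianDensity μ S y = c}) = 0 := by
    rcases Set.eq_empty_or_nonempty (whitenInv μ S ⁻¹' {y | gaussianDensity μ S y = c}) with h0 | h0
    · simp [h0]
    · obtain ⟨x₀, hx₀⟩ := h0
      refine measure_mono_null (t := Metric.sphere (0 : Resp d) ‖x₀‖) (fun x hx => ?_)
        (Measure.addHaar_sphere _ _ _)
      simp only [Set.mem_preimage, Set.mem_ofPred_eq, gaussianDensity_whitenInv hS] at hx hx₀
      rw [← hx₀] at hx
      have h1 := mul_left_cancel₀ hc.ne' hx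
      have h2 := mul_left_cancel₀ (by positivity) h1
      have h3 := Real.exp_injective h2
      rw [mem_sphere_zero_iff_norm]
      have h4 : ‖x‖ ^ 2 = ‖x₀‖ ^ 2 := by linarith
      exact (pow_left_inj₀ (norm_nonneg _) (norm_nonneg _) two_ne_zero).1 h4
  rw [h0] at h
  exact (mul_eq_zero.1 h.symm).resolve_left (ENNReal.ofReal_pos.2 hc).ne'

end ConformalGen

namespace ConformalGen

/-! ### Highest-density sets and the Neyman–Pearson inequality -/

open scoped MatrixOrder

/-- A real law without atoms takes every intermediate value as the mass of a half-line. -/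
lemma exists_measure_Iic_eq (ν : Measure ℝ) [IsProbabilityMeasure ν] (hν : ∀ x, ν {x} = 0)
    {a : ℝ} (h0 : 0 < a) (h1 : a < 1) : ∃ x, ν (Set.Iic x) = ENNReal.ofReal a := by
  have hcont : Continuous (cdf ν) := by
    rw [continuous_iff_continuousAt]
    intro x
    rw [(monotone_cdf ν).continuousAt_iff_leftLim_eq_rightLim, StieltjesFunction.rightLim_eq]
    have h := hν x
    rw [← measure_cdf ν, StieltjesFunction.measure_singleton, ENNReal.ofReal_eq_zero] at h
    exact le_antisymm ((monotone_cdf ν).leftLim_le le_rfl) (by linarith)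
  obtain ⟨x, hx⟩ := mem_range_of_exists_le_of_exists_ge hcont
    (((tendsto_cdf_atBot ν).eventually (eventually_lt_nhds h0)).exists.imp fun _ h => h.le)
    (((tendsto_cdf_atTop ν).eventually (eventually_gt_nhds h1)).exists.imp fun _ h => h.le)
  exact ⟨x, by rw [← ofReal_cdf, hx]⟩

variable {d : ℕ} {S : Matrix (Fin d) (Fin d) ℝ}

lemma measurableSet_superlevelSet {f : Resp d → ℝ} (hf : Measurable f) (τ : ℝ) :
    MeasurableSet (superlevelSet f τ) := measurableSet_le measurable_const hf

lemma multivariateGaussian_absolutelyContinuous (hS : S.PosDef) (μ : Resp d) :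
    multivariateGaussian μ S ≪ volume := by
  rw [multivariateGaussian_eq_withDensity hS]
  exact withDensity_absolutelyContinuous _ _

lemma volume_absolutelyContinuous_multivariateGaussian (hS : S.PosDef) (μ : Resp d) :
    volume ≪ multivariateGaussian μ S := by
  rw [multivariateGaussian_eq_withDensity hS]
  refine withDensity_absolutelyContinuous'
    (continuous_gaussianDensity μ).measurable.ennreal_ofReal.aemeasurable
    (Eventually.of_forall fun y => (ENNReal.ofReal_pos.2 (gaussianDensity_pos hS μ y)).ne')

/-- There is a highest-density set of every mass strictly between `0` and `1`. -/
lemma exists_superlevelSet_mass (hd : 0 < d) (hS : S.PosDef) (μ : Resp d) {α : ℝ} (hα0 : 0 < α)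
    (hα1 : α < 1) : ∃ τ, 0 < τ ∧
      multivariateGaussian μ S (superlevelSet (gaussianDensity μ S) τ) =
        ENNReal.ofReal (1 - α) := by
  have hm : Measurable (gaussianDensity μ S) := (continuous_gaussianDensity μ).measurable
  have hp : IsProbabilityMeasure ((multivariateGaussian μ S).map (gaussianDensity μ S)) :=
    Measure.isProbabilityMeasure_map hm.aemeasurable
  have hν : ∀ x, (multivariateGaussian μ S).map (gaussianDensity μ S) {x} = 0 := fun x => by
    rw [Measure.map_apply hm (measurableSet_singleton x)]
    exact multivariateGaussian_absolutelyContinuous hS μ (volume_gaussianDensity_eq hd hS μ x)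
  obtain ⟨τ, hτ⟩ := exists_measure_Iic_eq _ hν hα0 hα1
  refine ⟨τ, ?_, ?_⟩
  · by_contra hneg
    rw [Measure.map_apply hm measurableSet_Iic] at hτ
    have : gaussianDensity μ S ⁻¹' Set.Iic τ = ∅ := by
      ext y
      simpa using (not_lt.1 hneg).trans_lt (gaussianDensity_pos hS μ y)
    rw [this, measure_empty] at hτ
    exact (ENNReal.ofReal_pos.2 hα0).ne hτ
  · have h1 : superlevelSet (gaussianDensity μ S) τ = gaussianDensity μ S ⁻¹' Set.Ici τ := rfl
    rw [h1, ← Measure.map_apply hm measurableSet_Ici, ← Set.compl_Iio,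
      prob_compl_eq_one_sub measurableSet_Iio]
    have h2 : (multivariateGaussian μ S).map (gaussianDensity μ S) (Set.Iio τ) =
        (multivariateGaussian μ S).map (gaussianDensity μ S) (Set.Iic τ) := by
      refine le_antisymm (measure_mono Set.Iio_subset_Iic_self) ?_
      rw [← Set.Iio_union_right]
      exact (measure_union_le _ _).trans (by simp [hν])
    rw [h2, hτ, ENNReal.ofReal_sub _ hα0.le, ENNReal.ofReal_one]

/-- The Neyman–Pearson inequality with slack: `C = {τ ≤ f}` minimizes `τ λ(A) - γ(A)`, and a set
`A` that misses a part of `{τ + κ ≤ f}` or hits a part of `{f ≤ τ - κ}` loses at least `κ` times the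
volume of that part. -/
lemma neymanPearson_slack {f : Resp d → ℝ} (hf : Measurable f) (hf0 : ∀ y, 0 ≤ f y)
    {τ κ : ℝ} (hτ : 0 ≤ τ) (hκ : 0 ≤ κ) {U₁ U₂ A : Set (Resp d)} (hA : MeasurableSet A)
    (hU₁ : MeasurableSet U₁) (hU₂ : MeasurableSet U₂)
    (h₁ : ∀ y ∈ U₁, τ + κ ≤ f y) (h₂ : ∀ y ∈ U₂, f y < τ ∧ f y + κ ≤ τ) :
    (volume.withDensity fun y => ENNReal.ofReal (f y)) A +
        ENNReal.ofReal τ * volume (superlevelSet f τ) +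
        ENNReal.ofReal κ * (volume (U₁ \ A) + volume (U₂ ∩ A)) ≤
      (volume.withDensity fun y => ENNReal.ofReal (f y)) (superlevelSet f τ) +
        ENNReal.ofReal τ * volume A := by
  set C := superlevelSet f τ
  have hCm : MeasurableSet C := measurableSet_superlevelSet hf τ
  set γ := (volume : Measure (Resp d)).withDensity fun y => ENNReal.ofReal (f y) with hγ
  have hU₁C : U₁ ⊆ C := fun y hy => by
    have := h₁ y hy
    change τ ≤ f y
    linarith
  have hU₂C : U₂ ⊆ Cᶜ := fun y hy => not_le.2 (h₂ y hy).1
  have e1 : γ (A \ C) + ENNReal.ofReal κ * volume (U₂ ∩ A) ≤ ENNReal.ofReal τ * volume (A \ C) := by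
    have hsub : U₂ ∩ A ⊆ A \ C := fun y hy => ⟨hy.2, hU₂C hy.1⟩
    have h : ∫⁻ y in A \ C, (ENNReal.ofReal (f y) +
        (U₂ ∩ A).indicator (fun _ => ENNReal.ofReal κ) y) ≤ ∫⁻ _ in A \ C, ENNReal.ofReal τ := by
      refine setLIntegral_mono measurable_const fun y hy => ?_
      by_cases hyU : y ∈ U₂ ∩ A
      · rw [Set.indicator_of_mem hyU]
        rw [← ENNReal.ofReal_add (hf0 y) hκ]
        exact ENNReal.ofReal_le_ofReal (h₂ y hyU.1).2
      · rw [Set.indicator_of_notMem hyU, add_zero]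
        exact ENNReal.ofReal_le_ofReal (not_le.1 hy.2).le
    rw [lintegral_add_left hf.ennreal_ofReal, lintegral_indicator (hU₂.inter hA),
      setLIntegral_const, setLIntegral_const, Measure.restrict_apply (hU₂.inter hA), Set.inter_eq_left.2 hsub] at h
    rwa [hγ, withDensity_apply _ (hA.diff hCm)]
  have e2 : ENNReal.ofReal τ * volume (C \ A) + ENNReal.ofReal κ * volume (U₁ \ A) ≤ γ (C \ A) := by
    have hsub : U₁ \ A ⊆ C \ A := fun y hy => ⟨hU₁C hy.1, hy.2⟩
    have h : ∫⁻ y in C \ A, (ENNReal.ofReal τ +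
        (U₁ \ A).indicator (fun _ => ENNReal.ofReal κ) y) ≤
        ∫⁻ y in C \ A, ENNReal.ofReal (f y) := by
      refine setLIntegral_mono hf.ennreal_ofReal fun y hy => ?_
      by_cases hyU : y ∈ U₁ \ A
      · rw [Set.indicator_of_mem hyU, ← ENNReal.ofReal_add hτ hκ]
        exact ENNReal.ofReal_le_ofReal (h₁ y hyU.1)
      · rw [Set.indicator_of_notMem hyU, add_zero]
        exact ENNReal.ofReal_le_ofReal hy.1
    rw [lintegral_add_left measurable_const, lintegral_indicator (hU₁.diff hA),
      setLIntegral_const, setLIntegral_const, Measure.restrict_apply (hU₁.diff hA), Set.inter_eq_left.2 hsub] at h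
    rwa [hγ, withDensity_apply _ (hCm.diff hA)]
  have a1 : γ (A ∩ C) + γ (A \ C) = γ A := measure_inter_add_sdiff A hCm
  have a2 : volume (A ∩ C) + volume (A \ C) = volume A := measure_inter_add_sdiff A hCm
  have a3 : γ (C ∩ A) + γ (C \ A) = γ C := measure_inter_add_sdiff C hA
  have a4 : volume (C ∩ A) + volume (C \ A) = volume C := measure_inter_add_sdiff C hA
  rw [← a1, ← a2, ← a3, ← a4, Set.inter_comm C A]
  simp only [mul_add]
  calc _ = γ (A ∩ C) + ENNReal.ofReal τ * volume (A ∩ C) +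
        ((γ (A \ C) + ENNReal.ofReal κ * volume (U₂ ∩ A)) +
        (ENNReal.ofReal τ * volume (C \ A) + ENNReal.ofReal κ * volume (U₁ \ A))) := by ring
    _ ≤ γ (A ∩ C) + ENNReal.ofReal τ * volume (A ∩ C) +
        (ENNReal.ofReal τ * volume (A \ C) + γ (C \ A)) := by gcongr
    _ = _ := by ring

lemma dotProduct_inv_nonneg (hS : S.PosDef) (v : Fin d → ℝ) : 0 ≤ v ⬝ᵥ S⁻¹.mulVec v := by
  simpa using hS.inv.posSemidef.dotProduct_mulVec_nonneg v

lemma gaussianDensity_le (hS : S.PosDef) (μ y : Resp d) :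
    gaussianDensity μ S y ≤ gaussianDensity μ S μ := by
  have h := dotProduct_inv_nonneg hS (y - μ).ofLp
  unfold gaussianDensity
  refine mul_le_mul_of_nonneg_left (Real.exp_le_exp.2 ?_) (by positivity)
  rw [sub_self, WithLp.ofLp_zero, zero_dotProduct]
  linarith

/-- A Gaussian density takes all values between `0` and its maximum. -/
lemma exists_gaussianDensity_eq (hd : 0 < d) (hS : S.PosDef) (μ : Resp d) {c : ℝ} (hc0 : 0 < c)
    (hc : c ≤ gaussianDensity μ S μ) : ∃ y, gaussianDensity μ S y = c := by
  set c₀ := |((CFC.sqrt S).det)⁻¹| * (Real.sqrt ((2 * Real.pi) ^ d))⁻¹ with hc₀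
  have key : ∀ x, gaussianDensity μ S (whitenInv μ S x) =
      c₀ * Real.exp (-(1 / 2) * ‖x‖ ^ 2) := fun x => by
    rw [gaussianDensity_whitenInv hS, hc₀]; ring
  have hμ : gaussianDensity μ S μ = c₀ := by
    have h := key 0
    simpa [whitenInv] using h
  have hc₀pos : 0 < c₀ := hμ ▸ gaussianDensity_pos hS μ μ
  rw [hμ] at hc
  have hlog : 0 ≤ 2 * Real.log (c₀ / c) := by
    have := Real.log_nonneg ((one_le_div hc0).2 hc)
    positivity
  refine ⟨whitenInv μ S (EuclideanSpace.single ⟨0, hd⟩ (Real.sqrt (2 * Real.log (c₀ / c)))), ?_⟩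
  rw [key, PiLp.norm_single, Real.norm_eq_abs, sq_abs, Real.sq_sqrt hlog]
  rw [show -(1 / 2) * (2 * Real.log (c₀ / c)) = - Real.log (c₀ / c) by ring, Real.exp_neg,
    Real.exp_log (by positivity)]
  field_simp

lemma volume_superlevelSet_lt_top (hS : S.PosDef) (μ : Resp d) {τ : ℝ} (hτ : 0 < τ) :
    volume (superlevelSet (gaussianDensity μ S) τ) < ∞ := by
  have hm := (continuous_gaussianDensity (S := S) μ).measurable
  have h : ∫⁻ _ in superlevelSet (gaussianDensity μ S) τ, ENNReal.ofReal τ ≤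
      ∫⁻ y in superlevelSet (gaussianDensity μ S) τ, ENNReal.ofReal (gaussianDensity μ S y) :=
    setLIntegral_mono hm.ennreal_ofReal fun y hy => ENNReal.ofReal_le_ofReal hy
  rw [setLIntegral_const, ← withDensity_apply _ (measurableSet_superlevelSet hm τ),
    ← multivariateGaussian_eq_withDensity hS] at h
  by_contra hc
  rw [not_lt, top_le_iff] at hc
  rw [hc, ENNReal.mul_top (ENNReal.ofReal_pos.2 hτ).ne'] at h
  exact (measure_lt_top _ _).not_ge h

/-- The mass of a highest-density set is positive, so its level is below the maximum. -/
lemma lt_gaussianDensity_of_mass_pos (hd : 0 < d) (hS : S.PosDef) (μ : Resp d) {τ : ℝ}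
    (h : multivariateGaussian μ S (superlevelSet (gaussianDensity μ S) τ) ≠ 0) :
    τ < gaussianDensity μ S μ := by
  by_contra hτ
  refine h (measure_mono_null (fun y hy => ?_) (multivariateGaussian_absolutelyContinuous hS μ
    (volume_gaussianDensity_eq hd hS μ τ)))
  exact le_antisymm ((gaussianDensity_le hS μ y).trans (not_lt.1 hτ)) hy

/-- Averaging the Neyman–Pearson inequality over `ω`: among random sets of mean mass at least
`γ(C)`, the highest-density set `C` has the least expected volume. -/
lemma volume_superlevelSet_le_lintegral {Ω : Type*} [MeasurableSpace Ω] (P : Measure Ω)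
    [IsProbabilityMeasure P] (hS : S.PosDef) (μ : Resp d) {τ : ℝ} (hτ : 0 < τ)
    {A : Set (Ω × Resp d)} (hA : MeasurableSet A)
    (hmass : multivariateGaussian μ S (superlevelSet (gaussianDensity μ S) τ) ≤
      ∫⁻ ω, multivariateGaussian μ S (Prod.mk ω ⁻¹' A) ∂P) :
    volume (superlevelSet (gaussianDensity μ S) τ) ≤ ∫⁻ ω, volume (Prod.mk ω ⁻¹' A) ∂P := by
  set C := superlevelSet (gaussianDensity μ S) τ
  have hm := (continuous_gaussianDensity (S := S) μ).measurable
  have h : ∀ ω, multivariateGaussian μ S (Prod.mk ω ⁻¹' A) + ENNReal.ofReal τ * volume C ≤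
      multivariateGaussian μ S C + ENNReal.ofReal τ * volume (Prod.mk ω ⁻¹' A) := fun ω => by
    have h := neymanPearson_slack hm (fun y => (gaussianDensity_pos hS μ y).le) hτ.le le_rfl
      (measurable_prodMk_left (x := ω) hA) MeasurableSet.empty MeasurableSet.empty (by simp)
      (by simp)
    rw [← multivariateGaussian_eq_withDensity hS] at h
    simpa using h
  have h2 := lintegral_mono (μ := P) h
  rw [lintegral_add_right _ measurable_const, lintegral_add_left measurable_const,
    lintegral_const, lintegral_const, measure_univ, mul_one, mul_one,
    lintegral_const_mul _ (measurable_measure_prodMk_left hA)] at h2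
  have h3 : multivariateGaussian μ S C + ENNReal.ofReal τ * volume C ≤
      multivariateGaussian μ S C + ENNReal.ofReal τ * ∫⁻ ω, volume (Prod.mk ω ⁻¹' A) ∂P :=
    (by gcongr : _ ≤ _).trans h2
  have h4 := (ENNReal.add_le_add_iff_left (measure_ne_top _ _)).1 h3
  exact (ENNReal.mul_le_mul_iff_right (ENNReal.ofReal_pos.2 hτ).ne' ENNReal.ofReal_ne_top).1 h4

end ConformalGen

namespace ConformalGen

/-! ### Conformal sets as rank conditions -/

/-- A real number lies below the conformal threshold iff fewer than `b (N + 1)` calibration scores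
are strictly smaller. -/
lemma coe_le_conformalThreshold_iff {b : ℝ} (hb : 0 < b) (N : ℕ) (z : ℕ → ℝ) (t : ℝ) :
    (t : EReal) ≤ conformalThreshold b N z ↔
      ((Finset.univ.filter fun i : Fin N => z i < t).card : ℝ) < b * (N + 1) := by
  have hN : (0 : ℝ) < N + 1 := by positivity
  unfold conformalThreshold empiricalQuantile
  rw [Fintype.card_option, Fintype.card_fin, Nat.cast_add_one]
  constructor
  · intro h
    by_contra! hc
    have hne : (Finset.univ.filter fun i : Fin N => z i < t).Nonempty := by
      rw [← Finset.card_pos]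
      have : (0 : ℝ) < (Finset.univ.filter fun i : Fin N => z i < t).card :=
        (by positivity : 0 < b * (N + 1)).trans_le hc
      exact_mod_cast this
    obtain ⟨j, hj, hmax⟩ := Finset.exists_max_image _ (fun i : Fin N => z i) hne
    have hjt : z j < t := (Finset.mem_filter.1 hj).2
    have hmem : (z j : EReal) ∈ {x : EReal | b ≤ (Nat.card {o : Option (Fin N) //
        o.elim (⊤ : EReal) (fun i => (z i : EReal)) ≤ x} : ℝ) / (N + 1)} := by
      rw [Set.mem_ofPred_eq, le_div_iff₀ hN]
      refine hc.trans ?_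
      rw [Nat.card_eq_fintype_card, Fintype.card_subtype]
      norm_cast
      refine Finset.card_le_card_of_injOn some (fun i hi => ?_)
        ((Option.some_injective _).injOn)
      simpa using hmax i hi
    have h2 : (t : EReal) ≤ (z j : EReal) := h.trans (sInf_le hmem)
    exact absurd (EReal.coe_le_coe_iff.1 h2) (not_le.2 hjt)
  · intro h
    refine le_sInf fun x hx => ?_
    rw [Set.mem_ofPred_eq, le_div_iff₀ hN] at hx
    by_contra! hc
    refine absurd (hx.trans ?_) (not_le.2 h)
    rw [Nat.card_eq_fintype_card, Fintype.card_subtype]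
    norm_cast
    have hsub : (Finset.univ.filter fun o : Option (Fin N) =>
        o.elim (⊤ : EReal) (fun i => (z i : EReal)) ≤ x) ⊆
        (Finset.univ.filter fun i : Fin N => z i < t).map ⟨some, Option.some_injective _⟩ := by
      intro o ho
      rw [Finset.mem_filter] at ho
      cases o with
      | none =>
        have : (⊤ : EReal) < t := ho.2.trans_lt hc
        simp at this
      | some i =>
        have : (z i : EReal) < t := ho.2.trans_lt hc
        simpa using this
    exact (Finset.card_le_card hsub).trans (Finset.card_map _).le

lemma mem_conformalSet_iff {d M : ℕ} (s : (Fin M → Resp d) → Resp d → ℝ) {α : ℝ} (hα : α < 1)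
    (N : ℕ) (Y : ℕ → Resp d) (ens : ℕ → Fin M → Resp d) (y : Resp d) :
    y ∈ conformalSet s α N Y ens ↔
      ((Finset.univ.filter fun i : Fin N => s (ens i) (Y i) < s (ens N) y).card : ℝ) <
        (1 - α) * (N + 1) :=
  coe_le_conformalThreshold_iff (sub_pos.2 hα) N (fun i => s (ens i) (Y i)) _

/-- A conformal set depends on the score only through the order of its values. -/
lemma conformalSet_congr {d M : ℕ} {s s' : (Fin M → Resp d) → Resp d → ℝ}
    (h : ∀ e y e' y', s e y < s e' y' ↔ s' e y < s' e' y') {α : ℝ} (hα : α < 1)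
    (N : ℕ) (Y : ℕ → Resp d) (ens : ℕ → Fin M → Resp d) :
    conformalSet s α N Y ens = conformalSet s' α N Y ens := by
  ext y
  simp only [mem_conformalSet_iff _ hα, h]

lemma gaussianDensity_smul_one {d : ℕ} (m : Resp d) {σ : ℝ} (hσ : 0 < σ) (y : Resp d) :
    gaussianDensity m (σ ^ 2 • (1 : Matrix (Fin d) (Fin d) ℝ)) y =
      (Real.sqrt ((2 * Real.pi) ^ d * (σ ^ 2) ^ d))⁻¹ *
        Real.exp (-(‖y - m‖ ^ 2 / (2 * σ ^ 2))) := by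
  have hinv : (σ ^ 2 • (1 : Matrix (Fin d) (Fin d) ℝ))⁻¹ = (σ ^ 2)⁻¹ • 1 := by
    refine Matrix.inv_eq_left_inv ?_
    rw [smul_mul_smul_comm, mul_one, inv_mul_cancel₀ (by positivity), one_smul]
  unfold gaussianDensity
  rw [hinv, Matrix.det_smul, Matrix.det_one, Fintype.card_fin, mul_one, Matrix.smul_mulVec,
    Matrix.one_mulVec, dotProduct_smul, EuclideanSpace.real_norm_sq_eq]
  congr 2
  simp only [dotProduct, smul_eq_mul, ← sq]
  field_simp

/-! ### The PCP score and the largest term of the kernel density estimate -/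

section PCP

variable {d M : ℕ}

lemma pcpScore_le_iff (hM : 1 ≤ M) (e : Fin M → Resp d) (y : Resp d) (r : ℝ) :
    pcpScore e y ≤ r ↔ ∃ m, ‖y - e m‖ ≤ r := by
  have : Nonempty (Fin M) := ⟨⟨0, hM⟩⟩
  constructor
  · intro h
    obtain ⟨m, hm⟩ := exists_eq_ciInf_of_finite (f := fun m : Fin M => ‖y - e m‖)
    exact ⟨m, hm.le.trans h⟩
  · rintro ⟨m, hm⟩
    exact (ciInf_le (Set.finite_range _).bddBelow m).trans hm

lemma pcpScore_nonneg (e : Fin M → Resp d) (y : Resp d) : 0 ≤ pcpScore e y :=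
  Real.iInf_nonneg fun _ => norm_nonneg _

/-- The largest term of the kernel density estimate belongs to the nearest ensemble member. -/
lemma iSup_kernel_eq (hM : 1 ≤ M) {σ : ℝ} (hσ : 0 < σ) (e : Fin M → Resp d) (y : Resp d) :
    (⨆ m : Fin M, (1 / (M : ℝ)) * gaussianDensity (e m) (σ ^ 2 • (1 : Matrix _ _ ℝ)) y) =
      (1 / (M : ℝ)) * ((Real.sqrt ((2 * Real.pi) ^ d * (σ ^ 2) ^ d))⁻¹ *
        Real.exp (-(pcpScore e y ^ 2 / (2 * σ ^ 2)))) := by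
  have : Nonempty (Fin M) := ⟨⟨0, hM⟩⟩
  simp_rw [gaussianDensity_smul_one _ hσ]
  apply le_antisymm
  · refine ciSup_le fun m => ?_
    have h1 : pcpScore e y ≤ ‖y - e m‖ := (pcpScore_le_iff hM e y _).2 ⟨m, le_rfl⟩
    have h2 := pcpScore_nonneg e y
    gcongr
  · obtain ⟨m, hm⟩ := (pcpScore_le_iff hM e y _).1 le_rfl
    refine le_trans ?_ (le_ciSup (Set.finite_range _).bddAbove m)
    gcongr

lemma kdeMaxScore_eq (hM : 1 ≤ M) {σ : ℝ} (hσ : 0 < σ) (e : Fin M → Resp d) (y : Resp d) :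
    kdeMaxScore σ e y = pcpScore e y ^ 2 / (2 * σ ^ 2) -
      Real.log ((1 / (M : ℝ)) * (Real.sqrt ((2 * Real.pi) ^ d * (σ ^ 2) ^ d))⁻¹) := by
  have hM' : (0 : ℝ) < M := by exact_mod_cast hM
  unfold kdeMaxScore
  rw [iSup_kernel_eq hM hσ, ← mul_assoc, Real.log_mul (by positivity) (Real.exp_pos _).ne',
    Real.log_exp]
  ring

lemma kdeMaxScore_lt_iff (hM : 1 ≤ M) {σ : ℝ} (hσ : 0 < σ) (e : Fin M → Resp d) (y : Resp d)
    (e' : Fin M → Resp d) (y' : Resp d) :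
    kdeMaxScore σ e y < kdeMaxScore σ e' y' ↔ pcpScore e y < pcpScore e' y' := by
  rw [kdeMaxScore_eq hM hσ, kdeMaxScore_eq hM hσ, sub_lt_sub_iff_right,
    div_lt_div_iff_of_pos_right (by positivity),
    pow_lt_pow_iff_left₀ (pcpScore_nonneg _ _) (pcpScore_nonneg _ _) two_ne_zero]

lemma conformalSet_pcpScore_eq_kdeMaxScore (hM : 1 ≤ M) {σ : ℝ} (hσ : 0 < σ) {α : ℝ} (hα : α < 1)
    (N : ℕ) (Y : ℕ → Resp d) (ens : ℕ → Fin M → Resp d) :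
    conformalSet (pcpScore (M := M)) α N Y ens = conformalSet (kdeMaxScore (M := M) σ) α N Y ens :=
  conformalSet_congr (fun e y e' y' => (kdeMaxScore_lt_iff hM hσ e y e' y').symm) hα N Y ens

lemma conformalSet_pcpScore_eq (hM : 1 ≤ M) {α : ℝ} (hα : α < 1)
    (N : ℕ) (Y : ℕ → Resp d) (ens : ℕ → Fin M → Resp d) :
    conformalSet (pcpScore (M := M)) α N Y ens = Set.univ ∨
      ∃ r : ℝ, 0 ≤ r ∧ conformalSet (pcpScore (M := M)) α N Y ens =
        ⋃ m : Fin M, Metric.closedBall (ens N m) r := by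
  unfold conformalSet
  have h0 : ((0 : ℝ) : EReal) ≤
      conformalThreshold (1 - α) N (fun i => pcpScore (ens i) (Y i)) := by
    rw [coe_le_conformalThreshold_iff (sub_pos.2 hα), Finset.filter_false_of_mem
      (fun i _ => not_lt.2 (pcpScore_nonneg _ _))]
    have : 0 < 1 - α := sub_pos.2 hα
    simp only [Finset.card_empty, Nat.cast_zero]
    positivity
  induction h : conformalThreshold (1 - α) N (fun i => pcpScore (ens i) (Y i)) with
  | bot => simp [h] at h0
  | top => left; simp
  | coe r =>
    right
    rw [h, EReal.coe_le_coe_iff] at h0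
    refine ⟨r, h0, ?_⟩
    ext y
    simp [pcpScore_le_iff hM, dist_eq_norm]

end PCP

/-! ### Laws and independence in the sample -/

section Sample

variable {Ω 𝒳 : Type*} [MeasurableSpace Ω] [MeasurableSpace 𝒳] {P : Measure Ω}
  {PX : Measure 𝒳} {d : ℕ} {γ : Measure (Resp d)}
  {X : ℕ → Ω → 𝒳} {Y : ℕ → Ω → Resp d} {Yhat : ℕ → ℕ → Ω → Resp d}

namespace IsSample

lemma measurable_point (h : IsSample P PX γ X Y Yhat) (i : ℕ) :
    Measurable fun ω => (Y i ω, fun m => Yhat i m ω) :=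
  (h.measurable_Y i).prodMk (measurable_pi_lambda _ (h.measurable_Yhat i))

lemma measurable_ensemble (h : IsSample P PX γ X Y Yhat) (i : ℕ) {M : ℕ} :
    Measurable fun ω => ensemble Yhat M ω i :=
  measurable_pi_lambda _ fun m => h.measurable_Yhat i m

lemma iIndepFun_point (h : IsSample P PX γ X Y Yhat) :
    iIndepFun (fun i ω => (Y i ω, fun m => Yhat i m ω)) P :=
  h.indep.comp (fun _ p => p.2) fun _ => measurable_snd

lemma iIndepFun_Y (h : IsSample P PX γ X Y Yhat) : iIndepFun Y P :=
  h.iIndepFun_point.comp (fun _ p => p.1) fun _ => measurable_fst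

variable [IsProbabilityMeasure PX] [IsProbabilityMeasure γ]

lemma map_point (h : IsSample P PX γ X Y Yhat) (i : ℕ) :
    P.map (fun ω => (Y i ω, fun m => Yhat i m ω)) =
      γ.prod (Measure.infinitePi fun _ : ℕ => γ) := by
  have h1 := congrArg (Measure.map Prod.snd) (h.law i)
  rw [Measure.map_map measurable_snd ((h.measurable_X i).prodMk (h.measurable_point i))] at h1
  rw [← Measure.snd, Measure.snd_prod] at h1
  exact h1

lemma map_Y (h : IsSample P PX γ X Y Yhat) (i : ℕ) : P.map (Y i) = γ := by
  have h1 := congrArg (Measure.map Prod.fst) (h.map_point i)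
  rw [Measure.map_map measurable_fst (h.measurable_point i), ← Measure.fst, Measure.fst_prod] at h1
  exact h1

lemma map_draws (h : IsSample P PX γ X Y Yhat) (i : ℕ) :
    P.map (fun ω m => Yhat i m ω) = Measure.infinitePi fun _ : ℕ => γ := by
  have h1 := congrArg (Measure.map Prod.snd) (h.map_point i)
  rw [Measure.map_map measurable_snd (h.measurable_point i), ← Measure.snd, Measure.snd_prod] at h1
  exact h1

lemma map_Yhat (h : IsSample P PX γ X Y Yhat) (i m : ℕ) : P.map (Yhat i m) = γ := by
  have h1 := congrArg (Measure.map (fun x : ℕ → Resp d => x m)) (h.map_draws i)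
  rw [Measure.map_map (measurable_pi_apply m) (measurable_pi_lambda _ (h.measurable_Yhat i)),
    Measure.infinitePi_map_eval] at h1
  exact h1

lemma iIndepFun_Yhat [IsProbabilityMeasure P] (h : IsSample P PX γ X Y Yhat) (i : ℕ) :
    iIndepFun (fun m ω => Yhat i m ω) P := by
  rw [iIndepFun_iff_map_fun_eq_infinitePi_map (h.measurable_Yhat i), h.map_draws i]
  simp only [h.map_Yhat i]

/-- All data points have the same law. -/
lemma identDistrib_point (h : IsSample P PX γ X Y Yhat) (i j : ℕ) :
    IdentDistrib (fun ω => (Y i ω, fun m => Yhat i m ω)) (fun ω => (Y j ω, fun m => Yhat j m ω))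
      P P :=
  ⟨(h.measurable_point i).aemeasurable, (h.measurable_point j).aemeasurable, by
    rw [h.map_point, h.map_point]⟩

end IsSample

end Sample

end ConformalGen

namespace ConformalGen

/-! ### Marginal coverage by exchangeability -/

/-- At least `t` of `n ≥ t` numbers have fewer than `t` numbers strictly below them. -/
lemma le_card_rank_lt {n : ℕ} (x : Fin n → ℝ) {t : ℝ} (ht : t ≤ n) :
    t ≤ ((Finset.univ.filter fun j : Fin n =>
      ((Finset.univ.filter fun i : Fin n => x i < x j).card : ℝ) < t).card : ℝ) := by
  by_contra! hc
  set J := Finset.univ.filter fun j : Fin n =>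
      ((Finset.univ.filter fun i : Fin n => x i < x j).card : ℝ) < t with hJ
  have hne : (Jᶜ).Nonempty := by
    rw [Finset.nonempty_iff_ne_empty, Ne, Finset.compl_eq_empty_iff]
    intro h
    rw [h] at hc
    simp only [Finset.card_univ, Fintype.card_fin] at hc
    linarith
  -- the smallest value outside `J` has only members of `J` below it, hence rank less than `t`
  obtain ⟨j, hj, hmin⟩ := Finset.exists_min_image _ x hne
  have hsub : (Finset.univ.filter fun i : Fin n => x i < x j) ⊆ J := by
    intro i hi
    by_contra hiJ
    exact absurd (hmin i (Finset.mem_compl.2 hiJ)) (not_le.2 (Finset.mem_filter.1 hi).2)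
  refine Finset.mem_compl.1 hj ?_
  rw [hJ, Finset.mem_filter]
  refine ⟨Finset.mem_univ _, lt_of_le_of_lt ?_ hc⟩
  exact_mod_cast Finset.card_le_card hsub

lemma measurable_card_filter_lt {β ι : Type*} [MeasurableSpace β] [Fintype ι] {f : ι → β → ℝ}
    {g : β → ℝ} (hf : ∀ i, Measurable (f i)) (hg : Measurable g) :
    Measurable fun p => ((Finset.univ.filter fun i => f i p < g p).card : ℝ) := by
  simp_rw [Finset.card_filter]
  push_cast
  exact Finset.measurable_sum _ fun i _ =>
    Measurable.ite (measurableSet_lt (hf i) hg) measurable_const measurable_const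

/-- The rank of the last of `N + 1` independent, identically distributed real variables is small
with the probability that it has by symmetry. -/
lemma le_measure_rank_lt {Ω : Type*} [MeasurableSpace Ω] (P : Measure Ω) [IsProbabilityMeasure P]
    {s : ℕ → Ω → ℝ} (hs : ∀ i, Measurable (s i)) (hind : iIndepFun s P)
    (hid : ∀ i j, P.map (s i) = P.map (s j)) (N : ℕ) {b : ℝ} (hb : b ≤ 1) :
    ENNReal.ofReal b ≤ P {ω | ((Finset.univ.filter fun i : Fin N => s i ω < s N ω).card : ℝ) <
      b * (N + 1)} := by
  set ν := P.map (s 0)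
  have hνp : IsProbabilityMeasure ν := Measure.isProbabilityMeasure_map (hs 0).aemeasurable
  set Q : Measure (Fin (N + 1) → ℝ) := Measure.pi fun _ => ν with hQ
  have hlaw : P.map (fun ω (i : Fin (N + 1)) => s i ω) = Q := by
    have h := (iIndepFun_iff_map_fun_eq_pi_map (f := fun (i : Fin (N + 1)) ω => s i ω)
      (fun i => (hs i).aemeasurable)).1 (hind.precomp (g := fun i : Fin (N + 1) => (i : ℕ))
        Fin.val_injective)
    rw [h, hQ]
    congr 1
    funext i
    exact hid _ _
  have hmeas : Measurable fun ω (i : Fin (N + 1)) => s i ω := measurable_pi_lambda _ fun i => hs i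
  let E : Fin (N + 1) → Set (Fin (N + 1) → ℝ) := fun j =>
    {x | ((Finset.univ.filter fun i => x i < x j).card : ℝ) < b * (N + 1)}
  have hE : ∀ j, MeasurableSet (E j) := fun j =>
    measurableSet_lt (measurable_card_filter_lt (f := fun i (x : Fin (N + 1) → ℝ) => x i)
      (fun i => measurable_pi_apply i) (measurable_pi_apply j)) measurable_const
  have hsym : ∀ j, Q (E j) = Q (E (Fin.last N)) := by
    intro j
    have hmp := measurePreserving_piCongrLeft (fun _ : Fin (N + 1) => ν)
      (Equiv.swap j (Fin.last N))
    rw [← hmp.measure_preimage (hE (Fin.last N)).nullMeasurableSet]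
    congr 1
    ext x
    have hval : ∀ i, (MeasurableEquiv.piCongrLeft (fun _ : Fin (N + 1) => ℝ)
        (Equiv.swap j (Fin.last N)) x) i = x (Equiv.swap j (Fin.last N) i) := by
      intro i
      have := Equiv.piCongrLeft_apply_apply (P := fun _ : Fin (N + 1) => ℝ)
        (Equiv.swap j (Fin.last N)) x (Equiv.swap j (Fin.last N) i)
      rw [Equiv.swap_apply_self] at this
      exact this
    simp only [E, Set.mem_preimage, Set.mem_ofPred_eq, hval, Equiv.swap_apply_right]
    have hcard : (Finset.univ.filter fun i => x i < x j).card =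
        (Finset.univ.filter fun i => x (Equiv.swap j (Fin.last N) i) < x j).card := by
      refine (Finset.card_equiv (Equiv.swap j (Fin.last N)) fun i => ?_).symm
      simp
    rw [hcard]
  have hsum : ENNReal.ofReal (b * (N + 1)) ≤ ∑ j, Q (E j) := by
    have h1 : ∀ j, Q (E j) = ∫⁻ x, (E j).indicator 1 x ∂Q := fun j =>
      (lintegral_indicator_one (hE j)).symm
    simp_rw [h1]
    rw [← lintegral_finsetSum _ fun j _ => measurable_one.indicator (hE j)]
    calc ENNReal.ofReal (b * (N + 1)) = ∫⁻ _, ENNReal.ofReal (b * (N + 1)) ∂Q := by simp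
      _ ≤ _ := lintegral_mono fun x => ?_
    have h2 : ∑ j, (E j).indicator (1 : (Fin (N + 1) → ℝ) → ℝ≥0∞) x =
        ((Finset.univ.filter fun j => x ∈ E j).card : ℝ≥0∞) := by
      rw [Finset.card_filter]
      push_cast
      rfl
    rw [h2]
    have h3 := le_card_rank_lt x (t := b * (N + 1)) (by
      push_cast
      exact mul_le_of_le_one_left (by positivity) hb)
    rw [← ENNReal.ofReal_natCast]
    exact ENNReal.ofReal_le_ofReal h3
  simp_rw [hsym] at hsum
  rw [Finset.sum_const, Finset.card_univ, Fintype.card_fin, nsmul_eq_mul, mul_comm b,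
    ENNReal.ofReal_mul (by positivity)] at hsum
  have hN : ENNReal.ofReal ((N : ℝ) + 1) = ((N + 1 : ℕ) : ℝ≥0∞) := by
    rw [← ENNReal.ofReal_natCast]; push_cast; rfl
  rw [hN, ENNReal.mul_le_mul_iff_right (by simp) (by simp)] at hsum
  refine hsum.trans (le_of_eq ?_)
  rw [← hlaw, Measure.map_apply hmeas (hE _)]
  congr 1
  ext ω
  simp only [E, Set.mem_preimage, Set.mem_ofPred_eq]
  have hcard : (Finset.univ.filter fun i : Fin (N + 1) => s i ω < s (Fin.last N) ω).card =
      (Finset.univ.filter fun i : Fin N => s i ω < s N ω).card := by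
    have : (Finset.univ.filter fun i : Fin (N + 1) => s i ω < s (Fin.last N) ω) =
        (Finset.univ.filter fun i : Fin N => s i ω < s N ω).map Fin.castSuccEmb := by
      ext i
      refine Fin.lastCases ?_ (fun i => ?_) i
      · simp
      · simp
    rw [this, Finset.card_map]
  rw [hcard]

end ConformalGen

namespace ConformalGen

/-! ### The excess volume of the nearest-neighbour set -/

variable {d : ℕ} {S : Matrix (Fin d) (Fin d) ℝ}

lemma gaussian_le_volume (hS : S.PosDef) (μ : Resp d) (s : Set (Resp d)) :
    multivariateGaussian μ S s ≤ ENNReal.ofReal (gaussianDensity μ S μ) * volume s := by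
  rw [multivariateGaussian_eq_withDensity hS, withDensity_apply' _ s]
  calc _ ≤ ∫⁻ _ in s, ENNReal.ofReal (gaussianDensity μ S μ) :=
        lintegral_mono fun y => ENNReal.ofReal_le_ofReal (gaussianDensity_le hS μ y)
    _ = _ := setLIntegral_const _ _

lemma exists_volume_le_gaussian (hS : S.PosDef) (μ y₀ : Resp d) (R : ℝ) :
    ∃ m : ℝ, 0 < m ∧ ∀ s ⊆ Metric.closedBall y₀ R,
      ENNReal.ofReal m * volume s ≤ multivariateGaussian μ S s := by
  have hcont := continuous_gaussianDensity (S := S) μ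
  rcases (Metric.closedBall y₀ R).eq_empty_or_nonempty with h | h
  · refine ⟨1, one_pos, fun s hs => ?_⟩
    rw [h, Set.subset_empty_iff] at hs
    simp [hs]
  · obtain ⟨x, hx, hmin⟩ := (isCompact_closedBall y₀ R).exists_isMinOn h hcont.continuousOn
    refine ⟨gaussianDensity μ S x, gaussianDensity_pos hS μ x, fun s hs => ?_⟩
    rw [multivariateGaussian_eq_withDensity hS, withDensity_apply' _ s, ← setLIntegral_const]
    exact setLIntegral_mono (hcont.measurable.ennreal_ofReal) fun y hy =>
      ENNReal.ofReal_le_ofReal (hmin (hs hy))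

/-- Balls of equal radius around points of two bounded regions have comparable Gaussian mass,
uniformly in the radius. -/
lemma exists_ball_mass_ratio (hS : S.PosDef) (μ p : Resp d) :
    ∃ c : ℝ, 0 < c ∧ ∀ y₁, ∀ y₂ ∈ Metric.ball p 1, ∀ r : ℝ,
      c * (multivariateGaussian μ S).real (Metric.closedBall y₁ r) ≤
        (multivariateGaussian μ S).real (Metric.closedBall y₂ r) := by
  obtain ⟨m, hm, hlow⟩ := exists_volume_le_gaussian hS μ p 2
  have hF := gaussianDensity_pos hS μ μ
  set F := gaussianDensity μ S μ
  set v := volume.real (Metric.closedBall (0 : Resp d) 1)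
  have hvpos : 0 < v := ENNReal.toReal_pos
    ((Metric.measure_closedBall_pos volume _ one_pos).ne') measure_closedBall_lt_top.ne
  have hlow' : ∀ y₂ ∈ Metric.ball p 1, ∀ r ≤ 1,
      m * volume.real (Metric.closedBall (0 : Resp d) r) ≤
        (multivariateGaussian μ S).real (Metric.closedBall y₂ r) := by
    intro y₂ hy₂ r hr
    have h := hlow (Metric.closedBall y₂ r) (Metric.closedBall_subset_closedBall' (by
      have := Metric.mem_ball.1 hy₂
      linarith))
    have h2 := ENNReal.toReal_mono (measure_ne_top _ _) h
    rwa [ENNReal.toReal_mul, ENNReal.toReal_ofReal hm.le,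
      Measure.addHaar_closedBall_center volume] at h2
  refine ⟨min (m / F) (m * v), lt_min (by positivity) (by positivity), fun y₁ y₂ hy₂ r => ?_⟩
  rcases le_total r 1 with hr | hr
  · have h1 : (multivariateGaussian μ S).real (Metric.closedBall y₁ r) ≤
        F * volume.real (Metric.closedBall (0 : Resp d) r) := by
      have h := gaussian_le_volume hS μ (Metric.closedBall y₁ r)
      have h2 := ENNReal.toReal_mono
        (ENNReal.mul_ne_top ENNReal.ofReal_ne_top measure_closedBall_lt_top.ne) h
      rwa [ENNReal.toReal_mul, ENNReal.toReal_ofReal hF.le,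
        Measure.addHaar_closedBall_center volume] at h2
    calc _ ≤ m / F * (F * volume.real (Metric.closedBall (0 : Resp d) r)) :=
          mul_le_mul (min_le_left _ _) h1 measureReal_nonneg (by positivity)
      _ = m * volume.real (Metric.closedBall (0 : Resp d) r) := by field_simp
      _ ≤ _ := hlow' y₂ hy₂ r hr
  · calc _ ≤ m * v * 1 :=
          mul_le_mul (min_le_right _ _) measureReal_le_one measureReal_nonneg (by positivity)
      _ = m * v := mul_one _
      _ ≤ _ := hlow' y₂ hy₂ 1 le_rfl
      _ ≤ _ := measureReal_mono (Metric.closedBall_subset_closedBall hr)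

/-- The first `M` of a sequence of draws. -/
abbrev firstDraws (M : ℕ) (w : ℕ → Resp d) : Fin M → Resp d := fun m => w m

lemma measurable_pcpScore {β : Type*} [MeasurableSpace β] {M : ℕ} {e : β → Fin M → Resp d}
    {y : β → Resp d} (he : ∀ m, Measurable fun p => e p m) (hy : Measurable y) :
    Measurable fun p => pcpScore (e p) (y p) :=
  Measurable.iInf fun m => (hy.sub (he m)).norm

lemma infinitePi_lt_pcpScore (γ : Measure (Resp d)) [IsProbabilityMeasure γ] {M : ℕ} (hM : 1 ≤ M)
    (y : Resp d) (r : ℝ) :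
    (Measure.infinitePi fun _ : ℕ => γ) {w | r < pcpScore (firstDraws M w) y} =
      ENNReal.ofReal ((1 - γ.real (Metric.closedBall y r)) ^ M) := by
  have h : {w : ℕ → Resp d | r < pcpScore (firstDraws M w) y} =
      ((Finset.range M : Finset ℕ) : Set ℕ).pi fun _ => (Metric.closedBall y r)ᶜ := by
    ext w
    rw [Set.mem_ofPred_eq, ← not_le, pcpScore_le_iff hM]
    simp only [firstDraws, not_exists, Set.mem_pi, Finset.coe_range, Set.mem_Iio, Set.mem_compl_iff,
      Metric.mem_closedBall, dist_eq_norm]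
    constructor
    · intro h i hi
      rw [norm_sub_rev]
      exact h ⟨i, hi⟩
    · intro h i
      rw [norm_sub_rev]
      exact h i i.2
  rw [h, Measure.infinitePi_pi _ fun _ _ => Metric.isClosed_closedBall.measurableSet.compl]
  rw [Finset.prod_const, Finset.card_range, ← probReal_compl_eq_one_sub
    Metric.isClosed_closedBall.measurableSet, ENNReal.ofReal_pow measureReal_nonneg,
    ofReal_measureReal]

/-- Take a set `U₁` and a ball `U₂`. Whatever the common radius is, the balls around `M` Gaussian
draws either leave every point of `U₁` uncovered with probability at least `1 / 2`, or cover every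
point of `U₂` with a probability that is bounded below. -/
lemma exists_miss_or_hit (hS : S.PosDef) (μ p : Resp d) (U₁ : Set (Resp d)) :
    ∃ η : ℝ, 0 < η ∧ η ≤ 1 ∧ ∀ M : ℕ, 1 ≤ M → ∀ r : ℝ,
      (∀ y ∈ U₁, ENNReal.ofReal (1 / 2) ≤
        (Measure.infinitePi fun _ : ℕ => multivariateGaussian μ S)
          {w | r < pcpScore (firstDraws M w) y}) ∨
      (∀ y ∈ Metric.ball p 1, ENNReal.ofReal η ≤
        (Measure.infinitePi fun _ : ℕ => multivariateGaussian μ S)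
          {w | pcpScore (firstDraws M w) y ≤ r}) := by
  obtain ⟨c, hc, hratio⟩ := exists_ball_mass_ratio hS μ p
  set γ := multivariateGaussian μ S
  refine ⟨1 - Real.exp (-(c / 2)), ?_, ?_, fun M hM r => ?_⟩
  · rw [sub_pos, Real.exp_lt_one_iff]; linarith
  · linarith [Real.exp_pos (-(c / 2))]
  by_cases h : ∀ y ∈ U₁, (1 : ℝ) / 2 ≤ (1 - γ.real (Metric.closedBall y r)) ^ M
  · left
    intro y hy
    rw [infinitePi_lt_pcpScore _ hM]
    exact ENNReal.ofReal_le_ofReal (h y hy)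
  · right
    push Not at h
    obtain ⟨y₁, -, h₁⟩ := h
    intro y₂ hy₂
    have hm : MeasurableSet {w : ℕ → Resp d | r < pcpScore (firstDraws M w) y₂} :=
      measurableSet_lt measurable_const
        (measurable_pcpScore (fun m => measurable_pi_apply _) measurable_const)
    have hcompl : {w : ℕ → Resp d | pcpScore (firstDraws M w) y₂ ≤ r} =
        {w : ℕ → Resp d | r < pcpScore (firstDraws M w) y₂}ᶜ := by
      ext w; simp
    have hg1 : γ.real (Metric.closedBall y₁ r) ≤ 1 := measureReal_le_one
    have hg2 : γ.real (Metric.closedBall y₂ r) ≤ 1 := measureReal_le_one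
    have hb := one_add_mul_le_pow (a := -γ.real (Metric.closedBall y₁ r)) (by linarith) M
    have hMg : 1 / 2 < M * γ.real (Metric.closedBall y₁ r) := by
      rw [← sub_eq_add_neg] at hb
      linarith
    have hexp : (1 - γ.real (Metric.closedBall y₂ r)) ^ M ≤ Real.exp (-(c / 2)) := by
      calc _ ≤ (Real.exp (-γ.real (Metric.closedBall y₂ r))) ^ M := by
            refine pow_le_pow_left₀ (by linarith) ?_ M
            have := Real.add_one_le_exp (-γ.real (Metric.closedBall y₂ r))
            linarith
        _ = Real.exp (-(M * γ.real (Metric.closedBall y₂ r))) := by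
            rw [← Real.exp_nat_mul]; ring_nf
        _ ≤ _ := by
            rw [Real.exp_le_exp]
            have h1 := hratio y₁ y₂ hy₂ r
            nlinarith
    rw [hcompl, prob_compl_eq_one_sub hm, infinitePi_lt_pcpScore _ hM, ← ENNReal.ofReal_one,
      ← ENNReal.ofReal_sub _ (pow_nonneg (by linarith) M)]
    exact ENNReal.ofReal_le_ofReal (by linarith)

/-- The volume of `U₁` that is missed plus the volume of a ball `U₂` that is hit is bounded below in
mean, uniformly in the ensemble size and the radius. -/
lemma exists_miss_add_hit_volume (hS : S.PosDef) (μ p : Resp d) {U₁ U₂ : Set (Resp d)}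
    (hU₁ : volume U₁ ≠ 0) (hU₂ : volume U₂ ≠ 0) (hU₁m : MeasurableSet U₁)
    (hU₂m : MeasurableSet U₂) (hsub : U₂ ⊆ Metric.ball p 1) :
    ∃ δ : ℝ≥0∞, δ ≠ 0 ∧ ∀ M : ℕ, 1 ≤ M → ∀ T : EReal,
      δ ≤ (∫⁻ y in U₁, (Measure.infinitePi fun _ : ℕ => multivariateGaussian μ S)
          {w | T < pcpScore (firstDraws M w) y}) +
        ∫⁻ y in U₂, (Measure.infinitePi fun _ : ℕ => multivariateGaussian μ S)
          {w | (pcpScore (firstDraws M w) y : EReal) ≤ T} := by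
  obtain ⟨η, hη, hη1, h⟩ := exists_miss_or_hit hS μ p U₁
  refine ⟨min (ENNReal.ofReal (1 / 2) * volume U₁) (ENNReal.ofReal η * volume U₂), ?_, ?_⟩
  · have h1 : ENNReal.ofReal (1 / 2) ≠ 0 := (ENNReal.ofReal_pos.2 (by norm_num)).ne'
    have h2 : ENNReal.ofReal η ≠ 0 := (ENNReal.ofReal_pos.2 hη).ne'
    rcases min_choice (ENNReal.ofReal (1 / 2) * volume U₁) (ENNReal.ofReal η * volume U₂) with h | h
    · rw [h]; exact mul_ne_zero h1 hU₁
    · rw [h]; exact mul_ne_zero h2 hU₂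
  intro M hM T
  induction T with
  | bot =>
    refine (min_le_left _ _).trans (le_add_right ?_)
    rw [← setLIntegral_const]
    refine lintegral_mono fun y => ?_
    simp only [EReal.bot_lt_coe, Set.ofPred_true, measure_univ]
    exact ENNReal.ofReal_le_one.2 (by norm_num)
  | top =>
    refine (min_le_right _ _).trans (le_add_left ?_)
    rw [← setLIntegral_const]
    refine lintegral_mono fun y => ?_
    simp only [le_top, Set.ofPred_true, measure_univ]
    exact ENNReal.ofReal_le_one.2 hη1
  | coe r =>
    simp only [EReal.coe_lt_coe_iff, EReal.coe_le_coe_iff]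
    rcases h M hM r with h | h
    · refine (min_le_left _ _).trans (le_add_right ?_)
      rw [← setLIntegral_const]
      exact setLIntegral_mono' hU₁m h
    · refine (min_le_right _ _).trans (le_add_left ?_)
      rw [← setLIntegral_const]
      exact setLIntegral_mono' hU₂m fun y hy => h y (hsub hy)

end ConformalGen

namespace ConformalGen

/-! ### The expected volume of the PCP set -/

section

variable {Ω 𝒳 : Type*} {d : ℕ} {X : ℕ → Ω → 𝒳} {Y : ℕ → Ω → Resp d} {Yhat : ℕ → ℕ → Ω → Resp d}

/-- The calibration scores of the first `N` data points. -/
noncomputable def calibScores (Y : ℕ → Ω → Resp d) (Yhat : ℕ → ℕ → Ω → Resp d) (M N : ℕ) (ω : Ω) :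
    Fin N → ℝ :=
  fun i => pcpScore (ensemble Yhat M ω i) (Y i ω)

/-- The triples of calibration scores, draws at the test point and candidate response for which the
candidate belongs to the PCP set. -/
def pcpRegion (d : ℕ) (α : ℝ) (M N : ℕ) : Set ((Fin N → ℝ) × (ℕ → Resp d) × Resp d) :=
  {p | ((Finset.univ.filter fun i => p.1 i < pcpScore (firstDraws M p.2.1) p.2.2).card : ℝ) <
    (1 - α) * (N + 1)}

lemma measurableSet_pcpRegion (α : ℝ) (M N : ℕ) : MeasurableSet (pcpRegion d α M N) :=
  measurableSet_lt (measurable_card_filter_lt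
    (f := fun i (p : (Fin N → ℝ) × (ℕ → Resp d) × Resp d) => p.1 i)
    (fun i => (measurable_pi_apply i).comp measurable_fst)
    (measurable_pcpScore (fun m => by fun_prop) (by fun_prop))) measurable_const

lemma mem_pcpSet_iff {α : ℝ} (hα : α < 1) (M N : ℕ) (ω : Ω) (y : Resp d) :
    y ∈ pcpSet Y Yhat α M N ω ↔
      (calibScores Y Yhat M N ω, (fun m => Yhat N m ω), y) ∈ pcpRegion d α M N :=
  mem_conformalSet_iff _ hα N _ _ y

lemma mem_pcpRegion_iff {α : ℝ} (hα : α < 1) (M N : ℕ) (c : Fin N → ℝ) :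
    ∃ T : EReal, ∀ (w : ℕ → Resp d) (y : Resp d),
      (c, w, y) ∈ pcpRegion d α M N ↔ (pcpScore (firstDraws M w) y : EReal) ≤ T := by
  refine ⟨conformalThreshold (1 - α) N fun i => if h : i < N then c ⟨i, h⟩ else 0, fun w y => ?_⟩
  rw [coe_le_conformalThreshold_iff (sub_pos.2 hα)]
  simp [pcpRegion]

variable [MeasurableSpace Ω] [MeasurableSpace 𝒳] {P : Measure Ω} {PX : Measure 𝒳}
  {γ : Measure (Resp d)}

lemma IsSample.measurable_calibScores (h : IsSample P PX γ X Y Yhat) (M N : ℕ) :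
    Measurable (calibScores Y Yhat M N) :=
  measurable_pi_lambda _ fun i =>
    measurable_pcpScore (fun m => h.measurable_Yhat i m) (h.measurable_Y i)

variable [IsProbabilityMeasure P] [IsProbabilityMeasure PX] [IsProbabilityMeasure γ]

/-- The calibration scores, the draws at the test point and the test response are independent. -/
lemma IsSample.map_calibScores_test (h : IsSample P PX γ X Y Yhat) (M N : ℕ) :
    P.map (fun ω => (calibScores Y Yhat M N ω, (fun m => Yhat N m ω), Y N ω)) =
      (P.map (calibScores Y Yhat M N)).prod ((Measure.infinitePi fun _ : ℕ => γ).prod γ) := by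
  have hfin := h.iIndepFun_point.indepFun_finset (Finset.range N) {N} (by simp)
    h.measurable_point
  let φ : ((i : Finset.range N) → Resp d × (ℕ → Resp d)) → Fin N → ℝ := fun z i =>
    pcpScore (firstDraws M (z ⟨i, Finset.mem_range.2 i.2⟩).2) (z ⟨i, Finset.mem_range.2 i.2⟩).1
  let ψ : ((i : ({N} : Finset ℕ)) → Resp d × (ℕ → Resp d)) → (ℕ → Resp d) × Resp d := fun z =>
    (z ⟨N, Finset.mem_singleton_self N⟩).swap
  have hφ : Measurable φ := measurable_pi_lambda _ fun i =>
    measurable_pcpScore (fun m => by fun_prop) (by fun_prop)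
  have hψ : Measurable ψ := by fun_prop
  have hind := hfin.comp hφ hψ
  have h1 := (indepFun_iff_map_prod_eq_prod_map_map (h.measurable_calibScores M N).aemeasurable
    ((measurable_pi_lambda _ (h.measurable_Yhat N)).prodMk (h.measurable_Y N)).aemeasurable).1 hind
  rw [h1]
  congr 1
  rw [← Measure.prod_swap, ← h.map_point N, Measure.map_map measurable_swap (h.measurable_point N)]
  rfl

lemma IsSample.lintegral_section (h : IsSample P PX γ X Y Yhat) (M N : ℕ)
    (m : Measure (Resp d)) [SFinite m] {H : Set ((Fin N → ℝ) × (ℕ → Resp d) × Resp d)}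
    (hH : MeasurableSet H) :
    ∫⁻ ω, m {y | (calibScores Y Yhat M N ω, (fun k => Yhat N k ω), y) ∈ H} ∂P =
      ∫⁻ c, ((Measure.infinitePi fun _ : ℕ => γ).prod m) (Prod.mk c ⁻¹' H)
        ∂(P.map (calibScores Y Yhat M N)) := by
  have hwm : Measurable fun ω => (fun k => Yhat N k ω) := measurable_pi_lambda _ (h.measurable_Yhat N)
  have hlaw : P.map (fun ω => (calibScores Y Yhat M N ω, (fun k => Yhat N k ω))) =
      (P.map (calibScores Y Yhat M N)).prod (Measure.infinitePi fun _ : ℕ => γ) := by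
    have h1 := congrArg (Measure.map (Prod.map id Prod.fst)) (h.map_calibScores_test M N)
    rw [Measure.map_map (by fun_prop) ((h.measurable_calibScores M N).prodMk
      (hwm.prodMk (h.measurable_Y N)))] at h1
    rw [← Measure.map_prod_map _ _ measurable_id measurable_fst, Measure.map_id, ← Measure.fst,
      Measure.fst_prod] at h1
    exact h1
  have hH' : MeasurableSet {q : ((Fin N → ℝ) × (ℕ → Resp d)) × Resp d | (q.1.1, q.1.2, q.2) ∈ H} :=
    hH.preimage (by fun_prop)
  have hmeas : Measurable fun q : (Fin N → ℝ) × (ℕ → Resp d) => m {y | (q.1, q.2, y) ∈ H} :=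
    measurable_measure_prodMk_left hH'
  calc _ = ∫⁻ q, m {y | (q.1, q.2, y) ∈ H} ∂(P.map (fun ω =>
        (calibScores Y Yhat M N ω, (fun k => Yhat N k ω)))) := by
        rw [lintegral_map hmeas ((h.measurable_calibScores M N).prodMk hwm)]
    _ = ∫⁻ c, ∫⁻ w, m {y | (c, w, y) ∈ H} ∂(Measure.infinitePi fun _ : ℕ => γ)
        ∂(P.map (calibScores Y Yhat M N)) := by
        rw [hlaw, lintegral_prod _ hmeas.aemeasurable]
    _ = _ := by
        refine lintegral_congr fun c => ?_
        rw [Measure.prod_apply (measurable_prodMk_left hH)]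
        rfl

/-- Split conformal prediction has marginal coverage at least `1 - α`. -/
lemma IsSample.le_lintegral_pcpSet_mass (h : IsSample P PX γ X Y Yhat) {α : ℝ} (hα0 : 0 < α)
    (hα : α < 1) (M N : ℕ) :
    ENNReal.ofReal (1 - α) ≤ ∫⁻ ω, γ (pcpSet Y Yhat α M N ω) ∂P := by
  have hwm : Measurable fun ω => (fun k => Yhat N k ω) := measurable_pi_lambda _ (h.measurable_Yhat N)
  have hG := measurableSet_pcpRegion (d := d) α M N
  have e1 : ∫⁻ ω, γ (pcpSet Y Yhat α M N ω) ∂P =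
      ∫⁻ c, ((Measure.infinitePi fun _ : ℕ => γ).prod γ) (Prod.mk c ⁻¹' pcpRegion d α M N)
        ∂(P.map (calibScores Y Yhat M N)) := by
    rw [← h.lintegral_section M N γ hG]
    refine lintegral_congr fun ω => ?_
    congr 1
    ext y
    exact mem_pcpSet_iff hα M N ω y
  rw [e1, ← Measure.prod_apply hG, ← h.map_calibScores_test, Measure.map_apply
    ((h.measurable_calibScores M N).prodMk (hwm.prodMk (h.measurable_Y N))) hG]
  have hs : ∀ i, Measurable fun ω => pcpScore (ensemble Yhat M ω i) (Y i ω) := fun i =>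
    measurable_pcpScore (fun m => h.measurable_Yhat i m) (h.measurable_Y i)
  have hφ : Measurable fun z : Resp d × (ℕ → Resp d) => pcpScore (firstDraws M z.2) z.1 :=
    measurable_pcpScore (fun m => by fun_prop) (by fun_prop)
  exact le_measure_rank_lt P hs (h.iIndepFun_point.comp (fun _ => _) fun _ => hφ)
    (fun i j => ((h.identDistrib_point i j).comp hφ).map_eq) N (by linarith)

end

/-- The expected PCP volume exceeds the volume of the highest-density set by a fixed amount. The
coverage probability of a union of equal balls around Gaussian draws cannot jump at the boundary of
the highest-density set, so the Neyman–Pearson inequality is strict by a uniform margin. -/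
theorem IsSample.exists_excess_volume {Ω 𝒳 : Type*} [MeasurableSpace Ω] [MeasurableSpace 𝒳]
    {P : Measure Ω} [IsProbabilityMeasure P] {PX : Measure 𝒳} [IsProbabilityMeasure PX] {d : ℕ}
    {X : ℕ → Ω → 𝒳} {Y : ℕ → Ω → Resp d} {Yhat : ℕ → ℕ → Ω → Resp d}
    (hd : 0 < d) {μ : Resp d} {S : Matrix (Fin d) (Fin d) ℝ} (hS : S.PosDef)
    (h : IsSample P PX (multivariateGaussian μ S) X Y Yhat) {α : ℝ} (hα0 : 0 < α)
    (hα : α < 1) {τ : ℝ} (hτ : 0 < τ)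
    (hmass : multivariateGaussian μ S (superlevelSet (gaussianDensity μ S) τ) =
      ENNReal.ofReal (1 - α)) :
    ∃ δ : ℝ, 0 < δ ∧ ∀ M N : ℕ, 1 ≤ M →
      volume (superlevelSet (gaussianDensity μ S) τ) + ENNReal.ofReal δ ≤
        ∫⁻ ω, volume (pcpSet Y Yhat α M N ω) ∂P := by
  have hcont := continuous_gaussianDensity (S := S) μ
  have hF : τ < gaussianDensity μ S μ := lt_gaussianDensity_of_mass_pos hd hS μ (by
    rw [hmass]; exact (ENNReal.ofReal_pos.2 (by linarith)).ne')
  set F := gaussianDensity μ S μ with hFdef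
  set κ := min ((F - τ) / 2) (τ / 4)
  have hκ : 0 < κ := lt_min (by linarith) (by linarith)
  have hκ1 : κ ≤ (F - τ) / 2 := min_le_left _ _
  have hκ2 : κ ≤ τ / 4 := min_le_right _ _
  obtain ⟨p, hp⟩ := exists_gaussianDensity_eq hd hS μ (c := τ / 2) (by linarith)
    (by rw [← hFdef]; linarith)
  set U₁ : Set (Resp d) := {y | τ + κ < gaussianDensity μ S y} with hU₁
  set U₂ : Set (Resp d) := {y | gaussianDensity μ S y < τ - κ} ∩ Metric.ball p 1 with hU₂
  have hU₁o : IsOpen U₁ := isOpen_lt continuous_const hcont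
  have hU₂o : IsOpen U₂ := (isOpen_lt hcont continuous_const).inter Metric.isOpen_ball
  have hU₁v : volume U₁ ≠ 0 := hU₁o.measure_ne_zero volume ⟨μ, by
    rw [hU₁, Set.mem_ofPred_eq]; linarith⟩
  have hU₂v : volume U₂ ≠ 0 := hU₂o.measure_ne_zero volume ⟨p, by
    rw [hU₂, Set.mem_inter_iff, Set.mem_ofPred_eq, hp]
    exact ⟨by linarith, Metric.mem_ball_self one_pos⟩⟩
  obtain ⟨δ, hδ, hlow⟩ := exists_miss_add_hit_volume hS μ p hU₁v hU₂v hU₁o.measurableSet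
    hU₂o.measurableSet Set.inter_subset_right
  have hδ1 : 0 < (min δ 1).toReal := ENNReal.toReal_pos (by simp [hδ]) (by simp)
  refine ⟨κ / τ * (min δ 1).toReal, by positivity, fun M N hM => ?_⟩
  set γ := multivariateGaussian μ S
  set C := superlevelSet (gaussianDensity μ S) τ
  have hG := measurableSet_pcpRegion (d := d) α M N
  have hsec : ∀ ω, pcpSet Y Yhat α M N ω =
      {y | (calibScores Y Yhat M N ω, (fun k => Yhat N k ω), y) ∈ pcpRegion d α M N} := fun ω => by
    ext y
    exact mem_pcpSet_iff hα M N ω y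
  have hwm : Measurable fun ω => (fun k => Yhat N k ω) := measurable_pi_lambda _ (h.measurable_Yhat N)
  have hA : MeasurableSet {q : Ω × Resp d | q.2 ∈ pcpSet Y Yhat α M N q.1} := by
    simp_rw [hsec]
    exact hG.preimage (((h.measurable_calibScores M N).comp measurable_fst).prodMk
      ((hwm.comp measurable_fst).prodMk measurable_snd))
  have hAω : ∀ ω, MeasurableSet (pcpSet Y Yhat α M N ω) := fun ω => measurable_prodMk_left hA
  have hmv : Measurable fun ω => volume (pcpSet Y Yhat α M N ω) := measurable_measure_prodMk_left hA
  have hm1 : Measurable fun ω => volume (U₁ \ pcpSet Y Yhat α M N ω) :=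
    measurable_measure_prodMk_left ((hU₁o.measurableSet.preimage measurable_snd).diff hA)
  have hm2 : Measurable fun ω => volume (U₂ ∩ pcpSet Y Yhat α M N ω) :=
    measurable_measure_prodMk_left ((hU₂o.measurableSet.preimage measurable_snd).inter hA)
  have hnp := lintegral_mono (μ := P) fun ω => neymanPearson_slack hcont.measurable
    (fun y => (gaussianDensity_pos hS μ y).le) hτ.le hκ.le (hAω ω) hU₁o.measurableSet
    hU₂o.measurableSet (fun y hy => (le_of_lt hy : τ + κ ≤ _))
    (fun y hy => ⟨by have := hy.1; rw [Set.mem_ofPred_eq] at this; linarith,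
      by have := hy.1; rw [Set.mem_ofPred_eq] at this; linarith⟩)
  rw [← multivariateGaussian_eq_withDensity hS] at hnp
  have hexcess : δ ≤ ∫⁻ ω, (volume (U₁ \ pcpSet Y Yhat α M N ω) +
      volume (U₂ ∩ pcpSet Y Yhat α M N ω)) ∂P := by
    have hpc : IsProbabilityMeasure (P.map (calibScores Y Yhat M N)) :=
      Measure.isProbabilityMeasure_map (h.measurable_calibScores M N).aemeasurable
    have i1 : ∀ ω, volume (U₁ \ pcpSet Y Yhat α M N ω) = (volume.restrict U₁)
        {y | (calibScores Y Yhat M N ω, (fun k => Yhat N k ω), y) ∈ (pcpRegion d α M N)ᶜ} :=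
      fun ω => by
        rw [Measure.restrict_apply' hU₁o.measurableSet, Set.inter_comm, hsec]
        rfl
    have i2 : ∀ ω, volume (U₂ ∩ pcpSet Y Yhat α M N ω) = (volume.restrict U₂)
        {y | (calibScores Y Yhat M N ω, (fun k => Yhat N k ω), y) ∈ (pcpRegion d α M N)} :=
      fun ω => by
        rw [Measure.restrict_apply' hU₂o.measurableSet, Set.inter_comm, hsec]
    rw [lintegral_add_left hm1]
    simp_rw [i1, i2]
    rw [h.lintegral_section M N _ hG.compl, h.lintegral_section M N _ hG, ← lintegral_add_left
      (measurable_measure_prodMk_left hG.compl)]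
    calc δ = ∫⁻ _, δ ∂(P.map (calibScores Y Yhat M N)) := by simp
      _ ≤ _ := lintegral_mono fun c => ?_
    obtain ⟨T, hT⟩ := mem_pcpRegion_iff (d := d) hα M N c
    refine (hlow M hM T).trans (le_of_eq ?_)
    rw [Measure.prod_apply_symm (measurable_prodMk_left hG.compl),
      Measure.prod_apply_symm (measurable_prodMk_left hG)]
    congr 1
    · refine lintegral_congr fun y => ?_
      congr 1
      ext w
      simp [hT]
    · refine lintegral_congr fun y => ?_
      congr 1
      ext w
      simp [hT]
  rw [lintegral_add_right _ (by fun_prop), lintegral_add_left measurable_const,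
    lintegral_add_right _ measurable_const,
    lintegral_const, lintegral_const, measure_univ, mul_one, mul_one, lintegral_const_mul _ hmv,
    lintegral_const_mul' _ _ ENNReal.ofReal_ne_top] at hnp
  have hcov := h.le_lintegral_pcpSet_mass hα0 hα M N
  rw [← hmass] at hcov
  have hfin : γ C + (ENNReal.ofReal τ * volume C + ENNReal.ofReal κ * δ) ≤
      γ C + ENNReal.ofReal τ * ∫⁻ ω, volume (pcpSet Y Yhat α M N ω) ∂P := by
    rw [← add_assoc]
    refine le_trans ?_ hnp
    gcongr
  have hfin2 := (ENNReal.add_le_add_iff_left (measure_ne_top _ _)).1 hfin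
  have hstep : ENNReal.ofReal τ * (volume C + ENNReal.ofReal (κ / τ * (min δ 1).toReal)) ≤
      ENNReal.ofReal τ * ∫⁻ ω, volume (pcpSet Y Yhat α M N ω) ∂P := by
    refine le_trans ?_ hfin2
    rw [mul_add, ← ENNReal.ofReal_mul hτ.le]
    gcongr
    rw [show τ * (κ / τ * (min δ 1).toReal) = κ * (min δ 1).toReal by field_simp,
      ENNReal.ofReal_mul hκ.le, ENNReal.ofReal_toReal (by simp)]
    gcongr
    exact min_le_left _ _
  exact (ENNReal.mul_le_mul_iff_right (ENNReal.ofReal_pos.2 hτ).ne' ENNReal.ofReal_ne_top).1 hstep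

end ConformalGen

namespace ConformalGen

/-! ### Narrow kernels: the nearest draw dominates -/

section Kernel

variable {d : ℕ}

/-- The weight `exp (-(‖x‖² - ‖x'‖²) / (2 σ²))` of a point `x` relative to a point `x'` that is
nearer to the origin, for `x'` in the ball of radius `ρ`. -/
noncomputable def gapKernel (ρ σ : ℝ) (p : Resp d × Resp d) : ℝ≥0∞ :=
  {p : Resp d × Resp d | ‖p.2‖ ≤ ρ ∧ ‖p.2‖ ≤ ‖p.1‖}.indicator
    (fun p => ENNReal.ofReal (Real.exp (-((‖p.1‖ ^ 2 - ‖p.2‖ ^ 2) / (2 * σ ^ 2))))) p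

lemma measurable_gapKernel (ρ σ : ℝ) : Measurable (gapKernel (d := d) ρ σ) := by
  refine Measurable.indicator (by fun_prop) ?_
  exact (measurableSet_le measurable_snd.norm measurable_const).inter
    (measurableSet_le measurable_snd.norm measurable_fst.norm)

lemma gapKernel_smul {r : ℝ} (hr : 0 < r) (ρ σ : ℝ) (x x' : Resp d) :
    gapKernel (r * ρ) (r * σ) (r • x, r • x') = gapKernel ρ σ (x, x') := by
  unfold gapKernel
  have hiff : (r • x, r • x') ∈ {p : Resp d × Resp d | ‖p.2‖ ≤ r * ρ ∧ ‖p.2‖ ≤ ‖p.1‖} ↔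
      (x, x') ∈ {p : Resp d × Resp d | ‖p.2‖ ≤ ρ ∧ ‖p.2‖ ≤ ‖p.1‖} := by
    simp only [Set.mem_ofPred_eq, norm_smul, Real.norm_eq_abs, abs_of_pos hr]
    rw [mul_le_mul_iff_right₀ hr, mul_le_mul_iff_right₀ hr]
  by_cases h : (x, x') ∈ {p : Resp d × Resp d | ‖p.2‖ ≤ ρ ∧ ‖p.2‖ ≤ ‖p.1‖}
  · rw [Set.indicator_of_mem h, Set.indicator_of_mem (hiff.2 h)]
    simp only [norm_smul, Real.norm_eq_abs, abs_of_pos hr]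
    congr 3
    rw [show (r * ‖x‖) ^ 2 - (r * ‖x'‖) ^ 2 = r ^ 2 * (‖x‖ ^ 2 - ‖x'‖ ^ 2) by ring,
      show 2 * (r * σ) ^ 2 = r ^ 2 * (2 * σ ^ 2) by ring, mul_div_mul_left _ _ (by positivity)]
  · rw [Set.indicator_of_notMem h, Set.indicator_of_notMem (fun h' => h (hiff.1 h'))]

lemma lintegral_eq_smul {r : ℝ} (hr : 0 < r) {g : Resp d → ℝ≥0∞} (hg : Measurable g) :
    ∫⁻ x, g x = ENNReal.ofReal (r ^ d) * ∫⁻ x, g (r • x) := by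
  have h := Measure.map_addHaar_smul (volume : Measure (Resp d)) hr.ne'
  have h1 : ∫⁻ x, g (r • x) = ∫⁻ x, g x ∂((volume : Measure (Resp d)).map (r • ·)) :=
    (lintegral_map hg (measurable_const_smul r)).symm
  rw [h1, h, lintegral_smul_measure, smul_eq_mul, ← mul_assoc, finrank_euclideanSpace,
    Fintype.card_fin, abs_of_pos (by positivity), ← ENNReal.ofReal_mul (by positivity),
    mul_inv_cancel₀ (by positivity), ENNReal.ofReal_one, one_mul]

lemma lintegral_gapKernel_scale {r : ℝ} (hr : 0 < r) (ρ σ : ℝ) :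
    ∫⁻ x, ∫⁻ x', gapKernel (d := d) (r * ρ) (r * σ) (x, x') =
      ENNReal.ofReal (r ^ d) * (ENNReal.ofReal (r ^ d) * ∫⁻ p, gapKernel (d := d) ρ σ p) := by
  rw [lintegral_eq_smul hr (measurable_gapKernel _ _).lintegral_prod_right']
  congr 1
  rw [Measure.volume_eq_prod, lintegral_prod _ (measurable_gapKernel _ _).aemeasurable,
    ← lintegral_const_mul _ (measurable_gapKernel _ _).lintegral_prod_right']
  refine lintegral_congr fun x => ?_
  rw [lintegral_eq_smul (g := fun x' => gapKernel (r * ρ) (r * σ) (r • x, x')) hr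
    ((measurable_gapKernel _ _).comp measurable_prodMk_left)]
  simp only [gapKernel_smul hr]

lemma lintegral_exp_neg_sq_lt_top :
    ∫⁻ x : Resp d, ENNReal.ofReal (Real.exp (-(1 / 2) * ‖x‖ ^ 2)) < ∞ := by
  have h : (stdGaussian (Resp d)) Set.univ = 1 := measure_univ
  rw [stdGaussian_eq_withDensity, withDensity_apply _ MeasurableSet.univ,
    Measure.restrict_univ] at h
  have hc : (0 : ℝ) < (Real.sqrt ((2 * Real.pi) ^ d))⁻¹ := by positivity
  simp_rw [ENNReal.ofReal_mul hc.le] at h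
  rw [lintegral_const_mul _ (by fun_prop)] at h
  by_contra hinf
  rw [not_lt, top_le_iff] at hinf
  rw [hinf, ENNReal.mul_top (ENNReal.ofReal_pos.2 hc).ne'] at h
  exact ENNReal.top_ne_one h

lemma lintegral_gapKernel_lt_top (K : ℝ) : ∫⁻ p, gapKernel (d := d) K 1 p < ∞ := by
  calc ∫⁻ p, gapKernel (d := d) K 1 p
      ≤ ∫⁻ p : Resp d × Resp d, ENNReal.ofReal (Real.exp (-(1 / 2) * ‖p.1‖ ^ 2)) *
          (Metric.closedBall (0 : Resp d) K).indicator
            (fun _ => ENNReal.ofReal (Real.exp (K ^ 2 / 2))) p.2 := by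
        refine lintegral_mono fun p => ?_
        unfold gapKernel
        by_cases hp : p ∈ {p : Resp d × Resp d | ‖p.2‖ ≤ K ∧ ‖p.2‖ ≤ ‖p.1‖}
        swap
        · rw [Set.indicator_of_notMem hp]
          exact bot_le
        rw [Set.indicator_of_mem hp]
        have hmem : p.2 ∈ Metric.closedBall (0 : Resp d) K := by simpa using hp.1
        rw [Set.indicator_of_mem hmem, ← ENNReal.ofReal_mul (Real.exp_pos _).le, ← Real.exp_add]
        refine ENNReal.ofReal_le_ofReal (Real.exp_le_exp.2 ?_)
        have : ‖p.2‖ ^ 2 ≤ K ^ 2 := pow_le_pow_left₀ (norm_nonneg _) hp.1 2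
        linarith
    _ = (∫⁻ x : Resp d, ENNReal.ofReal (Real.exp (-(1 / 2) * ‖x‖ ^ 2))) *
          ∫⁻ x, (Metric.closedBall (0 : Resp d) K).indicator
            (fun _ => ENNReal.ofReal (Real.exp (K ^ 2 / 2))) x := by
        exact lintegral_prod_mul (μ := (volume : Measure (Resp d)))
          (ν := (volume : Measure (Resp d)))
          (f := fun x => ENNReal.ofReal (Real.exp (-(1 / 2) * ‖x‖ ^ 2))) (by fun_prop)
          (measurable_const.indicator Metric.isClosed_closedBall.measurableSet).aemeasurable
    _ < ∞ := by
        refine ENNReal.mul_lt_top lintegral_exp_neg_sq_lt_top ?_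
        rw [lintegral_indicator Metric.isClosed_closedBall.measurableSet, setLIntegral_const]
        exact ENNReal.mul_lt_top ENNReal.ofReal_lt_top measure_closedBall_lt_top

lemma tendsto_lintegral_gapKernel (hd : 0 < d) (K : ℝ) :
    Tendsto (fun s => ∫⁻ p, gapKernel (d := d) K s p) (𝓝[>] 0) (𝓝 0) := by
  have : Nonempty (Fin d) := ⟨⟨0, hd⟩⟩
  have h0 : ∫⁻ _ : Resp d × Resp d, (0 : ℝ≥0∞) = 0 := by simp
  rw [← h0]
  refine tendsto_lintegral_filter_of_dominated_convergence (gapKernel K 1)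
    (Eventually.of_forall fun s => measurable_gapKernel K s) ?_
    (lintegral_gapKernel_lt_top K).ne ?_
  · filter_upwards [Ioo_mem_nhdsGT (zero_lt_one (α := ℝ))] with s hs
    refine Eventually.of_forall fun p => ?_
    unfold gapKernel
    refine Set.indicator_le_indicator' fun hp => ENNReal.ofReal_le_ofReal (Real.exp_le_exp.2 ?_)
    have h1 : ‖p.2‖ ^ 2 ≤ ‖p.1‖ ^ 2 := pow_le_pow_left₀ (norm_nonneg _) hp.2 2
    have h2 : s ^ 2 ≤ 1 ^ 2 := pow_le_pow_left₀ hs.1.le hs.2.le 2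
    have h3 : 0 < s := hs.1
    rw [neg_le_neg_iff]
    gcongr
  · have hnull : ∀ᵐ p : Resp d × Resp d, ‖p.1‖ ≠ ‖p.2‖ := by
      rw [ae_iff]
      simp only [ne_eq, not_not]
      rw [Measure.volume_eq_prod, Measure.measure_prod_null
        (measurableSet_eq_fun (by fun_prop) (by fun_prop))]
      refine Eventually.of_forall fun x => ?_
      have : Prod.mk x ⁻¹' {p : Resp d × Resp d | ‖p.1‖ = ‖p.2‖} = Metric.sphere 0 ‖x‖ := by
        ext z; simp [eq_comm]
      change volume (Prod.mk x ⁻¹' {p : Resp d × Resp d | ‖p.1‖ = ‖p.2‖}) = 0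
      rw [this]
      exact Measure.addHaar_sphere _ _ _
    filter_upwards [hnull] with p hp
    unfold gapKernel
    by_cases hmem : p ∈ {p : Resp d × Resp d | ‖p.2‖ ≤ K ∧ ‖p.2‖ ≤ ‖p.1‖}
    · simp only [Set.indicator_of_mem hmem]
      have hpos : 0 < ‖p.1‖ ^ 2 - ‖p.2‖ ^ 2 := by
        have := pow_lt_pow_left₀ (lt_of_le_of_ne hmem.2 (Ne.symm hp)) (norm_nonneg _) two_ne_zero
        linarith
      rw [← ENNReal.ofReal_zero]
      refine ENNReal.tendsto_ofReal (Real.tendsto_exp_neg_atTop_nhds_zero.comp ?_)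
      refine Tendsto.const_mul_atTop hpos (tendsto_inv_nhdsGT_zero.comp ?_)
      refine tendsto_nhdsWithin_iff.2 ⟨?_, ?_⟩
      · have : Tendsto (fun s : ℝ => 2 * s ^ 2) (𝓝 0) (𝓝 (2 * 0 ^ 2)) :=
          Continuous.tendsto (by fun_prop) 0
        simp only [ne_eq, OfNat.ofNat_ne_zero, not_false_eq_true, zero_pow, mul_zero] at this
        exact this.mono_left nhdsWithin_le_nhds
      · filter_upwards [self_mem_nhdsWithin] with s hs
        have : (0 : ℝ) < s := hs
        change (0 : ℝ) < 2 * s ^ 2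
        positivity
    · simp only [Set.indicator_of_notMem hmem]
      exact tendsto_const_nhds

/-- The two scores differ by at most the total relative weight of the draws other than the
nearest. -/
lemma ofReal_kdeMaxScore_sub_kdeScore_le {M : ℕ} (hM : 1 ≤ M) {σ : ℝ} (hσ : 0 < σ)
    (e : Fin M → Resp d) (y : Resp d) {ρ : ℝ} (hρ : pcpScore e y ≤ ρ) :
    ENNReal.ofReal |kdeMaxScore σ e y - kdeScore σ e y| ≤
      ∑ k, ∑ m ∈ Finset.univ.erase k, gapKernel ρ σ (y - e m, y - e k) := by
  obtain ⟨k, hk⟩ := (pcpScore_le_iff hM e y _).1 le_rfl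
  have hk' : ∀ m, pcpScore e y ≤ ‖y - e m‖ := fun m => (pcpScore_le_iff hM e y _).2 ⟨m, le_rfl⟩
  have hkeq : ‖y - e k‖ = pcpScore e y := le_antisymm hk (hk' k)
  have hM' : (0 : ℝ) < M := by exact_mod_cast hM
  set c := (Real.sqrt ((2 * Real.pi) ^ d * (σ ^ 2) ^ d))⁻¹ with hc
  set E : Fin M → ℝ := fun m => Real.exp (-((‖y - e m‖ ^ 2 - ‖y - e k‖ ^ 2) / (2 * σ ^ 2))) with hE
  set B := 1 / (M : ℝ) * (c * Real.exp (-(pcpScore e y ^ 2 / (2 * σ ^ 2)))) with hB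
  have hBpos : 0 < B := by positivity
  have hkde : kde σ e y = B * ∑ m, E m := by
    unfold kde
    rw [Finset.mul_sum]
    refine Finset.sum_congr rfl fun m _ => ?_
    rw [gaussianDensity_smul_one _ hσ, ← hc, hB, hE, mul_assoc, mul_assoc, ← Real.exp_add, hkeq]
    congr 3
    ring
  have hEk : E k = 1 := by simp [hE]
  have hsum : ∑ m, E m = 1 + ∑ m ∈ Finset.univ.erase k, E m := by
    rw [← Finset.add_sum_erase _ _ (Finset.mem_univ k), hEk]
  have hrest : 0 ≤ ∑ m ∈ Finset.univ.erase k, E m :=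
    Finset.sum_nonneg fun m _ => (Real.exp_pos _).le
  have hdiff : kdeMaxScore σ e y - kdeScore σ e y = Real.log (∑ m, E m) := by
    unfold kdeMaxScore kdeScore
    rw [iSup_kernel_eq hM hσ, ← hc, ← hB, hkde, Real.log_mul hBpos.ne' (by rw [hsum]; positivity)]
    ring
  rw [hdiff, abs_of_nonneg (Real.log_nonneg (by linarith))]
  calc ENNReal.ofReal (Real.log (∑ m, E m))
      ≤ ENNReal.ofReal (∑ m ∈ Finset.univ.erase k, E m) := by
        refine ENNReal.ofReal_le_ofReal ?_
        have := Real.log_le_sub_one_of_pos (x := ∑ m, E m) (by linarith)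
        linarith
    _ = ∑ m ∈ Finset.univ.erase k, ENNReal.ofReal (E m) :=
        ENNReal.ofReal_sum_of_nonneg fun m _ => (Real.exp_pos _).le
    _ = ∑ m ∈ Finset.univ.erase k, gapKernel ρ σ (y - e m, y - e k) := by
        refine Finset.sum_congr rfl fun m _ => ?_
        unfold gapKernel
        rw [Set.indicator_of_mem (by
          exact ⟨hkeq.le.trans hρ, hkeq.le.trans (hk' m)⟩)]
    _ ≤ _ := Finset.single_le_sum (f := fun k => ∑ m ∈ Finset.univ.erase k,
        gapKernel ρ σ (y - e m, y - e k)) (fun _ _ => bot_le) (Finset.mem_univ k)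

end Kernel

end ConformalGen

namespace ConformalGen

section KernelAsymptotics

variable {d : ℕ} {S : Matrix (Fin d) (Fin d) ℝ}

lemma lintegral_gaussian_le (hS : S.PosDef) (μ : Resp d) (g : Resp d → ℝ≥0∞) :
    ∫⁻ x, g x ∂(multivariateGaussian μ S) ≤
      ENNReal.ofReal (gaussianDensity μ S μ) * ∫⁻ x, g x := by
  have h : multivariateGaussian μ S ≤
      ENNReal.ofReal (gaussianDensity μ S μ) • (volume : Measure (Resp d)) :=
    Measure.le_iff.2 fun s _ => gaussian_le_volume hS μ s
  calc _ ≤ ∫⁻ x, g x ∂(ENNReal.ofReal (gaussianDensity μ S μ) • (volume : Measure (Resp d))) :=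
        lintegral_mono' h le_rfl
    _ = _ := by rw [lintegral_smul_measure, smul_eq_mul]

variable {Ω 𝒳 : Type*} [MeasurableSpace Ω] [MeasurableSpace 𝒳] {P : Measure Ω}
  [IsProbabilityMeasure P] {PX : Measure 𝒳} [IsProbabilityMeasure PX] {μ : Resp d}
  {X : ℕ → Ω → 𝒳} {Y : ℕ → Ω → Resp d} {Yhat : ℕ → ℕ → Ω → Resp d}

lemma IsSample.lintegral_gapKernel_le (hS : S.PosDef)
    (h : IsSample P PX (multivariateGaussian μ S) X Y Yhat) (i : ℕ) (y : Resp d) {m k : ℕ}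
    (hmk : m ≠ k) (ρ σ : ℝ) :
    ∫⁻ ω, gapKernel ρ σ (y - Yhat i m ω, y - Yhat i k ω) ∂P ≤
      ENNReal.ofReal (gaussianDensity μ S μ) * (ENNReal.ofReal (gaussianDensity μ S μ) *
        ∫⁻ x, ∫⁻ x', gapKernel (d := d) ρ σ (x, x')) := by
  have hm := h.measurable_Yhat i m
  have hk := h.measurable_Yhat i k
  have hg : Measurable fun p : Resp d × Resp d => gapKernel ρ σ (y - p.1, y - p.2) :=
    (measurable_gapKernel ρ σ).comp (by fun_prop)
  have hlaw := (indepFun_iff_map_prod_eq_prod_map_map hm.aemeasurable hk.aemeasurable).1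
    ((h.iIndepFun_Yhat i).indepFun hmk)
  rw [h.map_Yhat, h.map_Yhat] at hlaw
  have h1 : ∫⁻ ω, gapKernel ρ σ (y - Yhat i m ω, y - Yhat i k ω) ∂P =
      ∫⁻ p, gapKernel ρ σ (y - p.1, y - p.2)
        ∂(P.map fun ω => (Yhat i m ω, Yhat i k ω)) := by
    rw [lintegral_map hg (hm.prodMk hk)]
  rw [h1, hlaw, lintegral_prod _ hg.aemeasurable]
  refine (lintegral_gaussian_le hS μ _).trans ?_
  gcongr
  have h2 : ∀ x, ∫⁻ x', gapKernel ρ σ (y - x, y - x') ∂(multivariateGaussian μ S) ≤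
      ENNReal.ofReal (gaussianDensity μ S μ) * ∫⁻ x', gapKernel (d := d) ρ σ (y - x, x') :=
    fun x => by
      refine (lintegral_gaussian_le hS μ _).trans ?_
      rw [lintegral_sub_left_eq_self (fun x' => gapKernel (d := d) ρ σ (y - x, x')) y]
  refine (lintegral_mono h2).trans ?_
  have h3 : Measurable fun x => ∫⁻ x', gapKernel (d := d) ρ σ (y - x, x') :=
    (measurable_gapKernel ρ σ).lintegral_prod_right'.comp (measurable_const_sub y)
  rw [lintegral_const_mul _ h3, lintegral_sub_left_eq_self
    (fun x => ∫⁻ x', gapKernel (d := d) ρ σ (x, x')) y]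

/-- The nearest of `M` Gaussian draws is unlikely to be further away than a large multiple of
`M ^ (-1 / d)`. -/
lemma exists_measure_lt_pcpScore_le (hS : S.PosDef) (μ y : Resp d) :
    ∃ c : ℝ, 0 < c ∧ ∀ M : ℕ, 1 ≤ M → ∀ ρ : ℝ, 0 ≤ ρ → ρ ≤ 1 →
      (Measure.infinitePi fun _ : ℕ => multivariateGaussian μ S)
        {w | ρ < pcpScore (firstDraws M w) y} ≤
        ENNReal.ofReal (Real.exp (-(c * (M * ρ ^ d)))) := by
  obtain ⟨m, hm, hlow⟩ := exists_volume_le_gaussian hS μ y 1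
  have hv : 0 < volume.real (Metric.ball (0 : Resp d) 1) := ENNReal.toReal_pos
    ((Metric.measure_ball_pos volume _ one_pos).ne') measure_ball_lt_top.ne
  refine ⟨m * volume.real (Metric.ball (0 : Resp d) 1), by positivity, fun M hM ρ h0 h1 => ?_⟩
  rw [infinitePi_lt_pcpScore _ hM]
  refine ENNReal.ofReal_le_ofReal ?_
  have hg : m * (ρ ^ d * volume.real (Metric.ball (0 : Resp d) 1)) ≤
      (multivariateGaussian μ S).real (Metric.closedBall y ρ) := by
    have h2 := ENNReal.toReal_mono (measure_ne_top _ _)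
      (hlow (Metric.closedBall y ρ) (Metric.closedBall_subset_closedBall h1))
    rwa [Measure.addHaar_closedBall volume _ h0, ENNReal.toReal_mul, ENNReal.toReal_mul,
      ENNReal.toReal_ofReal hm.le, ENNReal.toReal_ofReal (by positivity),
      finrank_euclideanSpace, Fintype.card_fin] at h2
  have hg1 : (multivariateGaussian μ S).real (Metric.closedBall y ρ) ≤ 1 := measureReal_le_one
  calc _ ≤ (Real.exp (-(multivariateGaussian μ S).real (Metric.closedBall y ρ))) ^ M := by
        refine pow_le_pow_left₀ (by linarith) ?_ M
        have := Real.add_one_le_exp (-(multivariateGaussian μ S).real (Metric.closedBall y ρ))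
        linarith
    _ = Real.exp (-(M * (multivariateGaussian μ S).real (Metric.closedBall y ρ))) := by
        rw [← Real.exp_nat_mul]; ring_nf
    _ ≤ _ := by
        rw [Real.exp_le_exp, neg_le_neg_iff]
        have : (M : ℝ) * (m * (ρ ^ d * volume.real (Metric.ball (0 : Resp d) 1))) ≤
          M * (multivariateGaussian μ S).real (Metric.closedBall y ρ) := by gcongr
        linarith

lemma natCast_mul_rpow_pow (hd : 0 < d) {M : ℕ} (hM : 1 ≤ M) :
    (M : ℝ) * ((M : ℝ) ^ (-(1 / (d : ℝ)))) ^ d = 1 := by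
  have hM' : (0 : ℝ) < M := by exact_mod_cast hM
  have hd' : (d : ℝ) ≠ 0 := by exact_mod_cast hd.ne'
  rw [← Real.rpow_natCast, ← Real.rpow_mul hM'.le, show -(1 / (d : ℝ)) * d = -1 by field_simp,
    Real.rpow_neg_one, mul_inv_cancel₀ hM'.ne']

lemma tendsto_bandwidth_ratio {σ : ℕ → ℝ} (hσ : ∀ M, 0 < σ M)
    (ho : σ =o[atTop] (fun M : ℕ => (M : ℝ) ^ (-(1 / (d : ℝ))))) :
    Tendsto (fun M : ℕ => σ M / (M : ℝ) ^ (-(1 / (d : ℝ)))) atTop (𝓝[>] 0) := by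
  have hpos : ∀ᶠ M : ℕ in atTop, (0 : ℝ) < (M : ℝ) ^ (-(1 / (d : ℝ))) := by
    filter_upwards [eventually_ge_atTop 1] with M hM
    have hM' : (0 : ℝ) < M := by exact_mod_cast hM
    positivity
  refine tendsto_nhdsWithin_iff.2 ⟨ho.tendsto_div_nhds_zero, ?_⟩
  filter_upwards [hpos] with M hM
  exact div_pos (hσ M) hM

lemma tendsto_natCast_rpow_neg (hd : 0 < d) :
    Tendsto (fun M : ℕ => (M : ℝ) ^ (-(1 / (d : ℝ)))) atTop (𝓝 0) :=
  (tendsto_rpow_neg_atTop (by positivity)).comp tendsto_natCast_atTop_atTop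

/-- For bandwidths `o(M ^ (-1 / d))` the kernel density estimate is dominated by its largest term. -/
theorem IsSample.tendstoInMeasure_kdeMaxScore_sub (hd : 0 < d) (hS : S.PosDef)
    (h : IsSample P PX (multivariateGaussian μ S) X Y Yhat) {σ : ℕ → ℝ} (hσ : ∀ M, 0 < σ M)
    (ho : σ =o[atTop] (fun M : ℕ => (M : ℝ) ^ (-(1 / (d : ℝ))))) (i : ℕ) (y : Resp d) :
    TendstoInMeasure P (fun M ω => kdeMaxScore (σ M) (ensemble Yhat M ω i) y -
      kdeScore (σ M) (ensemble Yhat M ω i) y) atTop (fun _ => 0) := by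
  intro ε hε
  wlog hεtop : ε ≠ ∞ generalizing ε with H
  · have h1 := H 1 one_pos ENNReal.one_ne_top
    refine tendsto_of_tendsto_of_tendsto_of_le_of_le tendsto_const_nhds h1 (fun _ => bot_le)
      fun M => measure_mono fun ω hω => ?_
    rw [not_not] at hεtop
    rw [hεtop, Set.mem_ofPred_eq] at hω
    exact le_trans le_top hω
  rw [ENNReal.tendsto_nhds_zero]
  intro η hη
  obtain ⟨c, hc, hfar⟩ := exists_measure_lt_pcpScore_le hS μ y
  set F := ENNReal.ofReal (gaussianDensity μ S μ)
  have hη2 : 0 < η / 2 := ENNReal.half_pos hη.ne'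
  -- a radius `K` (in units of `M ^ (-1 / d)`) that the nearest draw rarely exceeds
  obtain ⟨K, hK0, hK⟩ : ∃ K : ℝ, 0 < K ∧ ENNReal.ofReal (Real.exp (-(c * K ^ d))) ≤ η / 2 := by
    have ht : Tendsto (fun K : ℝ => ENNReal.ofReal (Real.exp (-(c * K ^ d)))) atTop (𝓝 0) := by
      rw [← ENNReal.ofReal_zero]
      exact ENNReal.tendsto_ofReal (Real.tendsto_exp_neg_atTop_nhds_zero.comp
        (Tendsto.const_mul_atTop hc (tendsto_pow_atTop hd.ne')))
    obtain ⟨K, hK⟩ := ((eventually_gt_atTop 0).and ((ENNReal.tendsto_nhds_zero.1 ht) _ hη2)).exists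
    exact ⟨K, hK⟩
  have hlim : Tendsto (fun M : ℕ => F * (F * ∫⁻ p, gapKernel (d := d) K
      (σ M / (M : ℝ) ^ (-(1 / (d : ℝ)))) p) / ε) atTop (𝓝 0) := by
    have h1 := (tendsto_lintegral_gapKernel hd K).comp (tendsto_bandwidth_ratio hσ ho)
    have h2 := ENNReal.Tendsto.const_mul h1 (Or.inr (ENNReal.ofReal_ne_top (r := gaussianDensity μ S μ)))
    have h3 := ENNReal.Tendsto.const_mul h2 (Or.inr (ENNReal.ofReal_ne_top (r := gaussianDensity μ S μ)))
    have h4 := ENNReal.Tendsto.div_const h3 (Or.inr hε.ne')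
    simpa using h4
  have hsmall : ∀ᶠ M : ℕ in atTop, (M : ℝ) ^ (-(1 / (d : ℝ))) * K ≤ 1 := by
    have h1 := (tendsto_natCast_rpow_neg hd).mul_const K
    rw [zero_mul] at h1
    exact h1.eventually_le_const one_pos
  filter_upwards [eventually_ge_atTop 1, hsmall, (ENNReal.tendsto_nhds_zero.1 hlim) _ hη2]
    with M hM hrK hDη
  have hM' : (0 : ℝ) < M := by exact_mod_cast hM
  set r := (M : ℝ) ^ (-(1 / (d : ℝ)))
  have hrpos : 0 < r := by positivity
  have hMr : (M : ℝ) * r ^ d = 1 := natCast_mul_rpow_pow hd hM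
  set D : Ω → ℝ≥0∞ := fun ω => ∑ k : Fin M, ∑ m ∈ Finset.univ.erase k,
    gapKernel (r * K) (σ M) (y - Yhat i m ω, y - Yhat i k ω) with hD
  have hgm : ∀ k m : Fin M, Measurable fun ω =>
      gapKernel (r * K) (σ M) (y - Yhat i m ω, y - Yhat i k ω) := fun k m =>
    (measurable_gapKernel _ _).comp (((h.measurable_Yhat i m).const_sub y).prodMk
      ((h.measurable_Yhat i k).const_sub y))
  have hDm : Measurable D := Finset.measurable_sum _ fun k _ => Finset.measurable_sum _ fun m _ =>
    hgm k m
  have hsub : {ω | ε ≤ edist (kdeMaxScore (σ M) (ensemble Yhat M ω i) y -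
      kdeScore (σ M) (ensemble Yhat M ω i) y) 0} ⊆
      {ω | r * K < pcpScore (ensemble Yhat M ω i) y} ∪ {ω | ε ≤ D ω} := by
    intro ω hω
    rcases lt_or_ge (r * K) (pcpScore (ensemble Yhat M ω i) y) with hlt | hle
    · exact Or.inl hlt
    · right
      rw [Set.mem_ofPred_eq, edist_zero_right, Real.enorm_eq_ofReal_abs] at hω
      exact hω.trans (ofReal_kdeMaxScore_sub_kdeScore_le hM (hσ M) _ y hle)
  have hP1 : P {ω | r * K < pcpScore (ensemble Yhat M ω i) y} ≤ η / 2 := by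
    have h1 := hfar M hM (r * K) (by positivity) hrK
    rw [← h.map_draws i, Measure.map_apply (measurable_pi_lambda _ (h.measurable_Yhat i))
      (measurableSet_lt measurable_const
        (measurable_pcpScore (fun m => measurable_pi_apply _) measurable_const))] at h1
    refine le_trans h1 (le_trans (le_of_eq ?_) hK)
    rw [mul_pow, ← mul_assoc (M : ℝ), hMr, one_mul]
  have hP2 : P {ω | ε ≤ D ω} ≤ η / 2 := by
    refine (meas_ge_le_lintegral_div hDm.aemeasurable hε.ne' hεtop).trans (le_trans ?_ hDη)
    gcongr
    have hσr : σ M = r * (σ M / r) := by field_simp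
    set I := ∫⁻ p, gapKernel (d := d) K (σ M / r) p
    have hone : ∀ k m : Fin M, m ∈ Finset.univ.erase k →
        ∫⁻ ω, gapKernel (r * K) (σ M) (y - Yhat i m ω, y - Yhat i k ω) ∂P ≤
          F * (F * (ENNReal.ofReal (r ^ d) * (ENNReal.ofReal (r ^ d) * I))) := by
      intro k m hm
      have hmk : (m : ℕ) ≠ k := fun h' => (Finset.mem_erase.1 hm).1 (Fin.ext h')
      refine (h.lintegral_gapKernel_le hS i y hmk _ _).trans (le_of_eq ?_)
      conv_lhs => rw [hσr]
      rw [lintegral_gapKernel_scale hrpos]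
    calc ∫⁻ ω, D ω ∂P = ∑ k : Fin M, ∑ m ∈ Finset.univ.erase k,
          ∫⁻ ω, gapKernel (r * K) (σ M) (y - Yhat i m ω, y - Yhat i k ω) ∂P := by
          rw [hD, lintegral_finsetSum _ fun k _ => Finset.measurable_sum _ fun m _ => hgm k m]
          refine Finset.sum_congr rfl fun k _ => ?_
          rw [lintegral_finsetSum _ fun m _ => hgm k m]
      _ ≤ ∑ k : Fin M, ∑ m ∈ Finset.univ.erase k,
          F * (F * (ENNReal.ofReal (r ^ d) * (ENNReal.ofReal (r ^ d) * I))) :=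
          Finset.sum_le_sum fun k _ => Finset.sum_le_sum fun m hm => hone k m hm
      _ ≤ ∑ k : Fin M, ∑ m : Fin M,
          F * (F * (ENNReal.ofReal (r ^ d) * (ENNReal.ofReal (r ^ d) * I))) :=
          Finset.sum_le_sum fun k _ => Finset.sum_le_sum_of_subset (Finset.erase_subset _ _)
      _ = (ENNReal.ofReal (M * r ^ d)) * (ENNReal.ofReal (M * r ^ d)) * (F * (F * I)) := by
          simp only [Finset.sum_const, Finset.card_univ, Fintype.card_fin, nsmul_eq_mul]
          rw [ENNReal.ofReal_mul hM'.le, ENNReal.ofReal_natCast]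
          ring
      _ = F * (F * I) := by rw [hMr, ENNReal.ofReal_one, one_mul, one_mul]
  calc _ ≤ P ({ω | r * K < pcpScore (ensemble Yhat M ω i) y} ∪ {ω | ε ≤ D ω}) := measure_mono hsub
    _ ≤ _ := measure_union_le _ _
    _ ≤ η / 2 + η / 2 := add_le_add hP1 hP2
    _ = η := ENNReal.add_halves η

end KernelAsymptotics

end ConformalGen

namespace ConformalGen

/-! ### Inconsistency of the undersmoothed kernel density estimate -/

section Inconsistency

variable {d : ℕ} {S : Matrix (Fin d) (Fin d) ℝ}

/-- The part of the Gaussian kernel with bandwidth `σ` outside the ball of radius `K σ`. -/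
noncomputable def tailKernel (K σ : ℝ) (x : Resp d) : ℝ≥0∞ :=
  {x : Resp d | K * σ < ‖x‖}.indicator (fun x => ENNReal.ofReal
    ((Real.sqrt ((2 * Real.pi) ^ d * (σ ^ 2) ^ d))⁻¹ * Real.exp (-(‖x‖ ^ 2 / (2 * σ ^ 2))))) x

lemma measurable_tailKernel (K σ : ℝ) : Measurable (tailKernel (d := d) K σ) :=
  Measurable.indicator (by fun_prop) (measurableSet_lt measurable_const measurable_norm)

lemma lintegral_tailKernel (K : ℝ) {σ : ℝ} (hσ : 0 < σ) :
    ∫⁻ x, tailKernel (d := d) K σ x = stdGaussian (Resp d) {x | K < ‖x‖} := by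
  have hms : MeasurableSet {x : Resp d | K < ‖x‖} := measurableSet_lt measurable_const measurable_norm
  have hcomp : Measurable fun x => tailKernel (d := d) K σ (σ • x) :=
    (measurable_tailKernel K σ).comp (measurable_const_smul σ)
  rw [lintegral_eq_smul hσ (measurable_tailKernel K σ), stdGaussian_eq_withDensity,
    withDensity_apply _ hms, ← lintegral_indicator hms, ← lintegral_const_mul _ hcomp]
  refine lintegral_congr fun x => ?_
  unfold tailKernel
  have hiff : σ • x ∈ {x : Resp d | K * σ < ‖x‖} ↔ x ∈ {x : Resp d | K < ‖x‖} := by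
    simp only [Set.mem_ofPred_eq, norm_smul, Real.norm_eq_abs, abs_of_pos hσ]
    rw [mul_comm K, mul_lt_mul_iff_right₀ hσ]
  by_cases h : x ∈ {x : Resp d | K < ‖x‖}
  · rw [Set.indicator_of_mem h, Set.indicator_of_mem (hiff.2 h),
      ← ENNReal.ofReal_mul (by positivity), ← pow_mul, mul_comm 2 d, pow_mul,
      Real.sqrt_mul (by positivity), Real.sqrt_sq (by positivity), norm_smul, Real.norm_eq_abs,
      abs_of_pos hσ]
    congr 1
    rw [mul_inv, show (σ * ‖x‖) ^ 2 / (2 * σ ^ 2) = 1 / 2 * ‖x‖ ^ 2 by field_simp, neg_mul]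
    field_simp
  · rw [Set.indicator_of_notMem h, Set.indicator_of_notMem (fun h' => h (hiff.1 h')), mul_zero]

lemma exists_stdGaussian_tail_le {ε : ℝ≥0∞} (hε : 0 < ε) :
    ∃ K : ℝ, 0 < K ∧ stdGaussian (Resp d) {x | K < ‖x‖} ≤ ε := by
  have hanti : Antitone fun n : ℕ => {x : Resp d | (n : ℝ) < ‖x‖} := fun a b hab x hx =>
    lt_of_le_of_lt (Nat.cast_le.2 hab : (a : ℝ) ≤ b) hx
  have h := tendsto_measure_iInter_atTop (μ := stdGaussian (Resp d))
    (fun n : ℕ => (measurableSet_lt measurable_const measurable_norm).nullMeasurableSet) hanti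
    ⟨0, measure_ne_top _ _⟩
  have hempty : ⋂ n : ℕ, {x : Resp d | (n : ℝ) < ‖x‖} = ∅ := by
    ext x
    simp only [Set.mem_iInter, Set.mem_ofPred_eq, Set.mem_empty_iff_false, iff_false, not_forall,
      not_lt]
    exact exists_nat_ge _
  rw [hempty, measure_empty] at h
  obtain ⟨n, hn, hn0⟩ := (((ENNReal.tendsto_nhds_zero.1 h) ε hε).and (eventually_gt_atTop 0)).exists
  exact ⟨n, by exact_mod_cast hn0, hn⟩

lemma ofReal_kde_le {M : ℕ} {σ : ℝ} (hσ : 0 < σ) (e : Fin M → Resp d) (y : Resp d)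
    {K : ℝ} (h : ∀ m, K * σ < ‖y - e m‖) :
    ENNReal.ofReal (kde σ e y) ≤ ∑ m, ENNReal.ofReal (1 / M) * tailKernel K σ (y - e m) := by
  unfold kde
  rw [ENNReal.ofReal_sum_of_nonneg fun m _ => by
    rw [gaussianDensity_smul_one _ hσ]; positivity]
  refine Finset.sum_le_sum fun m _ => ?_
  rw [ENNReal.ofReal_mul (by positivity), gaussianDensity_smul_one _ hσ, tailKernel,
    Set.indicator_of_mem (by exact h m)]

variable {Ω 𝒳 : Type*} [MeasurableSpace Ω] [MeasurableSpace 𝒳] {P : Measure Ω}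
  {PX : Measure 𝒳} [IsProbabilityMeasure PX] {μ : Resp d}
  {X : ℕ → Ω → 𝒳} {Y : ℕ → Ω → Resp d} {Yhat : ℕ → ℕ → Ω → Resp d}

lemma IsSample.lintegral_comp_Yhat_le (hS : S.PosDef)
    (h : IsSample P PX (multivariateGaussian μ S) X Y Yhat) (i m : ℕ) (y : Resp d)
    {g : Resp d → ℝ≥0∞} (hg : Measurable g) :
    ∫⁻ ω, g (y - Yhat i m ω) ∂P ≤ ENNReal.ofReal (gaussianDensity μ S μ) * ∫⁻ x, g x := by
  have h1 : ∫⁻ ω, g (y - Yhat i m ω) ∂P = ∫⁻ x, g (y - x) ∂(P.map (Yhat i m)) := by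
    have hg' : Measurable fun x => g (y - x) := hg.comp (measurable_const_sub y)
    rw [lintegral_map hg' (h.measurable_Yhat i m)]
  rw [h1, h.map_Yhat]
  refine (lintegral_gaussian_le hS μ _).trans ?_
  rw [lintegral_sub_left_eq_self g y]

/-- For bandwidths `o(M ^ (-1 / d))` the estimate tends to `0` in probability: with high probability
no draw lies within a few bandwidths of `y`, and the more distant draws contribute little in mean. -/
theorem IsSample.tendsto_measure_le_kde (hd : 0 < d) (hS : S.PosDef)
    (h : IsSample P PX (multivariateGaussian μ S) X Y Yhat) {σ : ℕ → ℝ} (hσ : ∀ M, 0 < σ M)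
    (ho : σ =o[atTop] (fun M : ℕ => (M : ℝ) ^ (-(1 / (d : ℝ))))) (i : ℕ) (y : Resp d)
    {t : ℝ} (ht : 0 < t) :
    Tendsto (fun M => P {ω | t ≤ kde (σ M) (ensemble Yhat M ω i) y}) atTop (𝓝 0) := by
  rw [ENNReal.tendsto_nhds_zero]
  intro η hη
  set F := ENNReal.ofReal (gaussianDensity μ S μ)
  have hF0 : F ≠ 0 := (ENNReal.ofReal_pos.2 (gaussianDensity_pos hS μ μ)).ne'
  have hFt : F ≠ ∞ := ENNReal.ofReal_ne_top
  have ht' : ENNReal.ofReal t ≠ 0 := (ENNReal.ofReal_pos.2 ht).ne'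
  have hη2 : 0 < η / 2 := ENNReal.half_pos hη.ne'
  obtain ⟨K, hK0, hK⟩ := exists_stdGaussian_tail_le (d := d)
    (ε := η / 2 * ENNReal.ofReal t / F)
    (ENNReal.div_pos (mul_ne_zero hη2.ne' ht') hFt)
  have hv : volume (Metric.ball (0 : Resp d) 1) ≠ ∞ := measure_ball_lt_top.ne
  have hlim : Tendsto (fun M : ℕ => F * (ENNReal.ofReal ((K *
      (σ M / (M : ℝ) ^ (-(1 / (d : ℝ))))) ^ d) * volume (Metric.ball (0 : Resp d) 1)))
      atTop (𝓝 0) := by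
    have h1 := (tendsto_nhdsWithin_iff.1 (tendsto_bandwidth_ratio hσ ho)).1
    have h2 := ENNReal.tendsto_ofReal ((h1.const_mul K).pow d)
    rw [mul_zero, zero_pow hd.ne', ENNReal.ofReal_zero] at h2
    have h3 := ENNReal.Tendsto.const_mul (ENNReal.Tendsto.mul_const h2 (Or.inr hv)) (Or.inr hFt)
    rwa [zero_mul, mul_zero] at h3
  filter_upwards [eventually_ge_atTop 1, (ENNReal.tendsto_nhds_zero.1 hlim) _ hη2] with M hM hnear
  have hM' : (0 : ℝ) < M := by exact_mod_cast hM
  set r := (M : ℝ) ^ (-(1 / (d : ℝ)))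
  have hMr : (M : ℝ) * r ^ d = 1 := natCast_mul_rpow_pow hd hM
  have hσM := hσ M
  have hgm : ∀ m : Fin M, Measurable fun ω => ENNReal.ofReal (1 / M) *
      tailKernel K (σ M) (y - Yhat i m ω) := fun m =>
    ((measurable_tailKernel _ _).comp ((h.measurable_Yhat i m).const_sub y)).const_mul _
  set D : Ω → ℝ≥0∞ := fun ω => ∑ m : Fin M, ENNReal.ofReal (1 / M) *
    tailKernel K (σ M) (y - Yhat i m ω) with hD
  have hDm : Measurable D := Finset.measurable_sum _ fun m _ => hgm m
  have hsub : {ω | t ≤ kde (σ M) (ensemble Yhat M ω i) y} ⊆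
      (⋃ m : Fin M, {ω | Yhat i m ω ∈ Metric.closedBall y (K * σ M)}) ∪
        {ω | ENNReal.ofReal t ≤ D ω} := by
    intro ω hω
    by_cases hc : ∀ m : Fin M, K * σ M < ‖y - Yhat i m ω‖
    · right
      exact (ENNReal.ofReal_le_ofReal hω).trans (ofReal_kde_le (hσ M) _ y hc)
    · left
      push Not at hc
      obtain ⟨m, hm⟩ := hc
      refine Set.mem_iUnion.2 ⟨m, ?_⟩
      rw [norm_sub_rev] at hm
      simpa [dist_eq_norm] using hm
  have hP1 : P (⋃ m : Fin M, {ω | Yhat i m ω ∈ Metric.closedBall y (K * σ M)}) ≤ η / 2 := by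
    refine le_trans ?_ hnear
    have hone : ∀ m : Fin M, P {ω | Yhat i m ω ∈ Metric.closedBall y (K * σ M)} ≤
        F * (ENNReal.ofReal ((K * σ M) ^ d) * volume (Metric.ball (0 : Resp d) 1)) := fun m => by
      have h1 : P {ω | Yhat i m ω ∈ Metric.closedBall y (K * σ M)} =
          multivariateGaussian μ S (Metric.closedBall y (K * σ M)) := by
        rw [← h.map_Yhat i m, Measure.map_apply (h.measurable_Yhat i m)
          Metric.isClosed_closedBall.measurableSet]
        rfl
      rw [h1]
      refine (gaussian_le_volume hS μ _).trans (le_of_eq ?_)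
      rw [Measure.addHaar_closedBall volume _ (by positivity), finrank_euclideanSpace,
        Fintype.card_fin]
    calc _ ≤ ∑ m : Fin M, P {ω | Yhat i m ω ∈ Metric.closedBall y (K * σ M)} :=
          measure_iUnion_fintype_le _ _
      _ ≤ ∑ _m : Fin M,
          F * (ENNReal.ofReal ((K * σ M) ^ d) * volume (Metric.ball (0 : Resp d) 1)) :=
          Finset.sum_le_sum fun m _ => hone m
      _ = F * (ENNReal.ofReal (M * (K * σ M) ^ d) * volume (Metric.ball (0 : Resp d) 1)) := by
          rw [Finset.sum_const, Finset.card_univ, Fintype.card_fin, nsmul_eq_mul,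
            ENNReal.ofReal_mul hM'.le, ENNReal.ofReal_natCast]
          ring
      _ = _ := by
          congr 3
          rw [div_eq_mul_inv, ← mul_assoc, mul_pow (K * σ M), inv_pow, mul_comm]
          congr 1
          exact eq_inv_of_mul_eq_one_left hMr
  have hP2 : P {ω | ENNReal.ofReal t ≤ D ω} ≤ η / 2 := by
    refine (meas_ge_le_lintegral_div hDm.aemeasurable ht' ENNReal.ofReal_ne_top).trans ?_
    refine ENNReal.div_le_of_le_mul ?_
    calc ∫⁻ ω, D ω ∂P = ∑ m : Fin M, ENNReal.ofReal (1 / M) *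
          ∫⁻ ω, tailKernel K (σ M) (y - Yhat i m ω) ∂P := by
          rw [hD, lintegral_finsetSum _ fun m _ => hgm m]
          refine Finset.sum_congr rfl fun m _ => ?_
          rw [lintegral_const_mul]
          exact (measurable_tailKernel _ _).comp ((h.measurable_Yhat i m).const_sub y)
      _ ≤ ∑ _m : Fin M, ENNReal.ofReal (1 / M) * (F * stdGaussian (Resp d) {x | K < ‖x‖}) := by
          refine Finset.sum_le_sum fun m _ => ?_
          gcongr
          refine (h.lintegral_comp_Yhat_le hS i m y (measurable_tailKernel _ _)).trans (le_of_eq ?_)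
          rw [lintegral_tailKernel K (hσ M)]
      _ = F * stdGaussian (Resp d) {x | K < ‖x‖} := by
          rw [Finset.sum_const, Finset.card_univ, Fintype.card_fin, nsmul_eq_mul, ← mul_assoc,
            ← ENNReal.ofReal_natCast, ← ENNReal.ofReal_mul hM'.le, mul_one_div_cancel hM'.ne',
            ENNReal.ofReal_one, one_mul]
      _ ≤ F * (η / 2 * ENNReal.ofReal t / F) := by gcongr
      _ = _ := ENNReal.mul_div_cancel hF0 hFt
  calc _ ≤ P ((⋃ m : Fin M, {ω | Yhat i m ω ∈ Metric.closedBall y (K * σ M)}) ∪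
        {ω | ENNReal.ofReal t ≤ D ω}) := measure_mono hsub
    _ ≤ _ := measure_union_le _ _
    _ ≤ η / 2 + η / 2 := add_le_add hP1 hP2
    _ = η := ENNReal.add_halves η

theorem IsSample.not_tendstoInMeasure_kde [IsProbabilityMeasure P] (hd : 0 < d) (hS : S.PosDef)
    (h : IsSample P PX (multivariateGaussian μ S) X Y Yhat) {σ : ℕ → ℝ} (hσ : ∀ M, 0 < σ M)
    (ho : σ =o[atTop] (fun M : ℕ => (M : ℝ) ^ (-(1 / (d : ℝ))))) (i : ℕ) (y : Resp d) :
    ¬ TendstoInMeasure P (fun M ω => kde (σ M) (ensemble Yhat M ω i) y) atTop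
      (fun _ => gaussianDensity μ S y) := by
  intro hc
  have hf := gaussianDensity_pos hS μ y
  set f := gaussianDensity μ S y
  have h1 := h.tendsto_measure_le_kde hd hS hσ ho i y (half_pos hf)
  have h2 := hc (ENNReal.ofReal (f / 2)) (ENNReal.ofReal_pos.2 (half_pos hf))
  have h3 := h1.add h2
  rw [add_zero] at h3
  obtain ⟨M, hM⟩ := (h3.eventually_lt_const (zero_lt_one (α := ℝ≥0∞))).exists
  refine absurd hM (not_lt.2 ?_)
  calc (1 : ℝ≥0∞) = P Set.univ := measure_univ.symm
    _ ≤ P ({ω | f / 2 ≤ kde (σ M) (ensemble Yhat M ω i) y} ∪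
        {ω | ENNReal.ofReal (f / 2) ≤ edist (kde (σ M) (ensemble Yhat M ω i) y) f}) := by
        refine measure_mono fun ω _ => ?_
        rcases le_or_gt (f / 2) (kde (σ M) (ensemble Yhat M ω i) y) with hle | hlt
        · exact Or.inl hle
        · right
          rw [Set.mem_ofPred_eq, edist_dist, Real.dist_eq]
          refine ENNReal.ofReal_le_ofReal ?_
          rw [abs_sub_comm]
          exact le_trans (by linarith) (le_abs_self _)
    _ ≤ _ := measure_union_le _ _

end Inconsistency

end ConformalGen

namespace ConformalGen

open scoped MatrixOrder

/-! ### The negative Gaussian log-density as a function of its parameters -/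

section GaussScore

variable {d : ℕ} {A S : Matrix (Fin d) (Fin d) ℝ}

/-- The negative log-density of the Gaussian with mean `m` and covariance `A`. -/
noncomputable def gaussScore (m : Resp d) (A : Matrix (Fin d) (Fin d) ℝ) (y : Resp d) : ℝ :=
  -Real.log (gaussianDensity m A y)

/-- A size parameter that controls a covariance matrix from both sides. -/
noncomputable def covSize (A : Matrix (Fin d) (Fin d) ℝ) : ℝ := 1 + A.trace + (A.det)⁻¹

lemma gaussScore_eq (hA : 0 < A.det) (m y : Resp d) :
    gaussScore m A y = 1 / 2 * Real.log ((2 * Real.pi) ^ d * A.det) +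
      1 / 2 * ((y - m).ofLp ⬝ᵥ A⁻¹.mulVec (y - m).ofLp) := by
  unfold gaussScore gaussianDensity
  rw [Real.log_mul (by positivity) (Real.exp_pos _).ne', Real.log_exp, Real.log_inv,
    Real.log_sqrt (by positivity)]
  ring

lemma sqrt_apply_comm (a b : Fin d) : CFC.sqrt A a b = CFC.sqrt A b a := by
  conv_lhs => rw [← sqrt_transpose (S := A)]
  rfl

lemma trace_eq_sum_sqrt_sq (hA : A.PosDef) : A.trace = ∑ a, ∑ b, CFC.sqrt A a b ^ 2 := by
  conv_lhs => rw [← sqrt_mul_sqrt hA]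
  rw [Matrix.trace]
  refine Finset.sum_congr rfl fun a _ => ?_
  rw [Matrix.diag_apply, Matrix.mul_apply]
  refine Finset.sum_congr rfl fun b _ => ?_
  rw [sqrt_apply_comm b a, sq]

/-- The entries of a positive definite matrix are bounded by its trace. -/
lemma abs_entry_le_trace (hA : A.PosDef) (i j : Fin d) : |A i j| ≤ A.trace := by
  have hB := sqrt_mul_sqrt hA
  have hsym := sqrt_apply_comm (A := A)
  have htr := trace_eq_sum_sqrt_sq hA
  set B := CFC.sqrt A
  have hrow : ∀ a, ∑ b, B a b ^ 2 ≤ A.trace := fun a => by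
    rw [htr]
    exact Finset.single_le_sum (f := fun a => ∑ b, B a b ^ 2)
      (fun _ _ => Finset.sum_nonneg fun _ _ => sq_nonneg _) (Finset.mem_univ a)
  have hij : A i j = ∑ k, B i k * B j k := by
    conv_lhs => rw [← hB]
    rw [Matrix.mul_apply]
    exact Finset.sum_congr rfl fun k _ => by rw [hsym k j]
  rw [hij]
  calc |∑ k, B i k * B j k| ≤ ∑ k, |B i k * B j k| := Finset.abs_sum_le_sum_abs _ _
    _ ≤ ∑ k, (B i k ^ 2 + B j k ^ 2) / 2 := by
        refine Finset.sum_le_sum fun k _ => ?_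
        rw [abs_mul]
        have := sq_nonneg (|B i k| - |B j k|)
        have h1 := sq_abs (B i k)
        have h2 := sq_abs (B j k)
        nlinarith
    _ = ((∑ k, B i k ^ 2) + ∑ k, B j k ^ 2) / 2 := by
        rw [← Finset.sum_div, Finset.sum_add_distrib]
    _ ≤ A.trace := by linarith [hrow i, hrow j]

lemma one_le_covSize (hA : A.PosDef) : 1 ≤ covSize A := by
  have h1 := hA.posSemidef.trace_nonneg
  have h2 := inv_pos.2 hA.det_pos
  unfold covSize
  linarith

lemma trace_le_covSize (hA : A.PosDef) : A.trace ≤ covSize A := by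
  have h2 := inv_pos.2 hA.det_pos
  unfold covSize
  linarith

lemma inv_det_le_covSize (hA : A.PosDef) : (A.det)⁻¹ ≤ covSize A := by
  have h1 := hA.posSemidef.trace_nonneg
  unfold covSize
  linarith

lemma det_le_covSize (hA : A.PosDef) : A.det ≤ (Nat.factorial d : ℝ) * covSize A ^ d := by
  have h := Matrix.det_le (A := A) (abv := IsAbsoluteValue.toAbsoluteValue (abs : ℝ → ℝ))
    (x := covSize A) (fun i j => (abs_entry_le_trace hA i j).trans (trace_le_covSize hA))
  simp only [Fintype.card_fin, nsmul_eq_mul] at h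
  exact (le_abs_self _).trans h

lemma abs_adjugate_le (hA : A.PosDef) (i j : Fin d) :
    |A.adjugate i j| ≤ (Nat.factorial d : ℝ) * covSize A ^ d := by
  rw [Matrix.adjugate_apply]
  have h := Matrix.det_le (A := A.updateRow j (Pi.single i 1))
    (abv := IsAbsoluteValue.toAbsoluteValue (abs : ℝ → ℝ))
    (x := covSize A) (fun a b => by
      change |A.updateRow j (Pi.single i 1) a b| ≤ _
      by_cases ha : a = j
      · subst ha
        rw [Matrix.updateRow_self]
        refine le_trans ?_ (one_le_covSize hA)
        by_cases hb : b = i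
        · subst hb; simp
        · simp [Pi.single_eq_of_ne hb]
      · rw [Matrix.updateRow_ne ha]
        exact (abs_entry_le_trace hA a b).trans (trace_le_covSize hA))
  simp only [Fintype.card_fin, nsmul_eq_mul] at h
  exact h

lemma quadForm_inv_le (hA : A.PosDef) (v : Resp d) :
    v.ofLp ⬝ᵥ A⁻¹.mulVec v.ofLp ≤
      (Nat.factorial d * d : ℝ) * covSize A ^ (d + 1) * ‖v‖ ^ 2 := by
  have hH := one_le_covSize hA
  have hinv : A⁻¹ = (A.det)⁻¹ • A.adjugate := by rw [Matrix.inv_def, Ring.inverse_eq_inv']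
  set H := covSize A
  set c : ℝ := (Nat.factorial d : ℝ) * H ^ d with hc
  have hadj : v.ofLp ⬝ᵥ A.adjugate.mulVec v.ofLp ≤ c * (d * ‖v‖ ^ 2) := by
    calc v.ofLp ⬝ᵥ A.adjugate.mulVec v.ofLp = ∑ i, ∑ j, v i * (A.adjugate i j * v j) := by
          simp only [dotProduct, Matrix.mulVec, Finset.mul_sum]
      _ ≤ ∑ i, ∑ j, c * ((v i ^ 2 + v j ^ 2) / 2) := by
          refine Finset.sum_le_sum fun i _ => Finset.sum_le_sum fun j _ => ?_
          refine (le_abs_self _).trans ?_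
          rw [abs_mul, abs_mul]
          calc |v i| * (|A.adjugate i j| * |v j|) = |A.adjugate i j| * (|v i| * |v j|) := by ring
            _ ≤ c * ((v i ^ 2 + v j ^ 2) / 2) := by
              refine mul_le_mul (abs_adjugate_le hA i j) ?_ (by positivity) (by positivity)
              have := sq_nonneg (|v i| - |v j|)
              have h1 := sq_abs (v i)
              have h2 := sq_abs (v j)
              nlinarith
      _ = c * (d * ‖v‖ ^ 2) := by
          rw [EuclideanSpace.real_norm_sq_eq]
          simp only [← Finset.mul_sum, ← Finset.sum_div, Finset.sum_add_distrib, Finset.sum_const,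
            Finset.card_univ, Fintype.card_fin, nsmul_eq_mul]
          ring
  rw [hinv, Matrix.smul_mulVec, dotProduct_smul, smul_eq_mul]
  have hdet := inv_pos.2 hA.det_pos
  calc (A.det)⁻¹ * (v.ofLp ⬝ᵥ A.adjugate.mulVec v.ofLp) ≤ (A.det)⁻¹ * (c * (d * ‖v‖ ^ 2)) := by
        gcongr
    _ ≤ H * (c * (d * ‖v‖ ^ 2)) := by
        gcongr
        exact inv_det_le_covSize hA
    _ = _ := by rw [hc]; ring

/-- The Mahalanobis form of a covariance matrix dominates the Euclidean one divided by the trace. -/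
lemma norm_sq_le_trace_mul_quadForm_inv (hA : A.PosDef) (v : Resp d) :
    ‖v‖ ^ 2 ≤ A.trace * (v.ofLp ⬝ᵥ A⁻¹.mulVec v.ofLp) := by
  have hq := quadForm_whitenInv hA 0
  obtain ⟨x, hx⟩ : ∃ x, whitenInv 0 A x = v := by
    refine ⟨WithLp.toLp 2 ((CFC.sqrt A)⁻¹.mulVec v.ofLp), ?_⟩
    have hu : IsUnit (CFC.sqrt A).det := isUnit_iff_ne_zero.2 (det_sqrt_ne_zero hA)
    ext i
    simp [whitenInv, Matrix.mul_nonsing_inv _ hu]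
  have h1 := hq x
  rw [hx, sub_zero] at h1
  rw [h1, ← hx]
  rw [trace_eq_sum_sqrt_sq hA, EuclideanSpace.real_norm_sq_eq, EuclideanSpace.real_norm_sq_eq, Finset.sum_mul]
  refine Finset.sum_le_sum fun a _ => ?_
  have : (whitenInv 0 A x) a = ∑ b, CFC.sqrt A a b * x b := by
    simp [whitenInv, Matrix.mulVec, dotProduct]
  rw [this]
  exact Finset.sum_mul_sq_le_sq_mul_sq _ _ _

/-- Upper bound for the score in terms of the size of the covariance matrix. -/
lemma gaussScore_le (hA : A.PosDef) (m y : Resp d) :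
    gaussScore m A y ≤ ((2 * Real.pi) ^ d * Nat.factorial d + Nat.factorial d * d) *
      covSize A ^ (d + 1) * (1 + ‖y - m‖ ^ 2) := by
  have hdet := hA.det_pos
  have hH := one_le_covSize hA
  rw [gaussScore_eq hdet]
  have h1 : Real.log ((2 * Real.pi) ^ d * A.det) ≤
      (2 * Real.pi) ^ d * Nat.factorial d * covSize A ^ (d + 1) := by
    calc _ ≤ (2 * Real.pi) ^ d * A.det := Real.log_le_self (by positivity)
      _ ≤ (2 * Real.pi) ^ d * (Nat.factorial d * covSize A ^ d) := by
          gcongr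
          exact det_le_covSize hA
      _ ≤ (2 * Real.pi) ^ d * (Nat.factorial d * covSize A ^ (d + 1)) := by
          gcongr
          · omega
      _ = _ := by ring
  have h2 := quadForm_inv_le hA (y - m)
  set H' := covSize A ^ (d + 1)
  have hn := sq_nonneg ‖y - m‖
  have e1 : 0 ≤ (2 * Real.pi) ^ d * Nat.factorial d * H' := by positivity
  have e2 : 0 ≤ (Nat.factorial d * d : ℝ) * H' := by positivity
  have e3 := mul_nonneg e1 hn
  have e4 := mul_nonneg e2 hn
  calc _ ≤ 1 / 2 * ((2 * Real.pi) ^ d * Nat.factorial d * H') +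
        1 / 2 * ((Nat.factorial d * d : ℝ) * H' * ‖y - m‖ ^ 2) := by gcongr
    _ ≤ _ := by nlinarith

/-- Lower bound for the score in terms of the size of the covariance matrix. -/
lemma norm_sq_le_of_gaussScore (hA : A.PosDef) (m y : Resp d) :
    ‖y - m‖ ^ 2 ≤ covSize A * (2 * gaussScore m A y + covSize A) := by
  have hdet := hA.det_pos
  have hH := one_le_covSize hA
  have hlog : -covSize A ≤ Real.log ((2 * Real.pi) ^ d * A.det) := by
    have h1 : (1 : ℝ) ≤ (2 * Real.pi) ^ d :=
      one_le_pow₀ (by linarith [Real.pi_gt_three])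
    have h2 : Real.log A.det ≤ Real.log ((2 * Real.pi) ^ d * A.det) :=
      Real.log_le_log hdet (le_mul_of_one_le_left hdet.le h1)
    have h3 := Real.one_sub_inv_le_log_of_pos hdet
    have h4 := inv_det_le_covSize hA
    linarith
  have hq := norm_sq_le_trace_mul_quadForm_inv hA (y - m)
  have hs := gaussScore_eq hdet m y
  set Q := (y - m).ofLp ⬝ᵥ A⁻¹.mulVec (y - m).ofLp
  have hQ0 : 0 ≤ Q := dotProduct_inv_nonneg hA _
  have hQ : Q ≤ 2 * gaussScore m A y + covSize A := by linarith
  calc ‖y - m‖ ^ 2 ≤ A.trace * Q := hq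
    _ ≤ covSize A * Q := by gcongr; exact trace_le_covSize hA
    _ ≤ _ := by gcongr

lemma continuousAt_gaussScore (hS : 0 < S.det) (μ y : Resp d) :
    ContinuousAt (fun p : (Resp d × Matrix (Fin d) (Fin d) ℝ) × Resp d =>
      gaussScore p.1.1 p.1.2 p.2) ((μ, S), y) := by
  have hdet : ContinuousAt (fun p : (Resp d × Matrix (Fin d) (Fin d) ℝ) × Resp d => p.1.2.det)
      ((μ, S), y) := (Continuous.matrix_det (by fun_prop)).continuousAt
  have hadj : Continuous (fun p : (Resp d × Matrix (Fin d) (Fin d) ℝ) × Resp d =>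
      (p.2 - p.1.1).ofLp ⬝ᵥ p.1.2.adjugate.mulVec (p.2 - p.1.1).ofLp) := by
    have h1 : Continuous fun p : (Resp d × Matrix (Fin d) (Fin d) ℝ) × Resp d => p.1.2.adjugate :=
      Continuous.matrix_adjugate (by fun_prop)
    have h2 : Continuous fun p : (Resp d × Matrix (Fin d) (Fin d) ℝ) × Resp d =>
      (p.2 - p.1.1).ofLp := by fun_prop
    exact Continuous.dotProduct h2 (Continuous.matrix_mulVec h1 h2)
  have hg : ContinuousAt (fun p : (Resp d × Matrix (Fin d) (Fin d) ℝ) × Resp d =>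
      1 / 2 * Real.log ((2 * Real.pi) ^ d * p.1.2.det) + 1 / 2 * ((p.1.2.det)⁻¹ *
        ((p.2 - p.1.1).ofLp ⬝ᵥ p.1.2.adjugate.mulVec (p.2 - p.1.1).ofLp))) ((μ, S), y) := by
    refine ContinuousAt.add ?_ ?_
    · exact continuousAt_const.mul ((continuousAt_const.mul hdet).log (mul_ne_zero (by positivity) hS.ne'))
    · exact continuousAt_const.mul ((hdet.inv₀ hS.ne').mul hadj.continuousAt)
  refine hg.congr ?_
  filter_upwards [hdet.eventually (eventually_gt_nhds hS)] with p hp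
  rw [gaussScore_eq hp, Matrix.inv_def, Ring.inverse_eq_inv', Matrix.smul_mulVec, dotProduct_smul,
    smul_eq_mul]

lemma continuousAt_covSize (hS : 0 < S.det) :
    ContinuousAt (fun p : Resp d × Matrix (Fin d) (Fin d) ℝ => covSize p.2) (μ, S) := by
  unfold covSize
  refine ContinuousAt.add (continuousAt_const.add (Continuous.continuousAt ?_))
    (ContinuousAt.inv₀ (Continuous.continuousAt ?_) hS.ne')
  · exact Continuous.matrix_trace continuous_snd
  · exact Continuous.matrix_det continuous_snd

/-- Sublevel sets of the score depend continuously on the parameters, in the sense that they are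
eventually sandwiched between sublevel sets at neighbouring levels. -/
lemma eventually_gaussScore_sandwich (hS : S.PosDef) (μ : Resp d) (q : ℝ) {η : ℝ} (hη : 0 < η) :
    ∀ᶠ p : Resp d × Matrix (Fin d) (Fin d) ℝ in 𝓝 (μ, S), p.2.PosDef →
      (∀ y, gaussScore p.1 p.2 y ≤ q + η → gaussScore μ S y ≤ q + 2 * η) ∧
      (∀ y, gaussScore μ S y ≤ q - 2 * η → gaussScore p.1 p.2 y ≤ q - η) := by
  set H := covSize S + 1
  have hHev : ∀ᶠ p : Resp d × Matrix (Fin d) (Fin d) ℝ in 𝓝 (μ, S), covSize p.2 ≤ H :=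
    (continuousAt_covSize (μ := μ) hS.det_pos).eventually_le_const (lt_add_one _)
  have hmev : ∀ᶠ p : Resp d × Matrix (Fin d) (Fin d) ℝ in 𝓝 (μ, S), dist p.1 μ ≤ 1 := by
    have h1 : ContinuousAt (fun p : Resp d × Matrix (Fin d) (Fin d) ℝ => dist p.1 μ) (μ, S) := by
      fun_prop
    exact h1.eventually_le_const (by simp)
  -- all the sublevel sets in question lie in one compact ball
  set R := Real.sqrt (H * (2 * (|q| + η) + H)) + 1 with hR
  have hunif : ∀ᶠ p : Resp d × Matrix (Fin d) (Fin d) ℝ in 𝓝 (μ, S),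
      ∀ y ∈ Metric.closedBall μ R, |gaussScore p.1 p.2 y - gaussScore μ S y| < η := by
    refine (isCompact_closedBall μ R).eventually_forall_of_forall_eventually fun y _ => ?_
    have h1 := continuousAt_gaussScore hS.det_pos μ y
    have h2 : ContinuousAt (fun p : (Resp d × Matrix (Fin d) (Fin d) ℝ) × Resp d =>
        gaussScore μ S p.2) ((μ, S), y) := by
      have h3 : ContinuousAt (fun p : (Resp d × Matrix (Fin d) (Fin d) ℝ) × Resp d =>
        (((μ, S), p.2) : (Resp d × Matrix (Fin d) (Fin d) ℝ) × Resp d)) ((μ, S), y) := by fun_prop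
      exact ContinuousAt.comp (f := fun p : (Resp d × Matrix (Fin d) (Fin d) ℝ) × Resp d =>
        (((μ, S), p.2) : (Resp d × Matrix (Fin d) (Fin d) ℝ) × Resp d)) h1 h3
    have h4 := (h1.sub h2).abs
    refine h4.eventually_lt_const ?_
    simpa using hη
  have hball : ∀ p : Resp d × Matrix (Fin d) (Fin d) ℝ, p.2.PosDef → covSize p.2 ≤ H →
      dist p.1 μ ≤ 1 → ∀ y, gaussScore p.1 p.2 y ≤ |q| + η → y ∈ Metric.closedBall μ R := by
    intro p hp hpH hpm y hy
    have h1 := norm_sq_le_of_gaussScore hp p.1 y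
    have h0 := one_le_covSize hp
    have h2 : ‖y - p.1‖ ^ 2 ≤ H * (2 * (|q| + η) + H) := by
      have hH0 : 0 ≤ H := by linarith
      calc _ ≤ covSize p.2 * (2 * gaussScore p.1 p.2 y + covSize p.2) := h1
        _ ≤ covSize p.2 * (2 * (|q| + η) + H) := by gcongr
        _ ≤ _ := by gcongr
    have h3 := Real.le_sqrt_of_sq_le h2
    rw [Metric.mem_closedBall]
    calc dist y μ ≤ dist y p.1 + dist p.1 μ := dist_triangle _ _ _
      _ ≤ R := by rw [hR, dist_eq_norm y]; linarith
  have hq := le_abs_self q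
  filter_upwards [hHev, hmev, hunif] with p h1 h2 h3 hp
  refine ⟨fun y hy => ?_, fun y hy => ?_⟩
  · have := (abs_lt.1 (h3 y (hball p hp h1 h2 y (by linarith)))).1
    linarith
  · have := (abs_lt.1 (h3 y (hball (μ, S) hS (by simp [H]) (by simp) y (by
      change gaussScore μ S y ≤ _
      linarith)))).2
    linarith

end GaussScore

end ConformalGen

namespace ConformalGen

/-! ### The plug-in Gaussian fit of an ensemble and its consistency -/

section Fit

variable {d M : ℕ}

/-- The mean of an ensemble. -/
noncomputable def ensMean (e : Fin M → Resp d) : Resp d := (M : ℝ)⁻¹ • ∑ m, e m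

/-- The covariance of an ensemble (normalized by `1 / M`) plus the nugget `β ^ 2`. -/
noncomputable def ensCov (β : ℝ) (e : Fin M → Resp d) : Matrix (Fin d) (Fin d) ℝ :=
  Matrix.of (fun a b => (M : ℝ)⁻¹ * ∑ m, (e m a - ensMean e a) * (e m b - ensMean e b)) +
    β ^ 2 • (1 : Matrix (Fin d) (Fin d) ℝ)

/-- With one cluster the CP4Gen score is the negative log-density of the plug-in Gaussian fit. -/
lemma cp4genScore_eq_gaussScore (hM : 1 ≤ M) (β : ℝ) (e : Fin M → Resp d) (y : Resp d) :
    cp4genScore (fun _ : Fin M => (0 : Fin 1)) β e y =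
      gaussScore (ensMean e) (ensCov β e) y := by
  have hM' : (M : ℝ) ≠ 0 := by exact_mod_cast (by lia : M ≠ 0)
  have hmean : clusterMean (fun _ : Fin M => (0 : Fin 1)) e 0 = ensMean e := by
    simp [clusterMean, ensMean, clusterSize]
  have hcov : clusterCov (fun _ : Fin M => (0 : Fin 1)) e 0 + β ^ 2 • (1 : Matrix _ _ ℝ) =
      ensCov β e := by
    simp [clusterCov, ensCov, hmean, clusterSize]
  unfold cp4genScore gaussScore
  rw [ciSup_unique]
  change -Real.log ((clusterSize (fun _ : Fin M => (0 : Fin 1)) 0 : ℝ) / M * gaussianDensity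
    (clusterMean (fun _ : Fin M => (0 : Fin 1)) e 0)
    (clusterCov (fun _ : Fin M => (0 : Fin 1)) e 0 + β ^ 2 • (1 : Matrix _ _ ℝ)) y) = _
  rw [hmean, hcov]
  simp [clusterSize, hM']

lemma continuous_ensMean : Continuous (ensMean : (Fin M → Resp d) → Resp d) := by
  unfold ensMean
  fun_prop

lemma continuous_ensCov (β : ℝ) :
    Continuous (ensCov β : (Fin M → Resp d) → Matrix (Fin d) (Fin d) ℝ) := by
  unfold ensCov
  refine Continuous.add (continuous_matrix fun a b => ?_) continuous_const
  simp only [Matrix.of_apply]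
  fun_prop

lemma measurable_gaussScore {E : Type*} [TopologicalSpace E] [MeasurableSpace E]
    [OpensMeasurableSpace E] {m y : E → Resp d} {A : E → Matrix (Fin d) (Fin d) ℝ}
    (hm : Continuous m) (hA : Continuous A) (hy : Continuous y) :
    Measurable fun x => gaussScore (m x) (A x) (y x) := by
  unfold gaussScore gaussianDensity
  have hdet : Continuous fun x => (A x).det := hA.matrix_det
  have hadj : Continuous fun x =>
      (y x - m x).ofLp ⬝ᵥ (A x).adjugate.mulVec (y x - m x).ofLp := by
    have h1 : Continuous fun x => (y x - m x).ofLp := by fun_prop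
    exact h1.dotProduct (hA.matrix_adjugate.matrix_mulVec h1)
  have hq : ∀ x, (y x - m x).ofLp ⬝ᵥ (A x)⁻¹.mulVec (y x - m x).ofLp =
      (A x).det⁻¹ * ((y x - m x).ofLp ⬝ᵥ (A x).adjugate.mulVec (y x - m x).ofLp) := fun x => by
    rw [Matrix.inv_def, Ring.inverse_eq_inv', Matrix.smul_mulVec, dotProduct_smul, smul_eq_mul]
  simp_rw [hq]
  have := hdet.measurable
  have := hadj.measurable
  fun_prop

lemma ensCov_apply (hM : 1 ≤ M) (β : ℝ) (e : Fin M → Resp d) (a b : Fin d) :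
    ensCov β e a b = (M : ℝ)⁻¹ * ∑ m, e m a * e m b - ensMean e a * ensMean e b +
      β ^ 2 * (1 : Matrix (Fin d) (Fin d) ℝ) a b := by
  have hM' : (M : ℝ) ≠ 0 := by exact_mod_cast (by lia : M ≠ 0)
  have hs : ∀ a, ∑ m, e m a = M * ensMean e a := fun a => by
    simp [ensMean, hM']
  simp only [ensCov, Matrix.add_apply, Matrix.of_apply, Matrix.smul_apply, smul_eq_mul]
  congr 1
  simp only [sub_mul, mul_sub, Finset.sum_sub_distrib, ← Finset.mul_sum, ← Finset.sum_mul, hs,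
    Finset.sum_const, Finset.card_univ, Fintype.card_fin, nsmul_eq_mul]
  field_simp
  ring

lemma dotProduct_ensCov (β : ℝ) (e : Fin M → Resp d) (v : Resp d) :
    v.ofLp ⬝ᵥ (ensCov β e).mulVec v.ofLp =
      (M : ℝ)⁻¹ * ∑ m, (inner ℝ v (e m) - inner ℝ v (ensMean e)) ^ 2 + β ^ 2 * ‖v‖ ^ 2 := by
  have hin : ∀ m, inner ℝ v (e m) - inner ℝ v (ensMean e) =
      ∑ a, (e m a - ensMean e a) * v a := fun m => by
    rw [← inner_sub_right, PiLp.inner_apply]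
    simp
  unfold ensCov
  rw [Matrix.add_mulVec, dotProduct_add, Matrix.smul_mulVec, Matrix.one_mulVec, dotProduct_smul,
    smul_eq_mul, EuclideanSpace.real_norm_sq_eq]
  congr 1
  · simp only [hin, dotProduct, Matrix.mulVec, Matrix.of_apply, sq, Finset.sum_mul, Finset.mul_sum]
    calc ∑ a, ∑ b, ∑ m, v a * ((M : ℝ)⁻¹ * ((e m a - ensMean e a) * (e m b - ensMean e b)) * v b)
        = ∑ a, ∑ m, ∑ b, v a *
          ((M : ℝ)⁻¹ * ((e m a - ensMean e a) * (e m b - ensMean e b)) * v b) :=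
          Finset.sum_congr rfl fun a _ => Finset.sum_comm
      _ = ∑ m, ∑ a, ∑ b, v a *
          ((M : ℝ)⁻¹ * ((e m a - ensMean e a) * (e m b - ensMean e b)) * v b) := Finset.sum_comm
      _ = _ := Finset.sum_congr rfl fun m _ => by
          rw [Finset.sum_comm]
          exact Finset.sum_congr rfl fun a _ => Finset.sum_congr rfl fun b _ => by ring
  · simp only [dotProduct, sq]

lemma posSemidef_ensCov (β : ℝ) (e : Fin M → Resp d) : (ensCov β e).PosSemidef := by
  refine Matrix.PosSemidef.of_dotProduct_mulVec_nonneg ?_ fun x => ?_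
  · ext a b
    simp [ensCov, Matrix.one_apply, mul_comm, eq_comm]
  · have h := dotProduct_ensCov β e (WithLp.toLp 2 x)
    simp only [star_trivial]
    rw [h]
    positivity

end Fit

section Consistency

variable {Ω 𝒳 : Type*} [MeasurableSpace Ω] [MeasurableSpace 𝒳] {P : Measure Ω}
  [IsProbabilityMeasure P] {PX : Measure 𝒳} [IsProbabilityMeasure PX] {d : ℕ} {μ : Resp d}
  {S : Matrix (Fin d) (Fin d) ℝ}
  {X : ℕ → Ω → 𝒳} {Y : ℕ → Ω → Resp d} {Yhat : ℕ → ℕ → Ω → Resp d}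

lemma integral_eval_multivariateGaussian (a : Fin d) :
    ∫ x, x a ∂(multivariateGaussian μ S) = μ a := by
  have h : Integrable id (multivariateGaussian μ S) :=
    (IsGaussian.memLp_id _ 1 (by simp)).integrable le_rfl
  have h2 := (EuclideanSpace.proj a : Resp d →L[ℝ] ℝ).integral_comp_comm h
  simp only [id, integral_id_multivariateGaussian] at h2
  exact h2

lemma memLp_eval_multivariateGaussian (a : Fin d) :
    MemLp (fun x : Resp d => x a) 2 (multivariateGaussian μ S) :=
  (EuclideanSpace.proj a : Resp d →L[ℝ] ℝ).comp_memLp' (IsGaussian.memLp_id _ 2 (by simp))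

lemma integral_eval_mul_eval_multivariateGaussian (hS : S.PosSemidef) (a b : Fin d) :
    ∫ x, x a * x b ∂(multivariateGaussian μ S) = S a b + μ a * μ b := by
  have h := covariance_eval_multivariateGaussian (μ := μ) hS a b
  rw [covariance_eq_sub (memLp_eval_multivariateGaussian a) (memLp_eval_multivariateGaussian b),
    integral_eval_multivariateGaussian, integral_eval_multivariateGaussian] at h
  simp only [Pi.mul_apply] at h
  linarith

/-- The strong law of large numbers for a function of the draws at one data point. -/
lemma IsSample.ae_tendsto_average (h : IsSample P PX (multivariateGaussian μ S) X Y Yhat) (i : ℕ)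
    {g : Resp d → ℝ} (hgm : Measurable g) (hg : Integrable g (multivariateGaussian μ S)) :
    ∀ᵐ ω ∂P, Tendsto (fun M : ℕ => (M : ℝ)⁻¹ * ∑ m : Fin M, g (ensemble Yhat M ω i m)) atTop
      (𝓝 (∫ x, g x ∂(multivariateGaussian μ S))) := by
  have hid : ∀ m, IdentDistrib (Yhat i m) (Yhat i 0) P P := fun m =>
    ⟨(h.measurable_Yhat i m).aemeasurable, (h.measurable_Yhat i 0).aemeasurable, by
      rw [h.map_Yhat, h.map_Yhat]⟩
  have hint : Integrable (g ∘ Yhat i 0) P := by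
    rw [← integrable_map_measure hgm.aestronglyMeasurable (h.measurable_Yhat i 0).aemeasurable,
      h.map_Yhat]
    exact hg
  have hE : ∫ ω, (g ∘ Yhat i 0) ω ∂P = ∫ x, g x ∂(multivariateGaussian μ S) := by
    rw [← h.map_Yhat i 0, integral_map (h.measurable_Yhat i 0).aemeasurable
      hgm.aestronglyMeasurable]
    rfl
  have hlln := strong_law_ae_real (fun m => g ∘ Yhat i m) hint
    (fun a b hab => ((h.iIndepFun_Yhat i).indepFun hab).comp hgm hgm) fun m => (hid m).comp hgm
  rw [hE] at hlln
  filter_upwards [hlln] with ω hω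
  refine hω.congr fun M => ?_
  rw [div_eq_inv_mul, ← Fin.sum_univ_eq_sum_range (fun m => (g ∘ Yhat i m) ω) M]
  rfl

/-- The plug-in fit is strongly consistent. -/
lemma IsSample.ae_tendsto_fit (hS : S.PosDef)
    (h : IsSample P PX (multivariateGaussian μ S) X Y Yhat) (i : ℕ) {β : ℕ → ℝ}
    (hβ : Tendsto β atTop (𝓝 0)) :
    ∀ᵐ ω ∂P, Tendsto (fun M : ℕ => (ensMean (ensemble Yhat M ω i),
      ensCov (β M) (ensemble Yhat M ω i))) atTop (𝓝 (μ, S)) := by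
  have h1 : ∀ a : Fin d, ∀ᵐ ω ∂P, Tendsto (fun M : ℕ => (M : ℝ)⁻¹ * ∑ m : Fin M,
      ensemble Yhat M ω i m a) atTop (𝓝 (μ a)) := fun a => by
    have := h.ae_tendsto_average i (g := fun x => x a) (by fun_prop)
      ((memLp_eval_multivariateGaussian a).integrable (by norm_num))
    rwa [integral_eval_multivariateGaussian] at this
  have h2 : ∀ a b : Fin d, ∀ᵐ ω ∂P, Tendsto (fun M : ℕ => (M : ℝ)⁻¹ * ∑ m : Fin M,
      ensemble Yhat M ω i m a * ensemble Yhat M ω i m b) atTop (𝓝 (S a b + μ a * μ b)) :=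
    fun a b => by
    have := h.ae_tendsto_average i (g := fun x => x a * x b) (by fun_prop)
      ((memLp_eval_multivariateGaussian a).integrable_mul (memLp_eval_multivariateGaussian b))
    rwa [integral_eval_mul_eval_multivariateGaussian hS.posSemidef] at this
  filter_upwards [ae_all_iff.2 h1, ae_all_iff.2 fun a => ae_all_iff.2 (h2 a)] with ω hω1 hω2
  have hmean : ∀ a, Tendsto (fun M : ℕ => ensMean (ensemble Yhat M ω i) a) atTop (𝓝 (μ a)) :=
    fun a => by
    refine (hω1 a).congr fun M => ?_
    simp [ensMean]
  refine Tendsto.prodMk_nhds ?_ ?_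
  · rw [(PiLp.homeomorph 2 (fun _ : Fin d => ℝ)).isInducing.tendsto_nhds_iff]
    exact tendsto_pi_nhds.2 hmean
  · refine tendsto_pi_nhds.2 fun a => tendsto_pi_nhds.2 fun b => ?_
    have h3 := ((hω2 a b).sub ((hmean a).mul (hmean b))).add
      ((hβ.pow 2).mul_const ((1 : Matrix (Fin d) (Fin d) ℝ) a b))
    have h4 : S a b + μ a * μ b - μ a * μ b + 0 ^ 2 * (1 : Matrix (Fin d) (Fin d) ℝ) a b =
      S a b := by ring
    rw [h4] at h3
    refine h3.congr' ?_
    filter_upwards [eventually_ge_atTop 1] with M hM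
    rw [ensCov_apply hM]

end Consistency

end ConformalGen

namespace ConformalGen

open scoped MatrixOrder

/-! ### Gaussian integrals and the determinant -/

section QuadIntegral

variable {d : ℕ} {A : Matrix (Fin d) (Fin d) ℝ}

/-- The Gaussian integral `∫ exp (- vᵀ A v / 2) dv`, a constant multiple of `(det A) ^ (-1/2)` for
positive definite `A`, and infinite for singular positive semidefinite `A`. -/
noncomputable def quadIntegral (A : Matrix (Fin d) (Fin d) ℝ) : ℝ≥0∞ :=
  ∫⁻ v : Resp d, ENNReal.ofReal (Real.exp (-(1 / 2) * (v.ofLp ⬝ᵥ A.mulVec v.ofLp)))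

lemma measurable_exp_quadForm (A : Matrix (Fin d) (Fin d) ℝ) (c : ℝ) :
    Measurable fun v : Resp d =>
      ENNReal.ofReal (Real.exp (c * (v.ofLp ⬝ᵥ A.mulVec v.ofLp))) := by
  have h : Continuous fun v : Resp d => v.ofLp ⬝ᵥ A.mulVec v.ofLp :=
    Continuous.dotProduct (by fun_prop) (Continuous.matrix_mulVec continuous_const (by fun_prop))
  have := h.measurable
  fun_prop

/-- The total mass of the Gaussian with covariance `A⁻¹` is one. -/
lemma inv_det_le_quadIntegral (hA : A.PosDef) :
    ENNReal.ofReal (A.det)⁻¹ ≤ quadIntegral A ^ 2 := by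
  have hdet := hA.det_pos
  have hI : (multivariateGaussian (0 : Resp d) A⁻¹) Set.univ = 1 := measure_univ
  rw [multivariateGaussian_eq_withDensity hA.inv, withDensity_apply _ MeasurableSet.univ,
    Measure.restrict_univ] at hI
  have hinv : (A⁻¹)⁻¹ = A := Matrix.nonsing_inv_nonsing_inv _ (isUnit_iff_ne_zero.2 hdet.ne')
  have hdinv : (A⁻¹).det = (A.det)⁻¹ := by
    rw [Matrix.det_nonsing_inv, Ring.inverse_eq_inv']
  set c : ℝ := (Real.sqrt ((2 * Real.pi) ^ d * (A.det)⁻¹))⁻¹ with hc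
  have hc0 : 0 < c := by positivity
  have h1 : ENNReal.ofReal c * quadIntegral A = 1 := by
    unfold quadIntegral
    rw [← hI, ← lintegral_const_mul _ (measurable_exp_quadForm A _)]
    refine lintegral_congr fun v => ?_
    rw [← ENNReal.ofReal_mul hc0.le, gaussianDensity, hinv, hdinv, sub_zero]
  have h2 : quadIntegral A = ENNReal.ofReal c⁻¹ := by
    rw [ENNReal.ofReal_inv_of_pos hc0]
    exact ENNReal.eq_inv_of_mul_eq_one_left (by rwa [mul_comm])
  rw [h2, ← ENNReal.ofReal_pow (by positivity), hc, inv_inv, Real.sq_sqrt (by positivity)]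
  refine ENNReal.ofReal_le_ofReal (le_mul_of_one_le_left (by positivity) ?_)
  exact one_le_pow₀ (by linarith [Real.pi_gt_three])

lemma inv_det_add_smul_one_le_quadIntegral (hA : A.PosSemidef) {t : ℝ} (ht : 0 < t) :
    ENNReal.ofReal ((A + t • (1 : Matrix (Fin d) (Fin d) ℝ)).det)⁻¹ ≤ quadIntegral A ^ 2 := by
  have hB : (A + t • (1 : Matrix (Fin d) (Fin d) ℝ)).PosDef :=
    Matrix.PosDef.posSemidef_add hA (Matrix.PosDef.one.smul ht)
  refine (inv_det_le_quadIntegral hB).trans ?_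
  gcongr
  refine lintegral_mono fun v => ENNReal.ofReal_le_ofReal (Real.exp_le_exp.2 ?_)
  rw [Matrix.add_mulVec, dotProduct_add, Matrix.smul_mulVec, Matrix.one_mulVec, dotProduct_smul]
  have h : 0 ≤ v.ofLp ⬝ᵥ v.ofLp := Finset.sum_nonneg fun i _ => mul_self_nonneg _
  have : 0 ≤ t • (v.ofLp ⬝ᵥ v.ofLp) := by positivity
  linarith

/-- A positive semidefinite matrix with a finite Gaussian integral is positive definite. -/
lemma posDef_of_quadIntegral_ne_top (hA : A.PosSemidef) (h : quadIntegral A ≠ ∞) :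
    A.PosDef := by
  rw [hA.posDef_iff_det_ne_zero]
  intro hdet
  have hcont : Continuous fun t : ℝ => (A + t • (1 : Matrix (Fin d) (Fin d) ℝ)).det :=
    Continuous.matrix_det (by fun_prop)
  have hlim : Tendsto (fun t : ℝ => (A + t • (1 : Matrix (Fin d) (Fin d) ℝ)).det) (𝓝[>] 0)
      (𝓝[>] 0) := by
    refine tendsto_nhdsWithin_iff.2 ⟨?_, ?_⟩
    · have := (hcont.tendsto 0).mono_left (nhdsWithin_le_nhds (s := Set.Ioi 0))
      simpa [hdet] using this
    · filter_upwards [self_mem_nhdsWithin] with t ht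
      exact (Matrix.PosDef.posSemidef_add hA (Matrix.PosDef.one.smul ht)).det_pos
  have hinf := ENNReal.tendsto_ofReal_atTop.comp (tendsto_inv_nhdsGT_zero.comp hlim)
  have hle : ∞ ≤ quadIntegral A ^ 2 := by
    refine le_of_tendsto hinf ?_
    filter_upwards [self_mem_nhdsWithin] with t ht
    exact inv_det_add_smul_one_le_quadIntegral hA ht
  exact ENNReal.pow_ne_top h (top_le_iff.1 hle)

/-- Hölder's inequality against a weight of finite integral. -/
lemma lintegral_pow_le_weighted {E : Type*} [MeasurableSpace E] (ν : Measure E) {k : ℕ}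
    (hk : 2 ≤ k) {f w : E → ℝ≥0∞} (hf : Measurable f) (hw : Measurable w) (hw0 : ∀ x, w x ≠ 0)
    (hwt : ∀ x, w x ≠ ∞) :
    (∫⁻ x, f x ∂ν) ^ k ≤
      (∫⁻ x, f x ^ k * (w x)⁻¹ ^ (k - 1) ∂ν) * (∫⁻ x, w x ∂ν) ^ (k - 1) := by
  have hk1 : (1 : ℝ) < k := by exact_mod_cast hk
  have hpq : (k : ℝ).HolderConjugate (k / (k - 1)) :=
    Real.HolderConjugate.conjExponent hk1
  have hg : Measurable fun x => f x * (w x)⁻¹ := hf.mul hw.inv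
  have h := ENNReal.lintegral_mul_le_Lp_mul_Lq (ν.withDensity w) hpq hg.aemeasurable
    (g := fun _ => 1) aemeasurable_const
  simp only [Pi.mul_def, mul_one, ENNReal.rpow_natCast, ENNReal.one_rpow, lintegral_const,
    one_mul, withDensity_apply _ MeasurableSet.univ, Measure.restrict_univ] at h
  rw [lintegral_withDensity_eq_lintegral_mul _ hw hg,
    lintegral_withDensity_eq_lintegral_mul _ hw (hg.pow_const k)] at h
  have h1 : ∀ x, (w * fun x => f x * (w x)⁻¹) x = f x := fun x => by
    simp only [Pi.mul_apply]
    rw [mul_comm, mul_assoc, ENNReal.inv_mul_cancel (hw0 x) (hwt x), mul_one]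
  have h2 : ∀ x, (w * fun x => (f x * (w x)⁻¹) ^ k) x = f x ^ k * (w x)⁻¹ ^ (k - 1) := fun x => by
    simp only [Pi.mul_apply]
    obtain ⟨j, rfl⟩ : ∃ j, k = j + 1 := ⟨k - 1, by lia⟩
    rw [mul_pow, pow_succ (w x)⁻¹, Nat.add_sub_cancel]
    rw [show w x * (f x ^ (j + 1) * ((w x)⁻¹ ^ j * (w x)⁻¹)) =
      f x ^ (j + 1) * (w x)⁻¹ ^ j * ((w x)⁻¹ * w x) by ring,
      ENNReal.inv_mul_cancel (hw0 x) (hwt x), mul_one]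
  simp only [h1, h2] at h
  calc _ ≤ ((∫⁻ x, f x ^ k * (w x)⁻¹ ^ (k - 1) ∂ν) ^ (1 / (k : ℝ)) *
        (∫⁻ x, w x ∂ν) ^ (1 / ((k : ℝ) / (k - 1)))) ^ k := by gcongr
    _ = _ := by
      have hk0 : (k : ℝ) ≠ 0 := by positivity
      rw [mul_pow, ← ENNReal.rpow_natCast, ← ENNReal.rpow_mul, ← ENNReal.rpow_natCast (_ ^ _) k,
        ← ENNReal.rpow_mul, one_div_mul_cancel hk0, ENNReal.rpow_one, one_div_div,
        div_mul_cancel₀ _ hk0, ← ENNReal.rpow_natCast, Nat.cast_sub (by lia), Nat.cast_one]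

end QuadIntegral

/-! ### Laplace transform of the empirical quadratic form -/

section Laplace

lemma lintegral_exp_neg_mul_sq_gaussianReal (w : NNReal) {s : ℝ} (hs : 0 ≤ s) :
    ∫⁻ x, ENNReal.ofReal (Real.exp (-s * x ^ 2)) ∂(gaussianReal 0 w) =
      ENNReal.ofReal (Real.sqrt (1 + 2 * s * w))⁻¹ := by
  by_cases hw : w = 0
  · simp [hw]
  rw [gaussianReal_of_var_ne_zero 0 hw,
    lintegral_withDensity_eq_lintegral_mul _ (by fun_prop) (by fun_prop)]
  have hb : 0 < s + 1 / (2 * w) := by positivity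
  have h1 : ∀ x : ℝ, (gaussianPDF 0 w * fun x => ENNReal.ofReal (Real.exp (-s * x ^ 2))) x =
      ENNReal.ofReal ((Real.sqrt (2 * Real.pi * w))⁻¹ *
        Real.exp (-(s + 1 / (2 * w)) * x ^ 2)) := fun x => by
    rw [Pi.mul_apply, gaussianPDF, ← ENNReal.ofReal_mul (gaussianPDFReal_nonneg _ _ _),
      gaussianPDFReal, mul_assoc, ← Real.exp_add]
    congr 3
    field_simp
    ring
  simp_rw [h1]
  rw [← ofReal_integral_eq_lintegral_ofReal ((integrable_exp_neg_mul_sq hb).const_mul _)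
    (Eventually.of_forall fun x => by positivity), integral_const_mul, integral_gaussian,
    ← Real.sqrt_inv, ← Real.sqrt_inv, ← Real.sqrt_mul (by positivity)]
  congr 2
  field_simp
  ring

variable {Ω : Type*} [MeasurableSpace Ω] {P : Measure Ω} [IsProbabilityMeasure P]

/-- Disjoint pairs from an independent sequence: the mean of a product over pairs is the product
of the means. -/
lemma lintegral_prod_pairs {E : Type*} [MeasurableSpace E] {Z : ℕ → Ω → E}
    (hind : iIndepFun Z P) (hZ : ∀ m, Measurable (Z m)) {g : E × E → ℝ≥0∞} (hg : Measurable g)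
    {c : ℝ≥0∞} (hc : ∀ j, ∫⁻ ω, g (Z (2 * j) ω, Z (2 * j + 1) ω) ∂P = c) (J : ℕ) :
    ∫⁻ ω, ∏ j ∈ Finset.range J, g (Z (2 * j) ω, Z (2 * j + 1) ω) ∂P = c ^ J := by
  induction J with
  | zero => simp
  | succ J ih =>
    have hdis : Disjoint (Finset.range (2 * J)) ({2 * J, 2 * J + 1} : Finset ℕ) := by
      rw [Finset.disjoint_left]
      intro a ha
      simp only [Finset.mem_range] at ha
      simp only [Finset.mem_insert, Finset.mem_singleton]
      lia
    have h := hind.indepFun_finset _ _ hdis hZ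
    have hm1 : ∀ j : (Finset.range J), 2 * (j : ℕ) ∈ Finset.range (2 * J) := fun j => by
      have := Finset.mem_range.1 j.2
      exact Finset.mem_range.2 (by lia)
    have hm2 : ∀ j : (Finset.range J), 2 * (j : ℕ) + 1 ∈ Finset.range (2 * J) := fun j => by
      have := Finset.mem_range.1 j.2
      exact Finset.mem_range.2 (by lia)
    have hφ : Measurable fun z : Finset.range (2 * J) → E =>
        ∏ j ∈ (Finset.range J).attach, g (z ⟨2 * j, hm1 j⟩, z ⟨2 * j + 1, hm2 j⟩) :=
      Finset.measurable_prod _ fun j _ =>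
        hg.comp ((measurable_pi_apply _).prodMk (measurable_pi_apply _))
    have hψ : Measurable fun z : ({2 * J, 2 * J + 1} : Finset ℕ) → E =>
        g (z ⟨2 * J, by simp⟩, z ⟨2 * J + 1, by simp⟩) :=
      hg.comp ((measurable_pi_apply _).prodMk (measurable_pi_apply _))
    have h' := h.comp hφ hψ
    have hF : Measurable fun ω => ∏ j ∈ Finset.range J, g (Z (2 * j) ω, Z (2 * j + 1) ω) :=
      Finset.measurable_prod _ fun j _ => hg.comp ((hZ _).prodMk (hZ _))
    have hG : Measurable fun ω => g (Z (2 * J) ω, Z (2 * J + 1) ω) :=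
      hg.comp ((hZ _).prodMk (hZ _))
    have h2 : (fun ω => ∏ j ∈ Finset.range J, g (Z (2 * j) ω, Z (2 * j + 1) ω)) ⟂ᵢ[P]
        (fun ω => g (Z (2 * J) ω, Z (2 * J + 1) ω)) := by
      convert h' using 1
      · ext ω
        exact (Finset.prod_attach (Finset.range J)
          fun j => g (Z (2 * j) ω, Z (2 * j + 1) ω)).symm
      · rfl
    simp only [Finset.prod_range_succ]
    have h3 := lintegral_mul_eq_lintegral_mul_lintegral_of_indepFun hF hG h2
    simp only [Pi.mul_apply] at h3
    rw [h3, ih, hc, pow_succ]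

lemma sum_pairs_le (u : ℕ → ℝ) (c : ℝ) {J M : ℕ} (hJ : 2 * J ≤ M) :
    1 / 2 * ∑ j ∈ Finset.range J, (u (2 * j) - u (2 * j + 1)) ^ 2 ≤
      ∑ m ∈ Finset.range M, (u m - c) ^ 2 := by
  have h1 : 1 / 2 * ∑ j ∈ Finset.range J, (u (2 * j) - u (2 * j + 1)) ^ 2 ≤
      ∑ m ∈ Finset.range (2 * J), (u m - c) ^ 2 := by
    clear hJ
    induction J with
    | zero => simp
    | succ J ih =>
      rw [Finset.sum_range_succ, show 2 * (J + 1) = 2 * J + 1 + 1 by ring,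
        Finset.sum_range_succ _ (2 * J + 1), Finset.sum_range_succ _ (2 * J)]
      nlinarith [sq_nonneg (u (2 * J) + u (2 * J + 1) - 2 * c)]
  refine h1.trans (Finset.sum_le_sum_of_subset_of_nonneg ?_ fun _ _ _ => sq_nonneg _)
  exact Finset.range_subset_range.2 hJ

end Laplace

end ConformalGen

namespace ConformalGen

/-! ### Moments of the fitted covariance -/

section FitMoments

variable {Ω 𝒳 : Type*} [MeasurableSpace Ω] [MeasurableSpace 𝒳] {P : Measure Ω}
  [IsProbabilityMeasure P] {PX : Measure 𝒳} [IsProbabilityMeasure PX] {d : ℕ} {μ : Resp d}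
  {S : Matrix (Fin d) (Fin d) ℝ}
  {X : ℕ → Ω → 𝒳} {Y : ℕ → Ω → Resp d} {Yhat : ℕ → ℕ → Ω → Resp d}

lemma map_inner_multivariateGaussian (hS : S.PosSemidef) (v : Resp d) :
    (multivariateGaussian μ S).map (fun x => inner ℝ v x) =
      gaussianReal (inner ℝ v μ) (v.ofLp ⬝ᵥ S.mulVec v.ofLp).toNNReal := by
  have h := IsGaussian.map_eq_gaussianReal (μ := multivariateGaussian μ S) (innerSL ℝ v)
  have hvar : Var[innerSL ℝ v; multivariateGaussian μ S] = v.ofLp ⬝ᵥ S.mulVec v.ofLp := by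
    rw [← covarianceBilin_multivariateGaussian (μ := μ) hS v v,
      covarianceBilin_self (IsGaussian.memLp_id _ 2 (by simp))]
    rfl
  have hint : ∫ x, innerSL ℝ v x ∂(multivariateGaussian μ S) = inner ℝ v μ := by
    have h1 := (innerSL ℝ v).integral_comp_comm (μ := multivariateGaussian μ S) (φ := id)
      ((IsGaussian.memLp_id _ 1 (by simp)).integrable le_rfl)
    simpa using h1
  rw [hvar, hint] at h
  exact h

lemma IsSample.map_inner_sub (hS : S.PosSemidef)
    (h : IsSample P PX (multivariateGaussian μ S) X Y Yhat) (i : ℕ) {m m' : ℕ} (hm : m ≠ m')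
    (v : Resp d) :
    P.map (fun ω => inner ℝ v (Yhat i m ω) - inner ℝ v (Yhat i m' ω)) =
      gaussianReal 0 (2 * (v.ofLp ⬝ᵥ S.mulVec v.ofLp).toNNReal) := by
  have hinner : Measurable fun x : Resp d => inner ℝ v x := by fun_prop
  have h1 : ∀ m, P.map (fun ω => inner ℝ v (Yhat i m ω)) =
      gaussianReal (inner ℝ v μ) (v.ofLp ⬝ᵥ S.mulVec v.ofLp).toNNReal := fun m => by
    rw [← map_inner_multivariateGaussian hS, ← h.map_Yhat i m,
      Measure.map_map hinner (h.measurable_Yhat i m)]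
    rfl
  have h2 : P.map (fun ω => -inner ℝ v (Yhat i m' ω)) =
      gaussianReal (-inner ℝ v μ) (v.ofLp ⬝ᵥ S.mulVec v.ofLp).toNNReal := by
    have hm : Measurable fun ω => inner ℝ v (Yhat i m' ω) := hinner.comp (h.measurable_Yhat i m')
    rw [← gaussianReal_map_neg, ← h1 m', Measure.map_map measurable_neg hm]
    rfl
  have hind : (fun ω => inner ℝ v (Yhat i m ω)) ⟂ᵢ[P] (fun ω => -inner ℝ v (Yhat i m' ω)) :=
    ((h.iIndepFun_Yhat i).indepFun hm).comp hinner hinner.neg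
  have h3 := gaussianReal_add_gaussianReal_of_indepFun hind (h1 m) h2
  rw [add_neg_cancel, ← two_mul] at h3
  simp only [sub_eq_add_neg]
  exact h3

/-- The Laplace transform of the empirical quadratic form. Pairing up the draws bounds the form below
by `(1 / (2 M)) ∑ ⟪v, Ŷ (2 j) - Ŷ (2 j + 1)⟫ ^ 2`, a sum of independent squares of centred Gaussians;
`2 * J` pairs are used so that the square roots in their Laplace transforms disappear. -/
lemma IsSample.lintegral_exp_quadForm_ensCov_le (hS : S.PosSemidef)
    (h : IsSample P PX (multivariateGaussian μ S) X Y Yhat) (i : ℕ) {M J : ℕ} (hM : 1 ≤ M)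
    (hJ : 2 * (2 * J) ≤ M) (β : ℝ) (k : ℕ) (v : Resp d) :
    ∫⁻ ω, ENNReal.ofReal (Real.exp (-(1 / 2) * (v.ofLp ⬝ᵥ
        (ensCov β (ensemble Yhat M ω i)).mulVec v.ofLp))) ^ k ∂P ≤
      ENNReal.ofReal ((1 + k * (v.ofLp ⬝ᵥ S.mulVec v.ofLp) / M) ^ J)⁻¹ := by
  have hM' : (0 : ℝ) < M := by exact_mod_cast hM
  have hσ : 0 ≤ v.ofLp ⬝ᵥ S.mulVec v.ofLp := by simpa using hS.dotProduct_mulVec_nonneg v.ofLp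
  set s : ℝ := k / (4 * M) with hs
  have hs0 : 0 ≤ s := by positivity
  have hinner : Measurable fun x : Resp d => inner ℝ v x := by fun_prop
  set g : Resp d × Resp d → ℝ≥0∞ := fun p =>
    ENNReal.ofReal (Real.exp (-s * (inner ℝ v p.1 - inner ℝ v p.2) ^ 2)) with hg
  have hgm : Measurable g := by fun_prop
  have hpt : ∀ ω, ENNReal.ofReal (Real.exp (-(1 / 2) * (v.ofLp ⬝ᵥ
      (ensCov β (ensemble Yhat M ω i)).mulVec v.ofLp))) ^ k ≤
      ∏ j ∈ Finset.range (2 * J), g (Yhat i (2 * j) ω, Yhat i (2 * j + 1) ω) := fun ω => by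
    rw [hg, ← ENNReal.ofReal_pow (Real.exp_nonneg _), ← Real.exp_nat_mul,
      ← ENNReal.ofReal_prod_of_nonneg fun _ _ => Real.exp_nonneg _, ← Real.exp_sum]
    refine ENNReal.ofReal_le_ofReal (Real.exp_le_exp.2 ?_)
    rw [dotProduct_ensCov, ← Finset.mul_sum]
    have h1 := sum_pairs_le (fun m => inner ℝ v (Yhat i m ω))
      (inner ℝ v (ensMean (ensemble Yhat M ω i))) hJ
    rw [← Fin.sum_univ_eq_sum_range (fun m => (inner ℝ v (Yhat i m ω) -
      inner ℝ v (ensMean (ensemble Yhat M ω i))) ^ 2) M] at h1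
    simp only [ensemble] at h1 ⊢
    set q := ∑ j ∈ Finset.range (2 * J),
      (inner ℝ v (Yhat i (2 * j) ω) - inner ℝ v (Yhat i (2 * j + 1) ω)) ^ 2
    have h2 : (M : ℝ)⁻¹ * (1 / 2 * q) ≤ _ := mul_le_mul_of_nonneg_left h1 (by positivity)
    have h3 : 0 ≤ β ^ 2 * ‖v‖ ^ 2 := by positivity
    calc _ ≤ (k : ℝ) * (-(1 / 2) * ((M : ℝ)⁻¹ * (1 / 2 * q))) := by
          refine mul_le_mul_of_nonneg_left ?_ (by positivity)
          linarith
      _ = -s * q := by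
        rw [hs]
        field_simp
        ring
  have hval : ∀ j, ∫⁻ ω, g (Yhat i (2 * j) ω, Yhat i (2 * j + 1) ω) ∂P =
      ENNReal.ofReal (Real.sqrt (1 + k * (v.ofLp ⬝ᵥ S.mulVec v.ofLp) / M))⁻¹ := fun j => by
    have hm := h.map_inner_sub hS i (m := 2 * j) (m' := 2 * j + 1) (by lia) v
    have h1 := lintegral_exp_neg_mul_sq_gaussianReal
      (2 * (v.ofLp ⬝ᵥ S.mulVec v.ofLp).toNNReal) hs0
    have hdm : Measurable fun ω =>
        inner ℝ v (Yhat i (2 * j) ω) - inner ℝ v (Yhat i (2 * j + 1) ω) :=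
      (hinner.comp (h.measurable_Yhat i _)).sub (hinner.comp (h.measurable_Yhat i _))
    rw [← hm, lintegral_map (by fun_prop) hdm] at h1
    rw [hg, h1]
    push_cast
    rw [Real.coe_toNNReal _ hσ, hs]
    congr 4
    field_simp
    ring
  have hpair := lintegral_prod_pairs (h.iIndepFun_Yhat i) (h.measurable_Yhat i) hgm hval (2 * J)
  refine (lintegral_mono hpt).trans (hpair.trans_le (le_of_eq ?_))
  rw [← ENNReal.ofReal_pow (by positivity), pow_mul, inv_pow, Real.sq_sqrt (by positivity),
    inv_pow]

lemma norm_sq_le_quadForm (hS : S.PosDef) (v : Resp d) :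
    ‖v‖ ^ 2 ≤ S⁻¹.trace * (v.ofLp ⬝ᵥ S.mulVec v.ofLp) := by
  have h := norm_sq_le_trace_mul_quadForm_inv hS.inv v
  rwa [Matrix.nonsing_inv_nonsing_inv _ (isUnit_iff_ne_zero.2 hS.det_pos.ne')] at h

/-- Negative moments of the determinant of the fitted covariance are bounded for large ensembles:
by Hölder's inequality and Fubini's theorem they are at most the integral over `v` of the Laplace
transform of the empirical quadratic form at `v`, times a polynomial weight. -/
theorem IsSample.exists_lintegral_quadIntegral_le (hS : S.PosDef)
    (h : IsSample P PX (multivariateGaussian μ S) X Y Yhat) {k : ℕ} (hk : 2 ≤ k) :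
    ∃ K : ℝ≥0∞, K ≠ ∞ ∧ ∃ M₀ : ℕ, 1 ≤ M₀ ∧ ∀ M, M₀ ≤ M → ∀ i β,
      ∫⁻ ω, quadIntegral (ensCov β (ensemble Yhat M ω i)) ^ k ∂P ≤ K := by
  -- the weight is `(1 + ‖v‖) ^ (-(d + 1))`; `r` makes the Laplace transform decay fast enough
  set r : ℕ := (d + 1) * k with hr
  have hr0 : 0 < r := by positivity
  set w : Resp d → ℝ≥0∞ := fun v => ENNReal.ofReal ((1 + ‖v‖) ^ (d + 1))⁻¹ with hw
  have hwm : Measurable w := by fun_prop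
  have hw0 : ∀ v, w v ≠ 0 := fun v => (ENNReal.ofReal_pos.2 (by positivity)).ne'
  have hwt : ∀ v, w v ≠ ∞ := fun v => ENNReal.ofReal_ne_top
  have hwint : ∫⁻ v, w v < ∞ := by
    have h1 := finite_integral_one_add_norm (E := Resp d) (μ := volume) (r := ((d + 1 : ℕ) : ℝ))
      (by simp)
    refine lt_of_le_of_lt (lintegral_mono fun v => ?_) h1
    rw [hw, Real.rpow_neg (by positivity), Real.rpow_natCast]
  set b : ℝ := 2 * (1 + S⁻¹.trace * (8 * r) / k) with hb
  have htr : 0 ≤ S⁻¹.trace := hS.inv.posSemidef.trace_nonneg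
  have hb0 : 0 < b := by positivity
  set K : ℝ≥0∞ := (ENNReal.ofReal (b ^ r) * ∫⁻ v, w v) * (∫⁻ v, w v) ^ (k - 1) with hK
  refine ⟨K, ENNReal.mul_ne_top (ENNReal.mul_ne_top ENNReal.ofReal_ne_top hwint.ne)
    (ENNReal.pow_ne_top hwint.ne), 4 * r, by lia, fun M hM i β => ?_⟩
  have hM1 : 1 ≤ M := by lia
  have hM0 : (0 : ℝ) < M := by exact_mod_cast hM1
  -- `L * r` pairs of pairs, with `L / M ≥ 1 / (8 * r)`
  set L := M / (4 * r) with hL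
  have hL1 : 2 * (2 * (L * r)) ≤ M := by
    have := Nat.div_mul_le_self M (4 * r)
    rw [← hL] at this
    linarith
  have hL2 : (M : ℝ) ≤ 8 * r * L := by
    have h1 : M < 4 * r * (L + 1) := by
      rw [hL]
      exact Nat.lt_mul_div_succ M (by positivity)
    have h2 : 1 ≤ L := (Nat.one_le_div_iff (by positivity)).2 hM
    have h3 : 4 * r * (L + 1) ≤ 8 * r * L := by nlinarith
    exact_mod_cast (h1.trans_le h3).le
  have hlap : ∀ v : Resp d, ∫⁻ ω, ENNReal.ofReal (Real.exp (-(1 / 2) * (v.ofLp ⬝ᵥ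
      (ensCov β (ensemble Yhat M ω i)).mulVec v.ofLp))) ^ k ∂P ≤
      ENNReal.ofReal (b ^ r) * w v ^ k := fun v => by
    refine (h.lintegral_exp_quadForm_ensCov_le hS.posSemidef i hM1 hL1 β k v).trans ?_
    have hσ := norm_sq_le_quadForm hS v
    set σ2 := v.ofLp ⬝ᵥ S.mulVec v.ofLp
    have hσ0 : 0 ≤ σ2 := by simpa using hS.posSemidef.dotProduct_mulVec_nonneg v.ofLp
    have h1 : 1 + k * σ2 / (8 * r) ≤ (1 + k * σ2 / M) ^ L := by
      have h2 := one_add_mul_le_pow (a := k * σ2 / M)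
        (by have : 0 ≤ k * σ2 / M := by positivity
            linarith) L
      refine le_trans ?_ h2
      have h3 : k * σ2 / (8 * r) ≤ L * (k * σ2 / M) := by
        rw [div_le_iff₀ (by positivity), mul_assoc, div_mul_eq_mul_div, ← mul_div_assoc,
          le_div_iff₀ hM0]
        have := mul_le_mul_of_nonneg_left hL2 (by positivity : 0 ≤ k * σ2)
        linarith
      linarith
    have h4 : (1 + ‖v‖) ^ 2 ≤ b * (1 + k * σ2 / (8 * r)) := by
      have h5 : (1 + ‖v‖) ^ 2 ≤ 2 * (1 + ‖v‖ ^ 2) := by nlinarith [sq_nonneg (1 - ‖v‖)]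
      refine h5.trans ?_
      rw [hb, mul_assoc]
      refine mul_le_mul_of_nonneg_left ?_ (by norm_num)
      have h6 : S⁻¹.trace * (8 * r) / k * (k * σ2 / (8 * r)) = S⁻¹.trace * σ2 := by
        field_simp
      have h7 : 0 ≤ S⁻¹.trace * (8 * r) / k := by positivity
      have h8 : 0 ≤ k * σ2 / (8 * r) := by positivity
      nlinarith
    have h9 : ((1 + ‖v‖) ^ 2) ^ r ≤ b ^ r * (1 + k * σ2 / M) ^ (L * r) := by
      rw [pow_mul (1 + k * σ2 / M), ← mul_pow]
      refine pow_le_pow_left₀ (by positivity) (h4.trans ?_) r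
      exact mul_le_mul_of_nonneg_left h1 hb0.le
    have h10 : (1 + ‖v‖) ^ ((d + 1) * k) ≤
        b ^ r * (1 + k * σ2 / M) ^ (L * r) := by
      refine le_trans ?_ h9
      rw [← pow_mul, hr]
      exact pow_le_pow_right₀ (by linarith [norm_nonneg v]) (Nat.le_mul_of_pos_left _ two_pos)
    rw [hw]
    simp only
    rw [← ENNReal.ofReal_pow (by positivity), ← ENNReal.ofReal_mul (by positivity)]
    refine ENNReal.ofReal_le_ofReal ?_
    rw [inv_pow, ← pow_mul, ← div_eq_mul_inv, le_div_iff₀ (by positivity),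
      inv_mul_le_iff₀ (by positivity), mul_comm _ (b ^ r)]
    exact h10
  have hjoint : Measurable fun p : Ω × Resp d => ENNReal.ofReal (Real.exp (-(1 / 2) *
      (p.2.ofLp ⬝ᵥ (ensCov β (ensemble Yhat M p.1 i)).mulVec p.2.ofLp))) ^ k *
      (w p.2)⁻¹ ^ (k - 1) := by
    have hc : Continuous fun p : (Fin M → Resp d) × Resp d =>
        p.2.ofLp ⬝ᵥ (ensCov β p.1).mulVec p.2.ofLp :=
      Continuous.dotProduct (by fun_prop)
        (Continuous.matrix_mulVec ((continuous_ensCov β).comp continuous_fst) (by fun_prop))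
    have he : Measurable fun p : Ω × Resp d => (ensemble Yhat M p.1 i, p.2) :=
      ((h.measurable_ensemble i).comp measurable_fst).prodMk measurable_snd
    have h1 := hc.measurable.comp he
    simp only [Function.comp_def] at h1
    exact (((h1.const_mul _).exp.ennreal_ofReal).pow_const k).mul
      (((hwm.comp measurable_snd).inv).pow_const _)
  calc ∫⁻ ω, quadIntegral (ensCov β (ensemble Yhat M ω i)) ^ k ∂P
      ≤ ∫⁻ ω, (∫⁻ v : Resp d, ENNReal.ofReal (Real.exp (-(1 / 2) * (v.ofLp ⬝ᵥ
          (ensCov β (ensemble Yhat M ω i)).mulVec v.ofLp))) ^ k * (w v)⁻¹ ^ (k - 1)) *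
          (∫⁻ v, w v) ^ (k - 1) ∂P :=
        lintegral_mono fun ω => lintegral_pow_le_weighted volume hk
          (measurable_exp_quadForm _ _) hwm hw0 hwt
    _ = (∫⁻ v : Resp d, (∫⁻ ω, ENNReal.ofReal (Real.exp (-(1 / 2) * (v.ofLp ⬝ᵥ
          (ensCov β (ensemble Yhat M ω i)).mulVec v.ofLp))) ^ k ∂P) * (w v)⁻¹ ^ (k - 1)) *
          (∫⁻ v, w v) ^ (k - 1) := by
        rw [lintegral_mul_const' _ _ (ENNReal.pow_ne_top hwint.ne),
          lintegral_lintegral_swap hjoint.aemeasurable]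
        congr 1
        refine lintegral_congr fun v => ?_
        rw [lintegral_mul_const' _ _ (ENNReal.pow_ne_top (ENNReal.inv_ne_top.2 (hw0 v)))]
    _ ≤ (∫⁻ v : Resp d, ENNReal.ofReal (b ^ r) * w v) * (∫⁻ v, w v) ^ (k - 1) := by
        refine mul_le_mul_left (lintegral_mono fun v => ?_) _
        refine (mul_le_mul_left (hlap v) _).trans_eq ?_
        obtain ⟨j, rfl⟩ : ∃ j, k = j + 1 := ⟨k - 1, by lia⟩
        rw [Nat.add_sub_cancel, pow_succ, mul_assoc, mul_right_comm (w v ^ j), ← mul_pow,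
          ENNReal.mul_inv_cancel (hw0 v) (hwt v), one_pow, one_mul]
    _ = K := by rw [hK, lintegral_const_mul _ hwm]

end FitMoments

end ConformalGen

namespace ConformalGen

/-! ### A volume bound for the conformal sets of the plug-in Gaussian fit -/

section FitSize

variable {d M : ℕ}

/-- A quantity attached to a data point that controls both its score and its fitted Gaussian. -/
noncomputable def fitSize (β : ℝ) (y : Resp d) (e : Fin M → Resp d) : ℝ :=
  1 + ‖y‖ ^ 2 + (M : ℝ)⁻¹ * ∑ m, ‖e m‖ ^ 2 + ((ensCov β e).det)⁻¹

lemma trace_ensCov (hM : 1 ≤ M) (β : ℝ) (e : Fin M → Resp d) :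
    (ensCov β e).trace = (M : ℝ)⁻¹ * ∑ m, ‖e m‖ ^ 2 - ‖ensMean e‖ ^ 2 + d * β ^ 2 := by
  simp only [Matrix.trace, Matrix.diag_apply, ensCov_apply hM, Matrix.one_apply_eq, mul_one,
    Finset.sum_add_distrib, Finset.sum_sub_distrib, ← Finset.mul_sum, EuclideanSpace.real_norm_sq_eq,
    Finset.sum_const, Finset.card_univ, Fintype.card_fin, nsmul_eq_mul, ← sq]
  rw [Finset.sum_comm]

lemma norm_ensMean_sq_le (hM : 1 ≤ M) (e : Fin M → Resp d) :
    ‖ensMean e‖ ^ 2 ≤ (M : ℝ)⁻¹ * ∑ m, ‖e m‖ ^ 2 := by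
  have h1 := trace_ensCov hM 0 e
  have h2 := (posSemidef_ensCov 0 e).trace_nonneg
  rw [h1] at h2
  simpa using h2

variable {β B : ℝ} {e : Fin M → Resp d}

lemma one_le_fitSize (hA : (ensCov β e).PosDef) (y : Resp d) : 1 ≤ fitSize β y e := by
  have h1 := inv_pos.2 hA.det_pos
  have h2 : 0 ≤ ‖y‖ ^ 2 + (M : ℝ)⁻¹ * ∑ m, ‖e m‖ ^ 2 := by positivity
  unfold fitSize
  linarith

lemma covSize_ensCov_le (hM : 1 ≤ M) (hβ : β ^ 2 ≤ B) (hA : (ensCov β e).PosDef) (y : Resp d) :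
    covSize (ensCov β e) ≤ (1 + d * B) * fitSize β y e := by
  have h1 := one_le_fitSize hA y
  have hB : 0 ≤ B := (sq_nonneg β).trans hβ
  have h3 : d * B ≤ d * B * fitSize β y e := le_mul_of_one_le_right (by positivity) h1
  unfold covSize
  rw [trace_ensCov hM]
  unfold fitSize at h1 h3 ⊢
  nlinarith [sq_nonneg ‖y‖, sq_nonneg ‖ensMean e‖]

lemma norm_sub_ensMean_sq_le (hM : 1 ≤ M) (hA : (ensCov β e).PosDef) (y : Resp d) :
    1 + ‖y - ensMean e‖ ^ 2 ≤ 2 * fitSize β y e := by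
  have h1 := norm_ensMean_sq_le hM e
  have h2 := inv_pos.2 hA.det_pos
  have h3 : ‖y - ensMean e‖ ^ 2 ≤ 2 * ‖y‖ ^ 2 + 2 * ‖ensMean e‖ ^ 2 := by
    have := norm_sub_le y (ensMean e)
    nlinarith [norm_nonneg (y - ensMean e), sq_nonneg (‖y‖ - ‖ensMean e‖)]
  unfold fitSize
  linarith

/-- A constant, depending on `d` and the bound `B` on the nuggets, for `gaussScore_le_fitSize`. -/
noncomputable def scoreConst (d : ℕ) (B : ℝ) : ℝ :=
  ((2 * Real.pi) ^ d * Nat.factorial d + Nat.factorial d * d) * (1 + d * B) ^ (d + 1) * 2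

lemma gaussScore_le_fitSize (hM : 1 ≤ M) (hβ : β ^ 2 ≤ B) (hA : (ensCov β e).PosDef)
    (y : Resp d) :
    gaussScore (ensMean e) (ensCov β e) y ≤ scoreConst d B * fitSize β y e ^ (d + 2) := by
  have h0 := one_le_fitSize hA y
  have h1 := covSize_ensCov_le hM hβ hA y
  have h2 := norm_sub_ensMean_sq_le hM hA y
  have h3 := one_le_covSize hA
  have hB : 0 ≤ B := (sq_nonneg β).trans hβ
  calc _ ≤ ((2 * Real.pi) ^ d * Nat.factorial d + Nat.factorial d * d) *
        covSize (ensCov β e) ^ (d + 1) * (1 + ‖y - ensMean e‖ ^ 2) := gaussScore_le hA _ y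
    _ ≤ ((2 * Real.pi) ^ d * Nat.factorial d + Nat.factorial d * d) *
        ((1 + d * B) * fitSize β y e) ^ (d + 1) * (2 * fitSize β y e) := by gcongr
    _ = _ := by
      unfold scoreConst
      rw [mul_pow (1 + (d : ℝ) * B)]
      ring

/-- The squared volume of the CP4Gen set is controlled by a power of `fitSize` at the test point
and by the average of a power of `fitSize` over the calibration points. -/
lemma volume_conformalSet_sq_le (hd : 0 < d) (hM : 1 ≤ M) {α : ℝ} (hα0 : 0 < α) (hα1 : α < 1)
    {N : ℕ} (hN : 2 ≤ α * N) (hβ : β ^ 2 ≤ B) (Y : ℕ → Resp d) (ens : ℕ → Fin M → Resp d)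
    (hA : ∀ i, (ensCov β (ens i)).PosDef) :
    volume (conformalSet (cp4genScore (fun _ : Fin M => (0 : Fin 1)) β) α N Y ens) ^ 2 ≤
      volume (Metric.ball (0 : Resp d) 1) ^ 2 * ENNReal.ofReal (2 ^ d * (2 ^ d *
        (1 + d * B) ^ (2 * d) * fitSize β (Y N) (ens N) ^ (2 * d) +
        2 / α * scoreConst d B ^ (2 * d) * ((N : ℝ)⁻¹ *
          ∑ i : Fin N, fitSize β (Y i) (ens i) ^ ((d + 2) * (2 * d))))) := by
  have hB : 0 ≤ B := (sq_nonneg β).trans hβ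
  have hN0 : (0 : ℝ) < N := by
    by_contra! hc
    nlinarith
  have hT : ∀ i y, 0 ≤ fitSize β y (ens i) := fun i y =>
    zero_le_one.trans (one_le_fitSize (hA i) y)
  have hc0 : 0 ≤ scoreConst d B := by unfold scoreConst; positivity
  set G : ℝ := 2 / α * scoreConst d B ^ (2 * d) * ((N : ℝ)⁻¹ *
          ∑ i : Fin N, fitSize β (Y i) (ens i) ^ ((d + 2) * (2 * d))) with hG
  set D : ℝ := 2 ^ d * (2 ^ d * (1 + d * B) ^ (2 * d) * fitSize β (Y N) (ens N) ^ (2 * d) + G)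
    with hD
  have hsum0 : 0 ≤ ∑ i : Fin N, fitSize β (Y i) (ens i) ^ ((d + 2) * (2 * d)) :=
    Finset.sum_nonneg fun i _ => pow_nonneg (hT _ _) _
  have hG0 : 0 ≤ G := mul_nonneg (mul_nonneg (by positivity) (pow_nonneg hc0 _))
    (mul_nonneg (by positivity) hsum0)
  have hD0 : 0 ≤ D := mul_nonneg (by positivity)
    (add_nonneg (mul_nonneg (by positivity) (pow_nonneg (hT N (Y N)) _)) hG0)
  -- the score of a point of the set is bounded by the upper empirical quantiles
  have hscore : ∀ y ∈ conformalSet (cp4genScore (fun _ : Fin M => (0 : Fin 1)) β) α N Y ens,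
      max (gaussScore (ensMean (ens N)) (ensCov β (ens N)) y) 0 ^ (2 * d) ≤ G := fun y hy => by
    rw [mem_conformalSet_iff _ hα1] at hy
    simp only [cp4genScore_eq_gaussScore hM] at hy
    set s := gaussScore (ensMean (ens N)) (ensCov β (ens N)) y
    rcases le_total s 0 with hs | hs
    · rw [max_eq_right hs, zero_pow (by lia)]
      exact hG0
    rw [max_eq_left hs]
    have hcard := Finset.card_filter_add_card_filter_not (s := (Finset.univ : Finset (Fin N)))
      (fun i : Fin N => gaussScore (ensMean (ens i)) (ensCov β (ens i)) (Y i) < s)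
    rw [Finset.card_univ, Fintype.card_fin] at hcard
    have hcard' : ((Finset.univ.filter fun i : Fin N =>
        gaussScore (ensMean (ens i)) (ensCov β (ens i)) (Y i) < s).card : ℝ) +
        ((Finset.univ.filter fun i : Fin N =>
        ¬ gaussScore (ensMean (ens i)) (ensCov β (ens i)) (Y i) < s).card : ℝ) = N := by
      exact_mod_cast hcard
    set F := Finset.univ.filter fun i : Fin N =>
      ¬ gaussScore (ensMean (ens i)) (ensCov β (ens i)) (Y i) < s
    have hF : α * N / 2 ≤ F.card := by nlinarith
    have h1 : (F.card : ℝ) * s ^ (2 * d) ≤ scoreConst d B ^ (2 * d) *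
        ∑ i : Fin N, fitSize β (Y i) (ens i) ^ ((d + 2) * (2 * d)) := by
      rw [← nsmul_eq_mul, Finset.mul_sum]
      refine (Finset.card_nsmul_le_sum F _ _ fun i hi => ?_).trans
        (Finset.sum_le_sum_of_subset_of_nonneg (Finset.subset_univ F) fun i _ _ => ?_)
      · have h2 := (not_lt.1 (Finset.mem_filter.1 hi).2).trans
          (gaussScore_le_fitSize hM hβ (hA i) (Y i))
        rw [pow_mul (fitSize β (Y i) (ens i)), ← mul_pow]
        exact pow_le_pow_left₀ hs h2 _
      · have := hT i (Y i)
        positivity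
    have h3 : α * N / 2 * s ^ (2 * d) ≤ scoreConst d B ^ (2 * d) *
        ∑ i : Fin N, fitSize β (Y i) (ens i) ^ ((d + 2) * (2 * d)) :=
      (mul_le_mul_of_nonneg_right hF (by positivity)).trans h1
    calc s ^ (2 * d) = 2 / α * (N : ℝ)⁻¹ * (α * N / 2 * s ^ (2 * d)) := by field_simp
      _ ≤ 2 / α * (N : ℝ)⁻¹ * _ := mul_le_mul_of_nonneg_left h3 (by positivity)
      _ = G := by rw [hG]; ring
  set ρ : ℝ := D ^ ((2 * d : ℕ) : ℝ)⁻¹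
  have hρ0 : 0 ≤ ρ := Real.rpow_nonneg hD0 _
  have hρD : ρ ^ (2 * d) = D := Real.rpow_inv_natCast_pow hD0 (by lia)
  have hsub : conformalSet (cp4genScore (fun _ : Fin M => (0 : Fin 1)) β) α N Y ens ⊆
      Metric.closedBall (ensMean (ens N)) ρ := fun y hy => by
    have h1 := hscore y hy
    have h2 := norm_sq_le_of_gaussScore (hA N) (ensMean (ens N)) y
    have h3 := covSize_ensCov_le hM hβ (hA N) (Y N)
    have h4 := one_le_covSize (hA N)
    set s := gaussScore (ensMean (ens N)) (ensCov β (ens N)) y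
    set H := covSize (ensCov β (ens N))
    have h5 : ‖y - ensMean (ens N)‖ ^ 2 ≤ 2 * H ^ 2 + max s 0 ^ 2 := by
      have h6 : H * (2 * s + H) ≤ H * (2 * max s 0 + H) := by
        gcongr
        exact le_max_left _ _
      nlinarith [sq_nonneg (H - max s 0)]
    rw [Metric.mem_closedBall, dist_eq_norm,
      ← pow_le_pow_iff_left₀ (norm_nonneg _) hρ0 (by lia : 2 * d ≠ 0), hρD, pow_mul]
    calc (‖y - ensMean (ens N)‖ ^ 2) ^ d ≤ (2 * H ^ 2 + max s 0 ^ 2) ^ d := by gcongr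
      _ ≤ 2 ^ (d - 1) * ((2 * H ^ 2) ^ d + (max s 0 ^ 2) ^ d) :=
        add_pow_le (by positivity) (by positivity) d
      _ ≤ 2 ^ d * ((2 * H ^ 2) ^ d + (max s 0 ^ 2) ^ d) := by
        gcongr
        · norm_num
        · lia
      _ ≤ 2 ^ d * ((2 * ((1 + d * B) * fitSize β (Y N) (ens N)) ^ 2) ^ d + G) := by
        rw [← pow_mul (max s 0)]
        gcongr
      _ = D := by
        rw [hD, mul_pow 2 _ d, mul_pow (1 + (d : ℝ) * B), mul_pow _ _ d, ← pow_mul, ← pow_mul]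
        ring
  calc _ ≤ volume (Metric.closedBall (ensMean (ens N)) ρ) ^ 2 := by gcongr
    _ = _ := by
      rw [Measure.addHaar_closedBall _ _ hρ0, finrank_euclideanSpace, Fintype.card_fin, mul_pow,
        ← ENNReal.ofReal_pow (by positivity), ← pow_mul, mul_comm d, hρD, mul_comm]

end FitSize

section FitSizeMoments

variable {Ω 𝒳 : Type*} [MeasurableSpace Ω] [MeasurableSpace 𝒳] {P : Measure Ω}
  {PX : Measure 𝒳} [IsProbabilityMeasure PX] {d : ℕ} {μ : Resp d}
  {S : Matrix (Fin d) (Fin d) ℝ}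
  {X : ℕ → Ω → 𝒳} {Y : ℕ → Ω → Resp d} {Yhat : ℕ → ℕ → Ω → Resp d}

lemma ennreal_add_pow_le (a b : ℝ≥0∞) (p : ℕ) : (a + b) ^ p ≤ 2 ^ p * (a ^ p + b ^ p) := by
  have h : a + b ≤ 2 * max a b := by
    rw [two_mul]
    exact add_le_add (le_max_left _ _) (le_max_right _ _)
  calc (a + b) ^ p ≤ (2 * max a b) ^ p := by gcongr
    _ = 2 ^ p * max a b ^ p := mul_pow _ _ _
    _ ≤ _ := by
      gcongr
      rcases le_total a b with h | h
      · rw [max_eq_right h]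
        exact le_add_self
      · rw [max_eq_left h]
        exact le_self_add

lemma lintegral_norm_pow_lt_top (p : ℕ) :
    ∫⁻ x, ENNReal.ofReal (‖x‖ ^ p) ∂(multivariateGaussian μ S) < ∞ := by
  have h := (IsGaussian.memLp_id (multivariateGaussian μ S) p (by simp)).integrable_norm_pow'
  simp only [id] at h
  exact h.lintegral_lt_top

lemma lintegral_affine [IsProbabilityMeasure P] {c : ℝ≥0∞} (hc : c ≠ ∞) {f g q : Ω → ℝ≥0∞}
    (hf : Measurable f) (hg : Measurable g) :
    ∫⁻ ω, c * (c * (c * (1 + f ω) + g ω) + (1 + q ω)) ∂P =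
      c * (c * (c * (1 + ∫⁻ ω, f ω ∂P) + ∫⁻ ω, g ω ∂P) + (1 + ∫⁻ ω, q ω ∂P)) := by
  rw [lintegral_const_mul' _ _ hc, lintegral_add_left (by fun_prop),
    lintegral_const_mul' _ _ hc, lintegral_add_left (by fun_prop),
    lintegral_const_mul' _ _ hc, lintegral_add_left (by fun_prop),
    lintegral_add_left (by fun_prop), lintegral_one, measure_univ]

lemma measurable_quadIntegral_ensCov {M : ℕ} (β : ℝ) :
    Measurable fun e : Fin M → Resp d => quadIntegral (ensCov β e) := by
  have hc : Continuous fun p : (Fin M → Resp d) × Resp d =>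
      p.2.ofLp ⬝ᵥ (ensCov β p.1).mulVec p.2.ofLp :=
    Continuous.dotProduct (by fun_prop)
      (Continuous.matrix_mulVec ((continuous_ensCov β).comp continuous_fst) (by fun_prop))
  have hm := ((hc.measurable.const_mul (-(1 / 2))).exp.ennreal_ofReal)
  exact hm.lintegral_prod_right'

lemma ofReal_average_pow_le {M : ℕ} (hM : 1 ≤ M) (e : Fin M → Resp d) (p : ℕ) :
    ENNReal.ofReal ((M : ℝ)⁻¹ * ∑ m, ‖e m‖ ^ 2) ^ p ≤
      (M : ℝ≥0∞)⁻¹ * ∑ m, ENNReal.ofReal (‖e m‖ ^ (2 * p)) := by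
  have hM' : (0 : ℝ) < M := by exact_mod_cast hM
  have h := Real.pow_arith_mean_le_arith_mean_pow Finset.univ (fun _ : Fin M => (M : ℝ)⁻¹)
    (fun m => ‖e m‖ ^ 2) (fun _ _ => by positivity) (by simp [hM'.ne'])
    (fun _ _ => by positivity) p
  simp only [← Finset.mul_sum, ← pow_mul] at h
  rw [← ENNReal.ofReal_pow (by positivity)]
  refine (ENNReal.ofReal_le_ofReal h).trans_eq ?_
  rw [ENNReal.ofReal_mul (by positivity), ENNReal.ofReal_inv_of_pos hM', ENNReal.ofReal_natCast,
    ENNReal.ofReal_sum_of_nonneg fun _ _ => by positivity]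

/-- The sizes of the plug-in fits have bounded moments. -/
lemma IsSample.exists_lintegral_fitSize_le [IsProbabilityMeasure P] (hS : S.PosDef)
    (h : IsSample P PX (multivariateGaussian μ S) X Y Yhat) (p : ℕ) :
    ∃ K : ℝ≥0∞, K ≠ ∞ ∧ ∃ M₀ : ℕ, 1 ≤ M₀ ∧ ∀ M, M₀ ≤ M → ∀ i β,
      (∀ᵐ ω ∂P, (ensCov β (ensemble Yhat M ω i)).PosDef) ∧
      ∫⁻ ω, ENNReal.ofReal (fitSize β (Y i ω) (ensemble Yhat M ω i) ^ p) ∂P ≤ K := by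
  obtain ⟨K, hK, M₀, hM₀, hI⟩ := h.exists_lintegral_quadIntegral_le hS
    (k := 2 * (p + 1)) (by lia)
  set m : ℝ≥0∞ := ∫⁻ x, ENNReal.ofReal (‖x‖ ^ (2 * p)) ∂(multivariateGaussian μ S)
  have hm : m ≠ ∞ := (lintegral_norm_pow_lt_top _).ne
  refine ⟨2 ^ p * (2 ^ p * (2 ^ p * (1 + m) + m) + (1 + K)), by finiteness,
    M₀, hM₀, fun M hM i β => ?_⟩
  have hM1 : 1 ≤ M := hM₀.trans hM
  have hIM := hI M hM i β
  have hpd : ∀ᵐ ω ∂P, quadIntegral (ensCov β (ensemble Yhat M ω i)) ≠ ∞ := by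
    have hm := ((measurable_quadIntegral_ensCov (d := d) (M := M) β).comp
      (h.measurable_ensemble i)).pow_const (2 * (p + 1))
    filter_upwards [ae_lt_top hm (hIM.trans_lt hK.lt_top).ne] with ω hω hc
    rw [Function.comp_apply, hc, ENNReal.top_pow (by lia)] at hω
    exact lt_irrefl _ hω
  refine ⟨?_, ?_⟩
  · filter_upwards [hpd] with ω hω
    exact posDef_of_quadIntegral_ne_top (posSemidef_ensCov _ _) hω
  · have hpt : ∀ᵐ ω ∂P, ENNReal.ofReal (fitSize β (Y i ω) (ensemble Yhat M ω i) ^ p) ≤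
        2 ^ p * (2 ^ p * (2 ^ p * (1 + ENNReal.ofReal (‖Y i ω‖ ^ (2 * p))) +
          (M : ℝ≥0∞)⁻¹ * ∑ m : Fin M, ENNReal.ofReal (‖Yhat i m ω‖ ^ (2 * p))) +
          (1 + quadIntegral (ensCov β (ensemble Yhat M ω i)) ^ (2 * (p + 1)))) := by
      filter_upwards [hpd] with ω hω
      have hA := posDef_of_quadIntegral_ne_top (posSemidef_ensCov _ _) hω
      have hdet := inv_pos.2 hA.det_pos
      have hq : ENNReal.ofReal ((ensCov β (ensemble Yhat M ω i)).det)⁻¹ ^ p ≤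
          1 + quadIntegral (ensCov β (ensemble Yhat M ω i)) ^ (2 * (p + 1)) := by
        refine (pow_le_pow_left' (inv_det_le_quadIntegral hA) p).trans ?_
        rw [← pow_mul]
        rcases le_total (quadIntegral (ensCov β (ensemble Yhat M ω i))) 1 with h1 | h1
        · exact (pow_le_one₀ zero_le h1).trans le_self_add
        · exact (pow_le_pow_right₀ h1 (by lia)).trans le_add_self
      have h0 := one_le_fitSize hA (Y i ω)
      rw [ENNReal.ofReal_pow (by linarith), fitSize, ENNReal.ofReal_add (by positivity) hdet.le,
        ENNReal.ofReal_add (by positivity) (by positivity),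
        ENNReal.ofReal_add zero_le_one (by positivity), ENNReal.ofReal_one]
      refine (ennreal_add_pow_le _ _ p).trans ?_
      gcongr
      refine (ennreal_add_pow_le _ _ p).trans ?_
      gcongr
      · refine (ennreal_add_pow_le _ _ p).trans_eq ?_
        rw [one_pow, ← ENNReal.ofReal_pow (by positivity), ← pow_mul]
      · exact ofReal_average_pow_le hM1 _ p
    have hmn : Measurable fun x : Resp d => ENNReal.ofReal (‖x‖ ^ (2 * p)) := by fun_prop
    have hY : ∫⁻ ω, ENNReal.ofReal (‖Y i ω‖ ^ (2 * p)) ∂P = m := by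
      rw [← lintegral_map hmn (h.measurable_Y i), h.map_Y]
    have hYh : ∀ j, ∫⁻ ω, ENNReal.ofReal (‖Yhat i j ω‖ ^ (2 * p)) ∂P = m := fun j => by
      rw [← lintegral_map hmn (h.measurable_Yhat i j), h.map_Yhat]
    have hYm : Measurable fun ω => ENNReal.ofReal (‖Y i ω‖ ^ (2 * p)) :=
      hmn.comp (h.measurable_Y i)
    have hYhm : ∀ j, Measurable fun ω => ENNReal.ofReal (‖Yhat i j ω‖ ^ (2 * p)) := fun j =>
      hmn.comp (h.measurable_Yhat i j)
    have hsm : Measurable fun ω => ∑ j : Fin M, ENNReal.ofReal (‖Yhat i j ω‖ ^ (2 * p)) :=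
      Finset.measurable_sum _ fun j _ => hYhm j
    have havg : ∫⁻ ω, (M : ℝ≥0∞)⁻¹ * ∑ j : Fin M, ENNReal.ofReal (‖Yhat i j ω‖ ^ (2 * p)) ∂P =
        m := by
      rw [lintegral_const_mul _ hsm, lintegral_finsetSum Finset.univ
        (f := fun (j : Fin M) ω => ENNReal.ofReal (‖Yhat i j ω‖ ^ (2 * p))) fun j _ => hYhm j]
      simp only [hYh, Finset.sum_const, Finset.card_univ, Fintype.card_fin, nsmul_eq_mul]
      rw [← mul_assoc, ENNReal.inv_mul_cancel (by simp; lia) (by simp), one_mul]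
    have ht : (2 : ℝ≥0∞) ^ p ≠ ∞ := by finiteness
    refine (lintegral_mono_ae hpt).trans ?_
    rw [lintegral_affine ht hYm (hsm.const_mul _), havg, hY]
    gcongr

end FitSizeMoments

end ConformalGen

namespace ConformalGen

section SecondMoment

variable {Ω 𝒳 : Type*} [MeasurableSpace Ω] [MeasurableSpace 𝒳] {P : Measure Ω}
  [IsProbabilityMeasure P] {PX : Measure 𝒳} [IsProbabilityMeasure PX] {d : ℕ} {μ : Resp d}
  {S : Matrix (Fin d) (Fin d) ℝ}
  {X : ℕ → Ω → 𝒳} {Y : ℕ → Ω → Resp d} {Yhat : ℕ → ℕ → Ω → Resp d}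

/-- For large ensembles the squared volume of the CP4Gen set has a bounded mean; the majorant is
needed because the volume of the random set is not known to be measurable. -/
theorem IsSample.exists_volume_sq_bound (hd : 0 < d) (hS : S.PosDef)
    (h : IsSample P PX (multivariateGaussian μ S) X Y Yhat) {α : ℝ} (hα0 : 0 < α) (hα1 : α < 1) :
    ∃ K : ℝ≥0∞, K ≠ ∞ ∧ ∃ M₀ : ℕ, 1 ≤ M₀ ∧ ∀ M, M₀ ≤ M → ∀ N : ℕ, 2 ≤ α * N → ∀ β : ℝ, β ^ 2 ≤ 1 →
      ∃ V : Ω → ℝ≥0∞, Measurable V ∧ ∫⁻ ω, V ω ∂P ≤ K ∧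
        ∀ᵐ ω ∂P, volume (cp4genSet Y Yhat α β M N ω) ^ 2 ≤ V ω := by
  obtain ⟨K₁, hK₁, M₁, hM₁, h1⟩ := h.exists_lintegral_fitSize_le hS (2 * d)
  obtain ⟨K₂, hK₂, M₂, hM₂, h2⟩ := h.exists_lintegral_fitSize_le hS ((d + 2) * (2 * d))
  set b : ℝ≥0∞ := volume (Metric.ball (0 : Resp d) 1) ^ 2
  have hb : b ≠ ∞ := ENNReal.pow_ne_top measure_ball_lt_top.ne
  set c₀ : ℝ := 2 ^ d
  set c₁ : ℝ := 2 ^ d * (1 + d * 1) ^ (2 * d)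
  set c₂ : ℝ := 2 / α * scoreConst d 1 ^ (2 * d)
  have hc₀ : 0 ≤ c₀ := by positivity
  have hc₁ : 0 ≤ c₁ := by positivity
  have hc₂ : 0 ≤ c₂ := by unfold c₂ scoreConst; positivity
  refine ⟨b * (ENNReal.ofReal c₀ * (ENNReal.ofReal c₁ * K₁ + ENNReal.ofReal c₂ * K₂)),
    by finiteness, max M₁ M₂, hM₁.trans (le_max_left _ _), fun M hM N hN β hβ => ?_⟩
  have hM1 : M₁ ≤ M := (le_max_left _ _).trans hM
  have hM2 : M₂ ≤ M := (le_max_right _ _).trans hM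
  have hN0 : (0 : ℝ) < N := by
    by_contra! hc
    nlinarith
  have hNne : N ≠ 0 := fun hc => by simp [hc] at hN0
  have hT : ∀ i (p : ℕ), Measurable fun ω =>
      ENNReal.ofReal (fitSize β (Y i ω) (ensemble Yhat M ω i) ^ p) := fun i p => by
    have hc : Continuous fun p : Resp d × (Fin M → Resp d) => (ensCov β p.2).det :=
      ((continuous_ensCov β).comp continuous_snd).matrix_det
    have hm := hc.measurable.inv
    have hf : Measurable fun p : Resp d × (Fin M → Resp d) => fitSize β p.1 p.2 := by
      unfold fitSize
      exact Measurable.add (by fun_prop) hm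
    have := hf.comp ((h.measurable_Y i).prodMk (h.measurable_ensemble i (M := M)))
    exact (this.pow_const p).ennreal_ofReal
  have hsm : Measurable fun ω => ∑ i : Fin N,
      ENNReal.ofReal (fitSize β (Y i ω) (ensemble Yhat M ω i) ^ ((d + 2) * (2 * d))) :=
    Finset.measurable_sum _ fun i _ => hT i _
  refine ⟨fun ω => b * (ENNReal.ofReal c₀ * (ENNReal.ofReal c₁ *
    ENNReal.ofReal (fitSize β (Y N ω) (ensemble Yhat M ω N) ^ (2 * d)) + ENNReal.ofReal c₂ *
    ((N : ℝ≥0∞)⁻¹ * ∑ i : Fin N,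
      ENNReal.ofReal (fitSize β (Y i ω) (ensemble Yhat M ω i) ^ ((d + 2) * (2 * d)))))), ?_, ?_, ?_⟩
  · have := hT N (2 * d)
    fun_prop
  · have hm1 := (hT N (2 * d)).const_mul (ENNReal.ofReal c₁)
    rw [lintegral_const_mul' _ _ hb, lintegral_const_mul' _ _ ENNReal.ofReal_ne_top,
      lintegral_add_left hm1, lintegral_const_mul' _ _ ENNReal.ofReal_ne_top,
      lintegral_const_mul' _ _ ENNReal.ofReal_ne_top, lintegral_const_mul _ hsm,
      lintegral_finsetSum Finset.univ (f := fun (i : Fin N) ω =>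
        ENNReal.ofReal (fitSize β (Y i ω) (ensemble Yhat M ω i) ^ ((d + 2) * (2 * d))))
        fun i _ => hT i _]
    have havg : (N : ℝ≥0∞)⁻¹ * ∑ i : Fin N, ∫⁻ ω, ENNReal.ofReal
        (fitSize β (Y i ω) (ensemble Yhat M ω i) ^ ((d + 2) * (2 * d))) ∂P ≤ K₂ := by
      calc _ ≤ (N : ℝ≥0∞)⁻¹ * ∑ i : Fin N, K₂ := by
            gcongr with i
            exact (h2 M hM2 i β).2
        _ = K₂ := by
          rw [Finset.sum_const, Finset.card_univ, Fintype.card_fin, nsmul_eq_mul, ← mul_assoc,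
            ENNReal.inv_mul_cancel (by exact_mod_cast hNne) (by simp), one_mul]
    have := (h1 M hM1 N β).2
    gcongr
  · filter_upwards [ae_all_iff.2 fun i => (h1 M hM1 i β).1] with ω hω
    have hv := volume_conformalSet_sq_le hd (hM₁.trans hM1) hα0 hα1 hN hβ (fun i => Y i ω)
      (ensemble Yhat M ω) hω
    have hp : ∀ i (p : ℕ), 0 ≤ fitSize β (Y i ω) (ensemble Yhat M ω i) ^ p := fun i p =>
      pow_nonneg (zero_le_one.trans (one_le_fitSize (hω i) _)) p
    refine hv.trans_eq ?_
    have hs0 : 0 ≤ ∑ i : Fin N,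
        fitSize β (Y i ω) (ensemble Yhat M ω i) ^ ((d + 2) * (2 * d)) :=
      Finset.sum_nonneg fun i _ => hp i _
    rw [ENNReal.ofReal_mul hc₀, ENNReal.ofReal_add (mul_nonneg hc₁ (hp N _))
      (mul_nonneg hc₂ (mul_nonneg (by positivity) hs0)), ENNReal.ofReal_mul hc₁,
      ENNReal.ofReal_mul hc₂, ENNReal.ofReal_mul (p := (N : ℝ)⁻¹) (by positivity),
      ENNReal.ofReal_inv_of_pos hN0, ENNReal.ofReal_natCast,
      ENNReal.ofReal_sum_of_nonneg (f := fun i : Fin N =>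
        fitSize β (Y i ω) (ensemble Yhat M ω i) ^ ((d + 2) * (2 * d))) fun i _ => hp i _]

end SecondMoment

/-! ### Concentration of the CP4Gen set -/

section Sandwich

variable {d : ℕ} {μ : Resp d} {S : Matrix (Fin d) (Fin d) ℝ}

/-- A CP4Gen set lies between two level sets of the true density when the fit at the test point is
accurate, the true scores of the calibration responses have roughly the right quantiles, and few
calibration scores are far from the true ones. -/
lemma conformalSet_sandwich {M : ℕ} (hM : 1 ≤ M) {α : ℝ} (hα0 : 0 < α) (hα1 : α < 1) {N : ℕ}
    {β q η κ : ℝ}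
    (hκN : 1 ≤ κ * N) (Y : ℕ → Resp d) (ens : ℕ → Fin M → Resp d)
    (hup : ∀ y, gaussScore (ensMean (ens N)) (ensCov β (ens N)) y ≤ q + η →
      gaussScore μ S y ≤ q + 2 * η)
    (hlow : ∀ y, gaussScore μ S y ≤ q - 2 * η →
      gaussScore (ensMean (ens N)) (ensCov β (ens N)) y ≤ q - η)
    (hcup : (1 - α + 2 * κ) * N ≤
      (Finset.univ.filter fun i : Fin N => gaussScore μ S (Y i) ≤ q + η / 2).card)
    (hclow : ((Finset.univ.filter fun i : Fin N => gaussScore μ S (Y i) ≤ q - η / 2).card : ℝ) ≤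
      (1 - α - 2 * κ) * N)
    (hfar : ((Finset.univ.filter fun i : Fin N => η / 2 <
      |gaussScore (ensMean (ens i)) (ensCov β (ens i)) (Y i) - gaussScore μ S (Y i)|).card : ℝ) ≤
      κ * N) :
    {y | gaussScore μ S y ≤ q - 2 * η} ⊆
      conformalSet (cp4genScore (fun _ : Fin M => (0 : Fin 1)) β) α N Y ens ∧
    conformalSet (cp4genScore (fun _ : Fin M => (0 : Fin 1)) β) α N Y ens ⊆
      {y | gaussScore μ S y ≤ q + 2 * η} := by
  refine ⟨fun y hy => ?_, fun y hy => ?_⟩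
  · rw [mem_conformalSet_iff _ hα1]
    simp only [cp4genScore_eq_gaussScore hM]
    have hy' := hlow y hy
    have hsub : (Finset.univ.filter fun i : Fin N =>
        gaussScore (ensMean (ens i)) (ensCov β (ens i)) (Y i) <
          gaussScore (ensMean (ens N)) (ensCov β (ens N)) y) ⊆
        (Finset.univ.filter fun i : Fin N => gaussScore μ S (Y i) ≤ q - η / 2) ∪
        (Finset.univ.filter fun i : Fin N => η / 2 < |gaussScore (ensMean (ens i))
          (ensCov β (ens i)) (Y i) - gaussScore μ S (Y i)|) := fun i hi => by
      have h1 := (Finset.mem_filter.1 hi).2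
      simp only [Finset.mem_union, Finset.mem_filter, Finset.mem_univ, true_and]
      by_contra! hc
      have := (abs_le.1 hc.2).1
      linarith [hc.1]
    have hcard := (Finset.card_le_card hsub).trans (Finset.card_union_le _ _)
    have hcard' := (Nat.cast_le (α := ℝ)).2 hcard
    push_cast at hcard'
    nlinarith
  · rw [mem_conformalSet_iff _ hα1] at hy
    simp only [cp4genScore_eq_gaussScore hM] at hy
    refine hup y ?_
    by_contra! hc
    have hsub : (Finset.univ.filter fun i : Fin N => gaussScore μ S (Y i) ≤ q + η / 2) ⊆
        (Finset.univ.filter fun i : Fin N =>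
          gaussScore (ensMean (ens i)) (ensCov β (ens i)) (Y i) <
          gaussScore (ensMean (ens N)) (ensCov β (ens N)) y) ∪
        (Finset.univ.filter fun i : Fin N => η / 2 < |gaussScore (ensMean (ens i))
          (ensCov β (ens i)) (Y i) - gaussScore μ S (Y i)|) := fun i hi => by
      have h1 := (Finset.mem_filter.1 hi).2
      simp only [Finset.mem_union, Finset.mem_filter, Finset.mem_univ, true_and]
      by_contra! hc2
      have := (abs_le.1 hc2.2).2
      linarith [hc2.1]
    have hcard := (Finset.card_le_card hsub).trans (Finset.card_union_le _ _)
    have hcard' := (Nat.cast_le (α := ℝ)).2 hcard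
    push_cast at hcard'
    nlinarith

end Sandwich

section Events

open Classical in
lemma natCast_card_filter_mem {Ω R : Type*} [Semiring R] {N : ℕ} (D : ℕ → Set Ω) (ω : Ω) :
    ((Finset.univ.filter fun i : Fin N => ω ∈ D i).card : R) =
      ∑ i : Fin N, (D i).indicator (fun _ => (1 : R)) ω := by
  rw [Finset.card_filter, Nat.cast_sum]
  refine Finset.sum_congr rfl fun i _ => ?_
  by_cases hi : ω ∈ D i <;> simp [hi]

variable {Ω : Type*} [MeasurableSpace Ω] {P : Measure Ω}

lemma tendsto_measure_zero_of_ae_eventually [IsProbabilityMeasure P] {A : ℕ → Set Ω}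
    (hA : ∀ n, MeasurableSet (A n)) (h : ∀ᵐ ω ∂P, ∀ᶠ n in atTop, ω ∉ A n) :
    Tendsto (fun n => P (A n)) atTop (𝓝 0) := by
  have h1 := tendsto_measure_of_ae_tendsto_indicator_of_isFiniteMeasure (μ := P) atTop
    MeasurableSet.empty hA (by
      filter_upwards [h] with ω hω
      filter_upwards [hω] with n hn
      simpa using hn)
  simpa using h1

open Classical in
/-- Markov's inequality for the number of events that occur. -/
lemma measure_card_filter_gt_le {N : ℕ} (hN : 1 ≤ N) {D : ℕ → Set Ω}
    (hD : ∀ i, MeasurableSet (D i)) {c : ℝ≥0∞} (hc : ∀ i, P (D i) ≤ c) {κ : ℝ} (hκ : 0 < κ) :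
    P {ω | κ * N < ((Finset.univ.filter fun i : Fin N => ω ∈ D i).card : ℝ)} ≤
      (ENNReal.ofReal κ)⁻¹ * c := by
  have hN' : (N : ℝ≥0∞) ≠ 0 := by exact_mod_cast (by lia : N ≠ 0)
  have hm : Measurable fun ω => ∑ i : Fin N, (D i).indicator (fun _ => (1 : ℝ≥0∞)) ω :=
    Finset.measurable_sum _ fun i _ => measurable_const.indicator (hD i)
  have h1 := mul_meas_ge_le_lintegral (μ := P) hm (ENNReal.ofReal (κ * N))
  have h2 : ∫⁻ ω, ∑ i : Fin N, (D i).indicator (fun _ => (1 : ℝ≥0∞)) ω ∂P ≤ N * c := by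
    rw [lintegral_finsetSum Finset.univ
      (f := fun (i : Fin N) ω => (D i).indicator (fun _ => (1 : ℝ≥0∞)) ω)
      fun i _ => measurable_const.indicator (hD i)]
    calc _ ≤ ∑ i : Fin N, c := Finset.sum_le_sum fun i _ => by
          rw [lintegral_indicator_const (hD i), one_mul]
          exact hc i
      _ = N * c := by simp
  have h3 : P {ω | κ * N < ((Finset.univ.filter fun i : Fin N => ω ∈ D i).card : ℝ)} ≤
      P {ω | ENNReal.ofReal (κ * N) ≤
        ∑ i : Fin N, (D i).indicator (fun _ => (1 : ℝ≥0∞)) ω} := by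
    refine measure_mono fun ω hω => ?_
    rw [Set.mem_ofPred_eq, ← natCast_card_filter_mem, ← ENNReal.ofReal_natCast]
    exact ENNReal.ofReal_le_ofReal (le_of_lt hω)
  have h4 := (mul_le_mul_right h3 (ENNReal.ofReal (κ * N))).trans (h1.trans h2)
  rw [ENNReal.ofReal_mul hκ.le, ENNReal.ofReal_natCast, mul_comm (ENNReal.ofReal κ), mul_assoc,
    ENNReal.mul_le_mul_iff_right hN' (ENNReal.natCast_ne_top N)] at h4
  rwa [← ENNReal.div_eq_inv_mul, ENNReal.le_div_iff_mul_le
    (Or.inl (ENNReal.ofReal_pos.2 hκ).ne') (Or.inl ENNReal.ofReal_ne_top), mul_comm]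

end Events

end ConformalGen

namespace ConformalGen

section Frequency

open Classical in
lemma measurable_card_filter_mem {Ω : Type*} [MeasurableSpace Ω] {D : ℕ → Set Ω}
    (hD : ∀ i, MeasurableSet (D i)) (N : ℕ) :
    Measurable fun ω => ((Finset.univ.filter fun i : Fin N => ω ∈ D i).card : ℝ) := by
  simp_rw [natCast_card_filter_mem]
  exact Finset.measurable_sum _ fun i _ => measurable_const.indicator (hD i)

variable {Ω 𝒳 : Type*} [MeasurableSpace Ω] [MeasurableSpace 𝒳] {P : Measure Ω}
  {PX : Measure 𝒳} [IsProbabilityMeasure PX] {d : ℕ} {μ : Resp d}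
  {S : Matrix (Fin d) (Fin d) ℝ}
  {X : ℕ → Ω → 𝒳} {Y : ℕ → Ω → Resp d} {Yhat : ℕ → ℕ → Ω → Resp d}

open Classical in
/-- The strong law for the relative frequency of an event among the calibration responses. -/
lemma IsSample.ae_tendsto_frequency (h : IsSample P PX (multivariateGaussian μ S) X Y Yhat)
    {G : Set (Resp d)} (hG : MeasurableSet G) :
    ∀ᵐ ω ∂P, Tendsto (fun N : ℕ =>
      ((Finset.univ.filter fun i : Fin N => Y i ω ∈ G).card : ℝ) / N) atTop
      (𝓝 ((multivariateGaussian μ S).real G)) := by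
  set g : Resp d → ℝ := G.indicator fun _ => 1
  have hgm : Measurable g := measurable_const.indicator hG
  have hid : ∀ i, IdentDistrib (Y i) (Y 0) P P := fun i =>
    ⟨(h.measurable_Y i).aemeasurable, (h.measurable_Y 0).aemeasurable, by
      rw [h.map_Y, h.map_Y]⟩
  have hgi : Integrable g (multivariateGaussian μ S) := (integrable_const _).indicator hG
  have hint : Integrable (g ∘ Y 0) P := by
    rw [← integrable_map_measure hgm.aestronglyMeasurable (h.measurable_Y 0).aemeasurable, h.map_Y]
    exact hgi
  have hE : ∫ ω, (g ∘ Y 0) ω ∂P = (multivariateGaussian μ S).real G := by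
    have h1 := integral_map (h.measurable_Y 0).aemeasurable
      (hgm.aestronglyMeasurable (μ := P.map (Y 0)))
    rw [h.map_Y, integral_indicator_const _ hG, smul_eq_mul, mul_one] at h1
    exact h1.symm
  have hlln := strong_law_ae_real (fun i => g ∘ Y i) hint
    (fun a b hab => (h.iIndepFun_Y.indepFun hab).comp hgm hgm) fun i => (hid i).comp hgm
  rw [hE] at hlln
  filter_upwards [hlln] with ω hω
  refine hω.congr fun N => ?_
  congr 1
  rw [← Fin.sum_univ_eq_sum_range (fun i => (g ∘ Y i) ω) N]
  exact (natCast_card_filter_mem (fun i => Y i ⁻¹' G) ω).symm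

end Frequency

section Concentration

variable {Ω 𝒳 : Type*} [MeasurableSpace Ω] [MeasurableSpace 𝒳] {P : Measure Ω}
  [IsProbabilityMeasure P] {PX : Measure 𝒳} [IsProbabilityMeasure PX] {d : ℕ} {μ : Resp d}
  {S : Matrix (Fin d) (Fin d) ℝ}
  {X : ℕ → Ω → 𝒳} {Y : ℕ → Ω → Resp d} {Yhat : ℕ → ℕ → Ω → Resp d}

lemma continuous_gaussScore (hS : S.PosDef) (μ : Resp d) : Continuous (gaussScore μ S) :=
  ((continuous_gaussianDensity μ).log fun y => (gaussianDensity_pos hS μ y).ne').neg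

lemma continuous_restrict_draws (M : ℕ) :
    Continuous fun p : Resp d × (ℕ → Resp d) => fun m : Fin M => p.2 m := by fun_prop

/-- The probability that the plug-in fit at a data point falls outside a neighbourhood of the true
parameters tends to zero, uniformly over the data points. -/
lemma IsSample.tendsto_measure_fit_notMem (hS : S.PosDef)
    (h : IsSample P PX (multivariateGaussian μ S) X Y Yhat) {β : ℕ → ℝ}
    (hβ : Tendsto β atTop (𝓝 0)) {U : Set (Resp d × Matrix (Fin d) (Fin d) ℝ)} (hU : IsOpen U)
    (hmem : (μ, S) ∈ U) :
    ∃ c : ℕ → ℝ≥0∞, Tendsto c atTop (𝓝 0) ∧ ∀ M i,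
      P {ω | (ensMean (ensemble Yhat M ω i), ensCov (β M) (ensemble Yhat M ω i)) ∉ U} ≤ c M := by
  have hG : ∀ M, MeasurableSet {p : Resp d × (ℕ → Resp d) |
      (ensMean (fun m : Fin M => p.2 m), ensCov (β M) (fun m : Fin M => p.2 m)) ∉ U} := fun M => by
    have hc : Continuous fun p : Resp d × (ℕ → Resp d) =>
        (ensMean (fun m : Fin M => p.2 m), ensCov (β M) (fun m : Fin M => p.2 m)) :=
      (continuous_ensMean.comp (continuous_restrict_draws M)).prodMk
        ((continuous_ensCov (β M)).comp (continuous_restrict_draws M))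
    exact (hU.isClosed_compl.preimage hc).measurableSet
  refine ⟨fun M => P {ω | (ensMean (ensemble Yhat M ω 0),
    ensCov (β M) (ensemble Yhat M ω 0)) ∉ U}, ?_, fun M i =>
    ((h.identDistrib_point i 0).measure_mem_eq (hG M)).le⟩
  refine tendsto_measure_zero_of_ae_eventually (fun M => h.measurable_point 0 (hG M)) ?_
  filter_upwards [h.ae_tendsto_fit hS 0 hβ] with ω hω
  filter_upwards [hω (hU.mem_nhds hmem)] with M hM hc
  exact hc hM

/-- The probability that the score of a calibration point is far from its limit tends to zero,
uniformly over the data points. -/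
lemma IsSample.tendsto_measure_score_sub (hS : S.PosDef)
    (h : IsSample P PX (multivariateGaussian μ S) X Y Yhat) {β : ℕ → ℝ}
    (hβ : Tendsto β atTop (𝓝 0)) {η : ℝ} (hη : 0 < η) :
    ∃ c : ℕ → ℝ≥0∞, Tendsto c atTop (𝓝 0) ∧ ∀ M i,
      MeasurableSet {ω | η < |gaussScore (ensMean (ensemble Yhat M ω i))
        (ensCov (β M) (ensemble Yhat M ω i)) (Y i ω) - gaussScore μ S (Y i ω)|} ∧
      P {ω | η < |gaussScore (ensMean (ensemble Yhat M ω i))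
        (ensCov (β M) (ensemble Yhat M ω i)) (Y i ω) - gaussScore μ S (Y i ω)|} ≤ c M := by
  have hG : ∀ M, MeasurableSet {p : Resp d × (ℕ → Resp d) |
      η < |gaussScore (ensMean (fun m : Fin M => p.2 m)) (ensCov (β M) (fun m : Fin M => p.2 m)) p.1
        - gaussScore μ S p.1|} := fun M => by
    have h1 := measurable_gaussScore (E := Resp d × (ℕ → Resp d))
      (continuous_ensMean.comp (continuous_restrict_draws M))
      ((continuous_ensCov (β M)).comp (continuous_restrict_draws M)) continuous_fst
    have h2 : Measurable fun p : Resp d × (ℕ → Resp d) => gaussScore μ S p.1 :=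
      (continuous_gaussScore hS μ).measurable.comp measurable_fst
    exact measurableSet_lt measurable_const (h1.sub h2).abs
  refine ⟨fun M => P {ω | η < |gaussScore (ensMean (ensemble Yhat M ω 0))
    (ensCov (β M) (ensemble Yhat M ω 0)) (Y 0 ω) - gaussScore μ S (Y 0 ω)|}, ?_, fun M i =>
    ⟨h.measurable_point i (hG M), ((h.identDistrib_point i 0).measure_mem_eq (hG M)).le⟩⟩
  refine tendsto_measure_zero_of_ae_eventually (fun M => h.measurable_point 0 (hG M)) ?_
  filter_upwards [h.ae_tendsto_fit hS 0 hβ] with ω hω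
  have h1 := (continuousAt_gaussScore hS.det_pos μ (Y 0 ω)).tendsto.comp
    (hω.prodMk_nhds (tendsto_const_nhds (x := Y 0 ω)))
  have h2 := (h1.sub_const (gaussScore μ S (Y 0 ω))).abs
  simp only [Function.comp_def, sub_self, abs_zero] at h2
  filter_upwards [h2.eventually_lt_const hη] with M hM hc
  exact absurd hM (not_lt.2 (le_of_lt hc))

section Strictness

lemma gaussScore_le_neg_log_iff (hS : S.PosDef) (μ : Resp d) {τ : ℝ} (hτ : 0 < τ) (y : Resp d) :
    gaussScore μ S y ≤ -Real.log τ ↔ τ ≤ gaussianDensity μ S y := by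
  unfold gaussScore
  rw [neg_le_neg_iff, Real.log_le_log_iff hτ (gaussianDensity_pos hS μ y)]

lemma exists_gaussScore_eq (hd : 0 < d) (hS : S.PosDef) (μ : Resp d) {v : ℝ}
    (hv : gaussScore μ S μ ≤ v) : ∃ y, gaussScore μ S y = v := by
  obtain ⟨y, hy⟩ := exists_gaussianDensity_eq hd hS μ (Real.exp_pos (-v)) (by
    rw [← Real.exp_log (gaussianDensity_pos hS μ μ)]
    refine Real.exp_le_exp.2 ?_
    unfold gaussScore at hv
    linarith)
  exact ⟨y, by rw [gaussScore, hy, Real.log_exp, neg_neg]⟩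

lemma measureReal_gaussScore_le_lt (hd : 0 < d) (hS : S.PosDef) (μ : Resp d) {a b : ℝ}
    (hab : a < b) (hb : gaussScore μ S μ < b) :
    (multivariateGaussian μ S).real {y | gaussScore μ S y ≤ a} <
      (multivariateGaussian μ S).real {y | gaussScore μ S y ≤ b} := by
  have hc := continuous_gaussScore hS μ
  set W := {y | a < gaussScore μ S y ∧ gaussScore μ S y < b}
  have hW : IsOpen W := (isOpen_lt continuous_const hc).inter (isOpen_lt hc continuous_const)
  have hne : W.Nonempty := by
    obtain ⟨y, hy⟩ := exists_gaussScore_eq hd hS μ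
      (le_max_right ((a + b) / 2) (gaussScore μ S μ))
    refine ⟨y, ?_, ?_⟩
    · rw [hy]
      exact lt_max_of_lt_left (by linarith)
    · rw [hy]
      exact max_lt (by linarith) hb
  have hpos : 0 < (multivariateGaussian μ S).real W := by
    refine ENNReal.toReal_pos (fun h0 => ?_) (measure_ne_top _ _)
    exact (hW.measure_pos volume hne).ne' (volume_absolutelyContinuous_multivariateGaussian hS μ h0)
  have hdis : Disjoint {y | gaussScore μ S y ≤ a} W :=
    Set.disjoint_left.2 fun y hy hy' => not_lt.2 hy hy'.1
  have hle : (multivariateGaussian μ S).real ({y | gaussScore μ S y ≤ a} ∪ W) ≤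
      (multivariateGaussian μ S).real {y | gaussScore μ S y ≤ b} := by
    refine measureReal_mono ?_
    rintro y (hy | hy)
    · exact (le_of_lt (lt_of_le_of_lt hy hab))
    · exact hy.2.le
  rw [measureReal_union hdis hW.measurableSet] at hle
  linarith

end Strictness

/-- With probability tending to one the CP4Gen set lies between two level sets of the density that
are as close to the optimal one as desired. -/
theorem IsSample.tendsto_measure_not_sandwich (hd : 0 < d) (hS : S.PosDef)
    (h : IsSample P PX (multivariateGaussian μ S) X Y Yhat) {α : ℝ} (hα0 : 0 < α) (hα1 : α < 1)
    {q : ℝ} (hq : (multivariateGaussian μ S).real {y | gaussScore μ S y ≤ q} = 1 - α)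
    (hμq : gaussScore μ S μ < q) {β : ℕ → ℝ} (hβ : Tendsto β atTop (𝓝 0)) {η : ℝ} (hη : 0 < η) :
    Tendsto (fun p : ℕ × ℕ => P {ω | ¬ ({y | gaussScore μ S y ≤ q - 2 * η} ⊆
      cp4genSet Y Yhat α (β p.1) p.1 p.2 ω ∧ cp4genSet Y Yhat α (β p.1) p.1 p.2 ω ⊆
      {y | gaussScore μ S y ≤ q + 2 * η})}) (atTop ×ˢ atTop) (𝓝 0) := by
  classical
  have hc := continuous_gaussScore hS μ
  have hms : ∀ t, MeasurableSet {y | gaussScore μ S y ≤ t} := fun t =>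
    (isClosed_le hc continuous_const).measurableSet
  have hup := measureReal_gaussScore_le_lt hd hS μ (by linarith : q < q + η / 2) (by linarith)
  have hlow := measureReal_gaussScore_le_lt hd hS μ (by linarith : q - η / 2 < q) hμq
  rw [hq] at hup hlow
  set Fu := (multivariateGaussian μ S).real {y | gaussScore μ S y ≤ q + η / 2}
  set Fl := (multivariateGaussian μ S).real {y | gaussScore μ S y ≤ q - η / 2}
  obtain ⟨κ, hκ0, hκu, hκl⟩ : ∃ κ : ℝ, 0 < κ ∧ 1 - α + 2 * κ < Fu ∧ Fl < 1 - α - 2 * κ := by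
    refine ⟨min (Fu - (1 - α)) (1 - α - Fl) / 3, by
      have := lt_min (sub_pos.2 hup) (sub_pos.2 hlow)
      positivity, ?_, ?_⟩
    · have := min_le_left (Fu - (1 - α)) (1 - α - Fl)
      linarith
    · have := min_le_right (Fu - (1 - α)) (1 - α - Fl)
      linarith
  obtain ⟨U, hU, hUo, hUm⟩ := eventually_nhds_iff.1 ((eventually_gaussScore_sandwich hS μ q hη).and
    ((Continuous.matrix_det continuous_snd).continuousAt.eventually_const_lt
      (show 0 < ((μ, S) : Resp d × Matrix (Fin d) (Fin d) ℝ).2.det from hS.det_pos)))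
  obtain ⟨c₁, hc₁, hE₁⟩ := h.tendsto_measure_fit_notMem hS hβ hUo hUm
  obtain ⟨c₃, hc₃, hE₃⟩ := h.tendsto_measure_score_sub hS hβ (half_pos hη)
  set cu : ℕ → Ω → ℝ := fun N ω =>
    ((Finset.univ.filter fun i : Fin N => gaussScore μ S (Y i ω) ≤ q + η / 2).card : ℝ)
  set cl : ℕ → Ω → ℝ := fun N ω =>
    ((Finset.univ.filter fun i : Fin N => gaussScore μ S (Y i ω) ≤ q - η / 2).card : ℝ)
  set A : ℕ → Set Ω := fun N =>
    {ω | cu N ω < (1 - α + 2 * κ) * N} ∪ {ω | (1 - α - 2 * κ) * N < cl N ω} with hA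
  have hAlim : Tendsto (fun N => P (A N)) atTop (𝓝 0) := by
    refine tendsto_measure_zero_of_ae_eventually (fun N => ?_) ?_
    · have hm : ∀ t, Measurable fun ω =>
          ((Finset.univ.filter fun i : Fin N => gaussScore μ S (Y i ω) ≤ t).card : ℝ) := fun t => by
        convert measurable_card_filter_mem (D := fun i => Y i ⁻¹' {y | gaussScore μ S y ≤ t})
          (fun i => h.measurable_Y i (hms t)) N
        exact Iff.rfl
      exact (measurableSet_lt (hm _) measurable_const).union
        (measurableSet_lt measurable_const (hm _))
    · filter_upwards [h.ae_tendsto_frequency (hms (q + η / 2)),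
        h.ae_tendsto_frequency (hms (q - η / 2))] with ω h1 h2
      filter_upwards [h1.eventually_const_lt hκu, h2.eventually_lt_const hκl,
        eventually_gt_atTop 0] with N hN1 hN2 hN
      have hN0 : (0 : ℝ) < N := by exact_mod_cast hN
      rw [lt_div_iff₀ hN0] at hN1
      rw [div_lt_iff₀ hN0] at hN2
      rintro (hb | hb)
      · have hb' : cu N ω < (1 - α + 2 * κ) * N := hb
        refine lt_asymm hN1 ?_
        convert hb'
      · have hb' : (1 - α - 2 * κ) * N < cl N ω := hb
        refine lt_asymm hN2 ?_
        convert hb'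
  have hsum : Tendsto (fun p : ℕ × ℕ => c₁ p.1 + P (A p.2) + (ENNReal.ofReal κ)⁻¹ * c₃ p.1)
      (atTop ×ˢ atTop) (𝓝 0) := by
    have h3 := ENNReal.Tendsto.const_mul (a := (ENNReal.ofReal κ)⁻¹) hc₃
      (Or.inr (ENNReal.inv_ne_top.2 (ENNReal.ofReal_pos.2 hκ0).ne'))
    have h4 : Tendsto (fun p : ℕ × ℕ => c₁ p.1) (atTop ×ˢ atTop) (𝓝 0) := hc₁.comp tendsto_fst
    have h5 : Tendsto (fun p : ℕ × ℕ => P (A p.2)) (atTop ×ˢ atTop) (𝓝 0) :=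
      hAlim.comp tendsto_snd
    have h6 : Tendsto (fun p : ℕ × ℕ => (ENNReal.ofReal κ)⁻¹ * c₃ p.1) (atTop ×ˢ atTop)
      (𝓝 ((ENNReal.ofReal κ)⁻¹ * 0)) := h3.comp tendsto_fst
    simpa using (h4.add h5).add h6
  refine tendsto_of_tendsto_of_tendsto_of_le_of_le' tendsto_const_nhds hsum
    (Eventually.of_forall fun _ => zero_le) ?_
  have hκN : ∀ᶠ N : ℕ in atTop, 1 ≤ κ * N :=
    (tendsto_natCast_atTop_atTop.const_mul_atTop hκ0).eventually_ge_atTop 1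
  filter_upwards [(eventually_ge_atTop 1).prod_mk hκN] with ⟨M, N⟩ ⟨hM, hN⟩
  have hN1 : 1 ≤ N := by
    by_contra hc
    have : N = 0 := by lia
    simp only [this] at hN
    norm_num at hN
  have hE₃' := measure_card_filter_gt_le (P := P) hN1 (fun i => (hE₃ M i).1) (fun i => (hE₃ M i).2)
    hκ0
  refine (measure_mono (t := ({ω | (ensMean (ensemble Yhat M ω N),
    ensCov (β M) (ensemble Yhat M ω N)) ∉ U} ∪ A N) ∪ _) fun ω hω => ?_).trans
    ((measure_union_le _ _).trans (add_le_add ((measure_union_le _ _).trans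
      (add_le_add (hE₁ M N) le_rfl)) hE₃'))
  by_contra hgood
  simp only [Set.mem_union, not_or, Set.mem_ofPred_eq, not_not, hA, not_lt] at hgood
  obtain ⟨⟨hg1, hg2, hg3⟩, hg4⟩ := hgood
  obtain ⟨hsand, hdet⟩ := hU _ hg1
  have hpd : (ensCov (β M) (ensemble Yhat M ω N)).PosDef :=
    (posSemidef_ensCov _ _).posDef_iff_det_ne_zero.2 hdet.ne'
  obtain ⟨hs1, hs2⟩ := hsand hpd
  refine hω (conformalSet_sandwich hM hα0 hα1 hN (fun i => Y i ω) (ensemble Yhat M ω) hs1 hs2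
    hg2 hg3 ?_)
  convert hg4 using 3

end Concentration

end ConformalGen

namespace ConformalGen

/-! ### Asymptotic volume optimality of CP4Gen -/

section Optimality

variable {Ω 𝒳 : Type*} [MeasurableSpace Ω] [MeasurableSpace 𝒳] {P : Measure Ω}
  [IsProbabilityMeasure P] {PX : Measure 𝒳} [IsProbabilityMeasure PX] {d : ℕ} {μ : Resp d}
  {S : Matrix (Fin d) (Fin d) ℝ}
  {X : ℕ → Ω → 𝒳} {Y : ℕ → Ω → Resp d} {Yhat : ℕ → ℕ → Ω → Resp d}

/-- Thin shells around a level set of the density have small volume. -/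
lemma exists_volume_shell_le (hd : 0 < d) (hS : S.PosDef) (μ : Resp d) (q : ℝ) {ε : ℝ≥0∞}
    (hε : 0 < ε) :
    ∃ η : ℝ, 0 < η ∧
      volume {y | q - 2 * η ≤ gaussScore μ S y ∧ gaussScore μ S y ≤ q + 2 * η} ≤ ε := by
  have hc := continuous_gaussScore hS μ
  set D : ℕ → Set (Resp d) := fun n => {y | q - 2 * (1 / ((n : ℝ) + 1)) ≤ gaussScore μ S y ∧
    gaussScore μ S y ≤ q + 2 * (1 / ((n : ℝ) + 1))}
  have hDm : ∀ n, MeasurableSet (D n) := fun n =>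
    ((isClosed_le continuous_const hc).inter (isClosed_le hc continuous_const)).measurableSet
  have hanti : Antitone D := fun a b hab y hy => by
    have h1 : 1 / ((b : ℝ) + 1) ≤ 1 / ((a : ℝ) + 1) := Nat.one_div_le_one_div hab
    exact ⟨by linarith [hy.1], by linarith [hy.2]⟩
  have hfin : volume (D 0) ≠ ∞ := by
    refine ((measure_mono fun y hy => ?_).trans_lt
      (volume_superlevelSet_lt_top hS μ (Real.exp_pos (-(q + 2))))).ne
    refine (gaussScore_le_neg_log_iff hS μ (Real.exp_pos _) y).1 ?_
    rw [Real.log_exp, neg_neg]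
    have := hy.2
    norm_num at this
    exact this
  have hlim := tendsto_measure_iInter_atTop (μ := (volume : Measure (Resp d)))
    (fun n => (hDm n).nullMeasurableSet) hanti ⟨0, hfin⟩
  have hnull : volume (⋂ n, D n) = 0 := by
    refine measure_mono_null (fun y hy => ?_) (volume_gaussianDensity_eq hd hS μ (Real.exp (-q)))
    have hy' : ∀ n : ℕ, |gaussScore μ S y - q| ≤ 2 * (1 / ((n : ℝ) + 1)) := fun n => by
      have := Set.mem_iInter.1 hy n
      exact abs_le.2 ⟨by linarith [this.1], by linarith [this.2]⟩
    have h0 : |gaussScore μ S y - q| ≤ 2 * 0 :=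
      ge_of_tendsto' (tendsto_one_div_add_atTop_nhds_zero_nat.const_mul 2) hy'
    have h1 : gaussScore μ S y = q := by
      rw [mul_zero] at h0
      exact sub_eq_zero.1 (abs_eq_zero.1 (le_antisymm h0 (abs_nonneg _)))
    change gaussianDensity μ S y = Real.exp (-q)
    rw [← h1, gaussScore, neg_neg, Real.exp_log (gaussianDensity_pos hS μ y)]
  rw [hnull] at hlim
  obtain ⟨n, hn⟩ := (hlim.eventually_le_const hε).exists
  exact ⟨1 / ((n : ℝ) + 1), Nat.one_div_pos_of_nat, hn⟩

lemma le_mul_sq_add_inv {κ : ℝ≥0∞} (hκ0 : κ ≠ 0) (hκt : κ ≠ ∞) (v : ℝ≥0∞) :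
    v ≤ κ * v ^ 2 + κ⁻¹ := by
  rcases le_total v κ⁻¹ with h | h
  · exact h.trans le_add_self
  · refine le_trans ?_ le_self_add
    calc v = κ * κ⁻¹ * v := by rw [ENNReal.mul_inv_cancel hκ0 hκt, one_mul]
      _ ≤ κ * v * v := by gcongr
      _ = κ * v ^ 2 := by ring

/-- The volume of the difference between the CP4Gen set and the optimal set has a measurable
majorant of small mean: off an event of small probability the difference lies in a thin shell, and
on that event the volume is controlled by its second moment. -/
theorem IsSample.eventually_exists_majorant (hd : 0 < d) (hS : S.PosDef)
    (h : IsSample P PX (multivariateGaussian μ S) X Y Yhat) {α : ℝ} (hα0 : 0 < α) (hα1 : α < 1)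
    {q : ℝ} (hq : (multivariateGaussian μ S).real {y | gaussScore μ S y ≤ q} = 1 - α)
    (hμq : gaussScore μ S μ < q) (hCfin : volume {y | gaussScore μ S y ≤ q} ≠ ∞)
    {β : ℕ → ℝ} (hβ : Tendsto β atTop (𝓝 0)) {ε : ℝ≥0∞} (hε : 0 < ε) :
    ∀ᶠ p : ℕ × ℕ in atTop ×ˢ atTop, ∃ B : Ω → ℝ≥0∞, Measurable B ∧ ∫⁻ ω, B ω ∂P ≤ ε ∧
      ∀ᵐ ω ∂P, volume (symmDiff (cp4genSet Y Yhat α (β p.1) p.1 p.2 ω)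
        {y | gaussScore μ S y ≤ q}) ≤ B ω := by
  have hε3 : 0 < ε / 3 := ENNReal.div_pos hε.ne' (by simp)
  set C := {y | gaussScore μ S y ≤ q}
  obtain ⟨η, hη, hshell⟩ := exists_volume_shell_le hd hS μ q hε3
  set D := {y | q - 2 * η ≤ gaussScore μ S y ∧ gaussScore μ S y ≤ q + 2 * η}
  obtain ⟨K, hK, M₀, hM₀, hV⟩ := h.exists_volume_sq_bound hd hS hα0 hα1
  obtain ⟨κ, hκ0, hκK⟩ := ENNReal.exists_nnreal_pos_mul_lt hK hε3.ne'
  have hκ0' : (κ : ℝ≥0∞) ≠ 0 := by exact_mod_cast hκ0.ne'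
  have hc : (κ : ℝ≥0∞)⁻¹ + volume C ≠ ∞ :=
    ENNReal.add_ne_top.2 ⟨ENNReal.inv_ne_top.2 hκ0', hCfin⟩
  have hbad := ENNReal.Tendsto.const_mul (a := (κ : ℝ≥0∞)⁻¹ + volume C)
    (h.tendsto_measure_not_sandwich hd hS hα0 hα1 hq hμq hβ hη) (Or.inr hc)
  rw [mul_zero] at hbad
  have hβ1 : ∀ᶠ M in atTop, β M ^ 2 ≤ 1 := by
    have := hβ.pow 2
    exact this.eventually_le_const (by norm_num)
  have hN2 : ∀ᶠ N : ℕ in atTop, 2 ≤ α * N :=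
    (tendsto_natCast_atTop_atTop.const_mul_atTop hα0).eventually_ge_atTop 2
  filter_upwards [hbad.eventually_le_const hε3,
    ((eventually_ge_atTop M₀).and hβ1).prod_mk hN2] with ⟨M, N⟩ hP ⟨⟨hM, hβM⟩, hN⟩
  obtain ⟨V, hVm, hVK, hVle⟩ := hV M hM N hN (β M) hβM
  set E := toMeasurable P {ω | ¬ ({y | gaussScore μ S y ≤ q - 2 * η} ⊆
      cp4genSet Y Yhat α (β M) M N ω ∧ cp4genSet Y Yhat α (β M) M N ω ⊆
      {y | gaussScore μ S y ≤ q + 2 * η})} with hE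
  have hEm : MeasurableSet E := measurableSet_toMeasurable _ _
  have hm : Measurable fun ω => volume D + κ * V ω := measurable_const.add (hVm.const_mul _)
  refine ⟨fun ω => volume D + κ * V ω +
    E.indicator (fun _ => (κ : ℝ≥0∞)⁻¹ + volume C) ω, ?_, ?_, ?_⟩
  · exact hm.add (measurable_const.indicator hEm)
  · beta_reduce
    rw [lintegral_add_left hm,
      lintegral_add_left measurable_const, lintegral_const, measure_univ, mul_one,
      lintegral_const_mul _ hVm, lintegral_indicator_const hEm, hE, measure_toMeasurable]
    calc _ ≤ ε / 3 + ε / 3 + ε / 3 := by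
          refine add_le_add (add_le_add hshell ?_) hP
          exact (mul_le_mul_right hVK _).trans hκK.le
      _ = ε := ENNReal.add_thirds ε
  · filter_upwards [hVle] with ω hω
    by_cases hωE : ω ∈ E
    · rw [Set.indicator_of_mem hωE]
      have hsub : symmDiff (cp4genSet Y Yhat α (β M) M N ω) C ⊆
          cp4genSet Y Yhat α (β M) M N ω ∪ C := symmDiff_le_sup
      calc _ ≤ volume (cp4genSet Y Yhat α (β M) M N ω) + volume C :=
            (measure_mono hsub).trans (measure_union_le _ _)
        _ ≤ (κ * V ω + (κ : ℝ≥0∞)⁻¹) + volume C := by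
          gcongr
          refine (le_mul_sq_add_inv hκ0' ENNReal.coe_ne_top _).trans ?_
          gcongr
        _ ≤ _ := by
          rw [add_assoc]
          gcongr
          exact le_add_self
    · have hgood := not_not.1 fun hb => hωE (subset_toMeasurable P _ hb)
      refine le_trans (measure_mono ?_) (le_self_add.trans le_self_add)
      rintro y (⟨hy1, hy2⟩ | ⟨hy1, hy2⟩)
      · have h1 : gaussScore μ S y ≤ q + 2 * η := hgood.2 hy1
        have h2 : q < gaussScore μ S y := not_le.1 hy2
        exact ⟨by linarith, h1⟩
      · have h1 : gaussScore μ S y ≤ q := hy1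
        have h2 : q - 2 * η < gaussScore μ S y := not_le.1 fun hc => hy2 (hgood.1 hc)
        exact ⟨h2.le, by linarith⟩

/-- CP4Gen with one cluster is asymptotically volume-optimal. -/
theorem IsSample.tendsto_lintegral_cp4genSet (hd : 0 < d) (hS : S.PosDef)
    (h : IsSample P PX (multivariateGaussian μ S) X Y Yhat) {α : ℝ} (hα0 : 0 < α) (hα1 : α < 1)
    {τ : ℝ} (hτ : 0 < τ)
    (hmass : multivariateGaussian μ S (superlevelSet (gaussianDensity μ S) τ) =
      ENNReal.ofReal (1 - α)) {β : ℕ → ℝ} (hβ : Tendsto β atTop (𝓝 0)) :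
    Tendsto (fun p : ℕ × ℕ => ∫⁻ ω, volume (symmDiff (cp4genSet Y Yhat α (β p.1) p.1 p.2 ω)
      (superlevelSet (gaussianDensity μ S) τ)) ∂P) (atTop ×ˢ atTop) (𝓝 0) ∧
    Tendsto (fun p : ℕ × ℕ => ∫⁻ ω, volume (cp4genSet Y Yhat α (β p.1) p.1 p.2 ω) ∂P)
      (atTop ×ˢ atTop) (𝓝 (volume (superlevelSet (gaussianDensity μ S) τ))) := by
  have hC : superlevelSet (gaussianDensity μ S) τ = {y | gaussScore μ S y ≤ -Real.log τ} := by
    ext y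
    exact (gaussScore_le_neg_log_iff hS μ hτ y).symm
  have hfin := (volume_superlevelSet_lt_top hS μ hτ).ne
  have hlt := lt_gaussianDensity_of_mass_pos hd hS μ (by
    rw [hmass]
    exact (ENNReal.ofReal_pos.2 (sub_pos.2 hα1)).ne')
  rw [hC] at hmass hfin ⊢
  have hq : (multivariateGaussian μ S).real {y | gaussScore μ S y ≤ -Real.log τ} = 1 - α := by
    rw [measureReal_def, hmass, ENNReal.toReal_ofReal (sub_pos.2 hα1).le]
  have hμq : gaussScore μ S μ < -Real.log τ := neg_lt_neg (Real.log_lt_log hτ hlt)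
  have hmaj := fun (ε : ℝ≥0∞) (hε : 0 < ε) =>
    h.eventually_exists_majorant hd hS hα0 hα1 hq hμq hfin hβ hε
  set C := {y | gaussScore μ S y ≤ -Real.log τ}
  refine ⟨ENNReal.tendsto_nhds_zero.2 fun ε hε => ?_,
    (ENNReal.tendsto_nhds hfin).2 fun ε hε => ?_⟩
  · filter_upwards [hmaj ε hε] with p ⟨B, _, hBε, hle⟩
    exact (lintegral_mono_ae hle).trans hBε
  · filter_upwards [hmaj ε hε] with p ⟨B, hBm, hBε, hle⟩
    refine ⟨?_, ?_⟩
    · rw [tsub_le_iff_right]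
      calc volume C = ∫⁻ _, volume C ∂P := by simp
        _ ≤ ∫⁻ ω, (volume (cp4genSet Y Yhat α (β p.1) p.1 p.2 ω) + B ω) ∂P := by
          refine lintegral_mono_ae ?_
          filter_upwards [hle] with ω hω
          refine (measure_mono (t := cp4genSet Y Yhat α (β p.1) p.1 p.2 ω ∪
            symmDiff (cp4genSet Y Yhat α (β p.1) p.1 p.2 ω) C) fun y hy => ?_).trans
            ((measure_union_le _ _).trans (by gcongr))
          by_cases hy' : y ∈ cp4genSet Y Yhat α (β p.1) p.1 p.2 ω
          · exact Or.inl hy'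
          · exact Or.inr (Or.inr ⟨hy, hy'⟩)
        _ ≤ _ := by
          rw [lintegral_add_right _ hBm]
          gcongr
    · calc ∫⁻ ω, volume (cp4genSet Y Yhat α (β p.1) p.1 p.2 ω) ∂P
          ≤ ∫⁻ ω, (volume C + B ω) ∂P := by
            refine lintegral_mono_ae ?_
            filter_upwards [hle] with ω hω
            refine (measure_mono (t := C ∪ symmDiff (cp4genSet Y Yhat α (β p.1) p.1 p.2 ω) C)
              fun y hy => ?_).trans ((measure_union_le _ _).trans (by gcongr))
            by_cases hy' : y ∈ C
            · exact Or.inl hy'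
            · exact Or.inr (Or.inl ⟨hy, hy'⟩)
        _ = volume C + ∫⁻ ω, B ω ∂P := by
          rw [lintegral_add_left measurable_const, lintegral_const, measure_univ, mul_one]
        _ ≤ _ := by gcongr

end Optimality

end ConformalGen

open ConformalGen in
theorem proposition1 {Ω 𝒳 : Type*} [MeasurableSpace Ω] [MeasurableSpace 𝒳]
    (P : Measure Ω) [IsProbabilityMeasure P] (PX : Measure 𝒳) [IsProbabilityMeasure PX]
    {d : ℕ} (hd : 0 < d) (μ : Resp d) (S : Matrix (Fin d) (Fin d) ℝ) (hS : S.PosDef)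
    (X : ℕ → Ω → 𝒳) (Y : ℕ → Ω → Resp d) (Yhat : ℕ → ℕ → Ω → Resp d)
    (hdata : IsSample P PX (multivariateGaussian μ S) X Y Yhat)
    (α : ℝ) (hα0 : 0 < α) (hα1 : α < 1) :
    ∃ τ : ℝ, 0 < τ ∧
      -- `C` is the highest-density set of mass `1 - α` of the true Gaussian
      ∃ C : Set (Resp d), C = superlevelSet (gaussianDensity μ S) τ ∧
      multivariateGaussian μ S C = ENNReal.ofReal (1 - α) ∧
      -- no random set of mean mass at least `1 - α` has a smaller expected volume
      (∀ A : Set (Ω × Resp d), MeasurableSet A →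
        ENNReal.ofReal (1 - α) ≤ ∫⁻ ω, multivariateGaussian μ S (Prod.mk ω ⁻¹' A) ∂P →
        volume C ≤ ∫⁻ ω, volume (Prod.mk ω ⁻¹' A) ∂P) ∧
      -- CP4Gen: convergence to `C`, and of the expected volume to the optimal one
      (∀ β : ℕ → ℝ, Tendsto β atTop (𝓝 0) →
        Tendsto (fun p : ℕ × ℕ =>
          ∫⁻ ω, volume (symmDiff (cp4genSet Y Yhat α (β p.1) p.1 p.2 ω) C) ∂P)
          (atTop ×ˢ atTop) (𝓝 0) ∧
        Tendsto (fun p : ℕ × ℕ => ∫⁻ ω, volume (cp4genSet Y Yhat α (β p.1) p.1 p.2 ω) ∂P)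
          (atTop ×ˢ atTop) (𝓝 (volume C))) ∧
      -- PCP: the set is the whole space or a union of equal balls around the ensemble members
      (∀ M N : ℕ, 1 ≤ M → ∀ ω, pcpSet Y Yhat α M N ω = Set.univ ∨
        ∃ r : ℝ, 0 ≤ r ∧ pcpSet Y Yhat α M N ω = ⋃ m : Fin M, Metric.closedBall (Yhat N m ω) r) ∧
      -- PCP is the conformal set of the largest-term score of a kernel density estimate
      (∀ M N : ℕ, 1 ≤ M → ∀ σ : ℝ, 0 < σ → ∀ ω, pcpSet Y Yhat α M N ω =
        conformalSet (kdeMaxScore (M := M) σ) α N (fun i => Y i ω) (ensemble Yhat M ω)) ∧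
      -- for bandwidths `o(M^(-1/d))` that score is asymptotically the negative log-density of the
      -- kernel density estimate, and that estimate is inconsistent at every point
      (∀ σ : ℕ → ℝ, (∀ M, 0 < σ M) →
        σ =o[atTop] (fun M : ℕ => (M : ℝ) ^ (-(1 / (d : ℝ)))) → ∀ (i : ℕ) (y : Resp d),
        TendstoInMeasure P (fun M ω => kdeMaxScore (σ M) (ensemble Yhat M ω i) y -
          kdeScore (σ M) (ensemble Yhat M ω i) y) atTop (fun _ => 0) ∧
        ¬ TendstoInMeasure P (fun M ω => kde (σ M) (ensemble Yhat M ω i) y) atTop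
          (fun _ => gaussianDensity μ S y)) ∧
      -- the expected PCP volume exceeds the optimal one by an amount that does not vanish
      (∃ δ : ℝ, 0 < δ ∧ ∀ M N : ℕ, 1 ≤ M →
        volume C + ENNReal.ofReal δ ≤ ∫⁻ ω, volume (pcpSet Y Yhat α M N ω) ∂P) := by
  obtain ⟨τ, hτ, hmass⟩ := exists_superlevelSet_mass hd hS μ hα0 hα1
  refine ⟨τ, hτ, superlevelSet (gaussianDensity μ S) τ, rfl, hmass, ?_, ?_, ?_, ?_, ?_, ?_⟩
  · intro A hA hA'
    exact volume_superlevelSet_le_lintegral P hS μ hτ hA (hmass.le.trans hA')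
  · exact fun β hβ => hdata.tendsto_lintegral_cp4genSet hd hS hα0 hα1 hτ hmass hβ
  · exact fun M N hM ω => conformalSet_pcpScore_eq hM hα1 N _ _
  · exact fun M N hM σ hσ ω => conformalSet_pcpScore_eq_kdeMaxScore hM hσ hα1 N _ _
  · exact fun σ hσ ho i y => ⟨hdata.tendstoInMeasure_kdeMaxScore_sub hd hS hσ ho i y,
      hdata.not_tendstoInMeasure_kde hd hS hσ ho i y⟩
  · exact hdata.exists_excess_volume hd hS hα0 hα1 hτ hmass
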